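/- **Conventions.** Let $\mathcal H$ be the upper half-plane. A *singular function* is a function $f(\tau,z)$, holomorphic on $\{(\tau,z)\in\mathcal H\times\mathbb C : z\notin\mathbb Z\oplus\tau\mathbb Z\}$, $1$-periodic in $\tau$ and in $z$, such that for every $\tau$ the function $z\mapsto f(\tau,z)$ is meromorphic on $\mathbb C$ with poles contained in $\mathbb Z\oplus\tau\mathbb Z$, of order bounded by an integer that depends on neither $\tau$ nor the pole, and such that every Laurent coefficient $A(\tau)$ of $z\mapsto f(\tau,z)$ at $z=0$ is holomorphic on $\mathcal H$ with an expansion $A(\tau)=\sum_{r\ge 0}\widehat A(r)e^{2i\pi r\tau}$. (Functions are considered off the lattice points; their values there are irrelevant.) For $A=\left(\begin{pmatrix}a&b\\c&d\end{pmatrix},(\lambda,\mu)\right)\in \mathrm{SL}(2,\mathbb Z)\ltimes\mathbb Z^2$ put $$(f|_kA)(\tau,z)=(c\tau+d)^{-k}f\!\left(\frac{a\tau+b}{c\tau+d},\frac{z+\lambda\tau+\mu}{c\tau+d}\right),\quad X(A)=\frac{c}{c\tau+d},\quad Y(A)=\frac{cz+c\mu-d\lambda}{c\tau+d}.$$ For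 $k\ge 0$, let $\mathrm{JS}^\infty_k$ be the vector space of quasi-Jacobi singular forms of index zero and weight $k$: the singular functions $f$ for which there are finitely many singular functions $f_{i,j}$ with $f|_kA=\sum_{i,j}f_{i,j}X(A)^iY(A)^j$ for all $A\in\mathrm{SL}(2,\mathbb Z)\ltimes\mathbb Z^2$. Let $\mathrm{JS}^\infty=\bigoplus_{k\ge0}\mathrm{JS}^\infty_k$, an algebra graded by the weight; let $\partial_\tau=\frac{\pi}{2i}\frac{\partial}{\partial\tau}$; and let $\mathrm M$ be the algebra of modular forms on $\mathrm{SL}(2,\mathbb Z)$, regarded as functions of $(\tau,z)$ that do not depend on $z$. A *formal deformation* of a commutative $\mathbb C$-algebra $R$ is a sequence $(\mu_n)_{n\ge0}$ of $\mathbb C$-bilinear maps $R\times R\to R$ such that $\mu_0$ is the product of $R$ and the product on $R[[\hbar]]$ given by $\left(\sum_i a_i\hbar^i\right)\star\left(\sum_j b_j\hbar^j\right)=\sum_{n,i,j}\mu_n(a_i,b_j)\hbar^{n+i+j}$ is associative, with unit $1$. **Proposition.** There is exactly one sequence $([\cdot,\cdot]_n)_{n\geq 0}$ of $\mathbb C$-bilinear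 maps $\mathrm{JS}^{\infty}\times \mathrm{JS}^{\infty}\to\mathrm{JS}^{\infty}$ such that, for all $n,k,\ell\ge0$, $f\in\mathrm{JS}^\infty_k$ and $g\in\mathrm{JS}^\infty_\ell$, $$[f,g]_n=\sum_{r=0}^n(-1)^r\binom{k+n-1}{n-r}\binom{\ell+n-1}{r}\,\partial_\tau^r(f)\,\partial_\tau^{n-r}(g).$$ Moreover: (i) $[\mathrm{JS}^\infty_k,\mathrm{JS}^\infty_\ell]_n\subseteq\mathrm{JS}^\infty_{k+\ell+2n}$ for all $n,k,\ell\geq 0$. (ii) The sequence $([\cdot,\cdot]_n)_{n\ge0}$ is a formal deformation of $\mathrm{JS}^\infty$. (iii) $\mathrm M$ is a subalgebra of $\mathrm{JS}^\infty$ that is stable under all the maps $[\cdot,\cdot]_n$, and their restrictions to $\mathrm M$ are the classical Rankin–Cohen brackets: if $f$ and $g$ are modular forms of weights $k$ and $\ell$, then $[f,g]_n$ is a modular form of weight $k+\ell+2n$, equal to $\pi^{2n}$ times the classical Rankin–Cohen bracket $\sum_{r=0}^n(-1)^r\binom{k+n-1}{n-r}\binom{\ell+n-1}{r}D^r(f)D^{n-r}(g)$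 built from $D=\frac1{2i\pi}\frac{d}{d\tau}$ (note that $\partial_\tau=\pi^2D$). -/

import Mathlib

open UpperHalfPlane hiding I
open Complex Filter Topology
open scoped MatrixGroups Manifold Derivative

namespace QuasiJacobi

noncomputable section

/-- The points `(τ, z)` with `Im τ > 0` and `z` outside the lattice `ℤ ⊕ τℤ`. All functions
considered here have their poles (in `z`) in `ℤ ⊕ τℤ`; they are functions on this set. -/
def dom : Set (ℂ × ℂ) :=
  {p | 0 < p.1.im ∧ ∀ m n : ℤ, p.2 ≠ (m : ℂ) + (n : ℂ) * p.1}

open Classical in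
/-- Extension by zero to `ℂ × ℂ` of a function on `dom`. Used only to speak about
differentiability, periodicity and meromorphy; the values off `dom` never matter. -/
def ext (f : dom → ℂ) (p : ℂ × ℂ) : ℂ := if h : p ∈ dom then f ⟨p, h⟩ else 0

lemma ext_of_mem (f : dom → ℂ) {p : ℂ × ℂ} (h : p ∈ dom) : ext f p = f ⟨p, h⟩ := by
  simp [ext, h]

lemma ext_add (f g : dom → ℂ) (p : ℂ × ℂ) : ext (f + g) p = ext f p + ext g p := by
  by_cases h : p ∈ dom <;> simp [ext, h]

lemma ext_mul (f g : dom → ℂ) (p : ℂ × ℂ) : ext (f * g) p = ext f p * ext g p := by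
  by_cases h : p ∈ dom <;> simp [ext, h]

lemma ext_algebraMap (c : ℂ) {p : ℂ × ℂ} (h : p ∈ dom) :
    ext (algebraMap ℂ (dom → ℂ) c) p = c := by
  simp [ext, h]

/-! ### Singular functions -/

/-- `a : ℍ → ℂ` is holomorphic on `ℍ` and at infinity: it has an expansion
`a(τ) = ∑_{r ≥ 0} c_r exp(2 i π r τ)`. -/
def IsHoloAtInfty (a : ℍ → ℂ) : Prop :=
  MDiff a ∧
    ∃ c : ℕ → ℂ, ∀ τ : ℍ, HasSum (fun r : ℕ => c r * cexp (2 * Real.pi * I * r * τ)) (a τ)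

/-- `f` has a Laurent expansion `f(τ, z) = ∑_{n ≥ 0} A_n(τ) z^(n - N)` around `z = 0`, whose
coefficients are holomorphic on `ℍ` and at infinity. -/
def HasLaurent (f : dom → ℂ) (N : ℕ) : Prop :=
  ∃ A : ℕ → ℍ → ℂ, (∀ n, IsHoloAtInfty (A n)) ∧
    ∀ τ : ℍ, ∀ᶠ z in 𝓝[≠] (0 : ℂ),
      HasSum (fun n : ℕ => A n τ * z ^ ((n : ℤ) - (N : ℤ))) (ext f (τ, z))

/-- For every `τ`, the function `z ↦ f(τ, z)` is meromorphic at every point of `ℤ ⊕ τℤ`, with a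
pole of order at most `N` (or no pole). -/
def PolesBoundedBy (f : dom → ℂ) (N : ℕ) : Prop :=
  ∀ (τ : ℍ) (m n : ℤ),
    MeromorphicAt (fun z : ℂ => ext f (τ, z)) ((m : ℂ) + (n : ℂ) * (τ : ℂ)) ∧
    ((-(N : ℤ) : ℤ) : WithTop ℤ) ≤
      meromorphicOrderAt (fun z : ℂ => ext f (τ, z)) ((m : ℂ) + (n : ℂ) * (τ : ℂ))

/-- Singular functions: holomorphic in `(τ, z)` off the lattice points, `1`-periodic in `z` and
in `τ`, with poles at lattice points only, of order bounded independently of `τ`, and with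
Laurent coefficients at `z = 0` holomorphic on `ℍ` and at infinity. -/
structure IsSingular (f : dom → ℂ) : Prop where
  holo : DifferentiableOn ℂ (ext f) dom
  periodic_z : ∀ τ z : ℂ, ext f (τ, z + 1) = ext f (τ, z)
  periodic_tau : ∀ τ z : ℂ, ext f (τ + 1, z) = ext f (τ, z)
  poles : ∃ N : ℕ, PolesBoundedBy f N
  laurent : ∃ N : ℕ, HasLaurent f N

/-! ### Singular functions form an algebra -/

lemma isHoloAtInfty_const (c : ℂ) : IsHoloAtInfty (fun _ => c) := by
  refine ⟨mdifferentiable_const, fun r => if r = 0 then c else 0, fun τ => ?_⟩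
  convert hasSum_ite_eq (0 : ℕ) c using 2 with r
  split_ifs with h <;> simp [h]

lemma IsHoloAtInfty.add {a b : ℍ → ℂ} (ha : IsHoloAtInfty a) (hb : IsHoloAtInfty b) :
    IsHoloAtInfty (a + b) := by
  obtain ⟨c, hc⟩ := ha.2
  obtain ⟨d, hd⟩ := hb.2
  refine ⟨ha.1.add hb.1, c + d, fun τ => ?_⟩
  simpa [add_mul] using (hc τ).add (hd τ)

/-- The Cauchy product of two convergent power series. -/
lemma hasSum_cauchy {u v : ℕ → ℂ} {x s t : ℂ} (hu : HasSum (fun n => u n * x ^ n) s)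
    (hv : HasSum (fun n => v n * x ^ n) t) :
    HasSum (fun n => (∑ p ∈ Finset.HasAntidiagonal.antidiagonal n, u p.1 * v p.2) * x ^ n) (s * t) := by
  have h1 := hu.summable.norm
  have h2 := hv.summable.norm
  have h3 := (summable_norm_sum_mul_antidiagonal_of_summable_norm h1 h2).of_norm.hasSum
  rw [← tsum_mul_tsum_eq_tsum_sum_antidiagonal_of_summable_norm h1 h2, hu.tsum_eq, hv.tsum_eq]
    at h3
  refine Eq.mp (congrArg (fun φ => HasSum φ _) (funext fun n => ?_)) h3
  rw [Finset.sum_mul]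
  refine Finset.sum_congr rfl fun p hp => ?_
  rw [← Finset.HasAntidiagonal.mem_antidiagonal.mp hp, pow_add]
  ring

lemma IsHoloAtInfty.mul {a b : ℍ → ℂ} (ha : IsHoloAtInfty a) (hb : IsHoloAtInfty b) :
    IsHoloAtInfty (a * b) := by
  obtain ⟨c, hc⟩ := ha.2
  obtain ⟨d, hd⟩ := hb.2
  refine ⟨ha.1.mul hb.1, fun n => ∑ p ∈ Finset.HasAntidiagonal.antidiagonal n, c p.1 * d p.2, fun τ => ?_⟩
  have e : ∀ r : ℕ, cexp (2 * Real.pi * I * r * τ) = cexp (2 * Real.pi * I * τ) ^ r := by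
    intro r
    rw [← Complex.exp_nat_mul]
    congr 1
    ring
  have h1 := hc τ
  have h2 := hd τ
  simp only [e] at h1 h2 ⊢
  exact hasSum_cauchy h1 h2

lemma isHoloAtInfty_sum {ι : Type*} (s : Finset ι) (a : ι → ℍ → ℂ)
    (h : ∀ i ∈ s, IsHoloAtInfty (a i)) : IsHoloAtInfty (∑ i ∈ s, a i) :=
  Finset.sum_induction a IsHoloAtInfty (fun _ _ h1 h2 => h1.add h2) (isHoloAtInfty_const 0) h

lemma hasLaurent_iff (f : dom → ℂ) (N : ℕ) :
    HasLaurent f N ↔ ∃ A : ℕ → ℍ → ℂ, (∀ n, IsHoloAtInfty (A n)) ∧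
      ∀ τ : ℍ, ∀ᶠ z in 𝓝[≠] (0 : ℂ), HasSum (fun n : ℕ => A n τ * z ^ n) (z ^ N * ext f (τ, z)) := by
  refine exists_congr fun A => and_congr_right fun _ => forall_congr' fun τ => ?_
  refine eventually_congr ?_
  filter_upwards [self_mem_nhdsWithin] with z hz
  have hz' : z ≠ 0 := hz
  have hN : z ^ N ≠ 0 := pow_ne_zero _ hz'
  rw [← hasSum_mul_left_iff hN]
  have e : ∀ n : ℕ, z ^ N * (A n τ * z ^ ((n : ℤ) - (N : ℤ))) = A n τ * z ^ n := by
    intro n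
    rw [zpow_sub₀ hz', zpow_natCast, zpow_natCast]
    field_simp
  simp only [e]

lemma HasLaurent.mono {f : dom → ℂ} {N : ℕ} (h : HasLaurent f N) (M : ℕ) :
    HasLaurent f (M + N) := by
  obtain ⟨A, hA, h⟩ := (hasLaurent_iff f N).mp h
  refine (hasLaurent_iff f _).mpr ⟨fun n => if n < M then fun _ => 0 else A (n - M), fun n => ?_,
    fun τ => ?_⟩
  · by_cases hn : n < M
    · simpa [hn] using isHoloAtInfty_const 0
    · simpa [hn] using hA _
  · filter_upwards [h τ] with z hz
    have h1 := hz.mul_left (z ^ M)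
    rw [← hasSum_nat_add_iff' M]
    have h0 : ∑ i ∈ Finset.range M,
        (if i < M then (fun _ : ℍ => (0 : ℂ)) else A (i - M)) τ * z ^ i = 0 := by
      refine Finset.sum_eq_zero fun i hi => ?_
      simp [Finset.mem_range.mp hi]
    rw [h0, sub_zero, pow_add, mul_assoc]
    refine Eq.mp (congrArg (fun φ => HasSum φ _) (funext fun n => ?_)) h1
    simp only [Nat.not_lt.mpr (Nat.le_add_left M n), if_false, Nat.add_sub_cancel, pow_add]
    ring

lemma HasLaurent.add {f g : dom → ℂ} {N : ℕ} (hf : HasLaurent f N) (hg : HasLaurent g N) :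
    HasLaurent (f + g) N := by
  obtain ⟨A, hA, hf⟩ := hf
  obtain ⟨B, hB, hg⟩ := hg
  refine ⟨fun n => A n + B n, fun n => (hA n).add (hB n), fun τ => ?_⟩
  filter_upwards [hf τ, hg τ] with z h1 h2
  rw [ext_add]
  simpa [add_mul] using h1.add h2

lemma HasLaurent.mul {f g : dom → ℂ} {N M : ℕ} (hf : HasLaurent f N) (hg : HasLaurent g M) :
    HasLaurent (f * g) (N + M) := by
  obtain ⟨A, hA, hf⟩ := (hasLaurent_iff f N).mp hf
  obtain ⟨B, hB, hg⟩ := (hasLaurent_iff g M).mp hg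
  refine (hasLaurent_iff _ _).mpr
    ⟨fun n => ∑ p ∈ Finset.HasAntidiagonal.antidiagonal n, A p.1 * B p.2, fun n => ?_, fun τ => ?_⟩
  · exact isHoloAtInfty_sum _ _ fun p _ => (hA _).mul (hB _)
  · filter_upwards [hf τ, hg τ] with z h1 h2
    have h3 := hasSum_cauchy h1 h2
    rw [ext_mul, pow_add]
    convert h3 using 1
    · ext n
      simp
    · ring

lemma PolesBoundedBy.mono {f : dom → ℂ} {N M : ℕ} (h : PolesBoundedBy f N) (hNM : N ≤ M) :
    PolesBoundedBy f M := fun τ m n =>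
  ⟨(h τ m n).1, le_trans (by exact_mod_cast neg_le_neg (Int.ofNat_le.mpr hNM)) (h τ m n).2⟩

lemma PolesBoundedBy.add {f g : dom → ℂ} {N : ℕ} (hf : PolesBoundedBy f N)
    (hg : PolesBoundedBy g N) : PolesBoundedBy (f + g) N := by
  intro τ m n
  have e : (fun z : ℂ => ext (f + g) (τ, z)) =
      (fun z : ℂ => ext f (τ, z)) + fun z : ℂ => ext g (τ, z) := by
    ext z
    simp [ext_add]
  rw [e]
  exact ⟨(hf τ m n).1.add (hg τ m n).1, le_trans (le_min (hf τ m n).2 (hg τ m n).2)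
    (meromorphicOrderAt_add (hf τ m n).1 (hg τ m n).1)⟩

lemma PolesBoundedBy.mul {f g : dom → ℂ} {N M : ℕ} (hf : PolesBoundedBy f N)
    (hg : PolesBoundedBy g M) : PolesBoundedBy (f * g) (N + M) := by
  intro τ m n
  have e : (fun z : ℂ => ext (f * g) (τ, z)) =
      (fun z : ℂ => ext f (τ, z)) * fun z : ℂ => ext g (τ, z) := by
    ext z
    simp [ext_mul]
  rw [e]
  refine ⟨(hf τ m n).1.mul (hg τ m n).1, ?_⟩
  rw [meromorphicOrderAt_mul (hf τ m n).1 (hg τ m n).1]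
  refine le_trans (le_of_eq ?_) (add_le_add (hf τ m n).2 (hg τ m n).2)
  rw [← WithTop.coe_add]
  congr 1
  push_cast
  ring

lemma dom_add_one_right {τ z : ℂ} : (τ, z + 1) ∈ dom ↔ (τ, z) ∈ dom := by
  refine and_congr_right fun _ => ⟨fun h m n e => h (m + 1) n ?_, fun h m n e => h (m - 1) n ?_⟩
  · simp only at e ⊢
    rw [e]
    push_cast
    ring
  · simp only at e ⊢
    rw [eq_sub_of_add_eq e]
    push_cast
    ring

lemma dom_add_one_left {τ z : ℂ} : (τ + 1, z) ∈ dom ↔ (τ, z) ∈ dom := by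
  refine and_congr (by simp) ⟨fun h m n e => h (m - n) n ?_, fun h m n e => h (m + n) n ?_⟩
  · simp only at e ⊢
    rw [e]
    push_cast
    ring
  · simp only at e ⊢
    rw [e]
    push_cast
    ring

/-- Near a lattice point, punctured, the points `(τ, z)` belong to `dom`. -/
lemma eventually_mem_dom (τ : ℍ) (w : ℂ) : ∀ᶠ z in 𝓝[≠] w, ((τ : ℂ), z) ∈ dom := by
  have hτ : 0 < (τ : ℂ).im := τ.2
  set S : Set ℂ := ⋃ n ∈ Set.Icc ⌊(w.im - 1) / (τ : ℂ).im⌋ ⌈(w.im + 1) / (τ : ℂ).im⌉,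
    (fun m : ℤ => (m : ℂ) + (n : ℂ) * (τ : ℂ)) ''
      Set.Icc ⌊w.re - 1 - n * (τ : ℂ).re⌋ ⌈w.re + 1 - n * (τ : ℂ).re⌉ with hS
  have hfin : S.Finite := (Set.finite_Icc _ _).biUnion fun n _ => (Set.finite_Icc _ _).image _
  have h1 : ∀ᶠ z in 𝓝[≠] w, z ∈ (S \ {w})ᶜ :=
    mem_nhdsWithin_of_mem_nhds
      ((hfin.subset Set.sdiff_subset).isClosed.isOpen_compl.mem_nhds (by simp))
  have h2 : ∀ᶠ z in 𝓝[≠] w, z ∈ Metric.ball w 1 :=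
    mem_nhdsWithin_of_mem_nhds (Metric.ball_mem_nhds w one_pos)
  filter_upwards [h1, h2, self_mem_nhdsWithin] with z hz hb hne
  refine ⟨hτ, fun m n e => hz ⟨?_, hne⟩⟩
  simp only at e
  rw [Metric.mem_ball, dist_eq_norm] at hb
  have him := (abs_lt.mp ((Complex.abs_im_le_norm (z - w)).trans_lt hb))
  have hre := (abs_lt.mp ((Complex.abs_re_le_norm (z - w)).trans_lt hb))
  have e1 : z.im = n * (τ : ℂ).im := by rw [e]; simp
  have e2 : z.re = m + n * (τ : ℂ).re := by rw [e]; simp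
  rw [Complex.sub_im, e1] at him
  rw [Complex.sub_re, e2] at hre
  simp only [hS, Set.mem_iUnion]
  refine ⟨n, ⟨?_, ?_⟩, m, ⟨?_, ?_⟩, e.symm⟩
  · have : (w.im - 1) / (τ : ℂ).im ≤ n := by
      rw [div_le_iff₀ hτ]
      linarith [him.1]
    exact_mod_cast (Int.floor_le _).trans this
  · have : (n : ℝ) ≤ (w.im + 1) / (τ : ℂ).im := by
      rw [le_div_iff₀ hτ]
      linarith [him.2]
    exact_mod_cast this.trans (Int.le_ceil _)
  · have : w.re - 1 - n * (τ : ℂ).re ≤ m := by linarith [hre.1]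
    exact_mod_cast (Int.floor_le _).trans this
  · have : (m : ℝ) ≤ w.re + 1 - n * (τ : ℂ).re := by linarith [hre.2]
    exact_mod_cast this.trans (Int.le_ceil _)

lemma isSingular_algebraMap (c : ℂ) : IsSingular (algebraMap ℂ (dom → ℂ) c) where
  holo := (differentiableOn_const c).congr fun p hp => ext_algebraMap c hp
  periodic_z τ z := by
    by_cases h : (τ, z) ∈ dom
    · rw [ext_algebraMap c h, ext_algebraMap c (dom_add_one_right.mpr h)]
    · simp [ext, h, mt dom_add_one_right.mp h]
  periodic_tau τ z := by
    by_cases h : (τ, z) ∈ dom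
    · rw [ext_algebraMap c h, ext_algebraMap c (dom_add_one_left.mpr h)]
    · simp [ext, h, mt dom_add_one_left.mp h]
  poles := by
    refine ⟨0, fun τ m n => ?_⟩
    have h : (fun z : ℂ => ext (algebraMap ℂ (dom → ℂ) c) (τ, z))
        =ᶠ[𝓝[≠] ((m : ℂ) + (n : ℂ) * (τ : ℂ))] fun _ => c :=
      (eventually_mem_dom τ _).mono fun z hz => ext_algebraMap c hz
    refine ⟨(MeromorphicAt.const c _).congr h.symm, ?_⟩
    rw [meromorphicOrderAt_congr h]
    simpa using (analyticAt_const (v := c)).meromorphicOrderAt_nonneg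
  laurent := by
    refine ⟨0, fun n => if n = 0 then fun _ => c else fun _ => 0, fun n => ?_, fun τ => ?_⟩
    · by_cases hn : n = 0
      · simpa [hn] using isHoloAtInfty_const c
      · simpa [hn] using isHoloAtInfty_const 0
    · filter_upwards [eventually_mem_dom τ 0] with z hz
      rw [ext_algebraMap c hz]
      convert hasSum_ite_eq (0 : ℕ) c using 2 with n
      split_ifs with h <;> simp [h]

/-- The algebra `𝒮` of singular functions. -/
def singular : Subalgebra ℂ (dom → ℂ) where
  carrier := {f | IsSingular f}
  algebraMap_mem' := isSingular_algebraMap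
  add_mem' := by
    rintro f g ⟨f1, f2, f3, ⟨N, f4⟩, ⟨N', f5⟩⟩ ⟨g1, g2, g3, ⟨M, g4⟩, ⟨M', g5⟩⟩
    refine ⟨?_, fun τ z => ?_, fun τ z => ?_, ⟨max N M, ?_⟩, ⟨M' + N', ?_⟩⟩
    · exact (f1.add g1).congr fun p _ => ext_add f g p
    · rw [ext_add, ext_add, f2, g2]
    · rw [ext_add, ext_add, f3, g3]
    · exact (f4.mono (le_max_left _ _)).add (g4.mono (le_max_right _ _))
    · exact (f5.mono M').add (add_comm N' M' ▸ g5.mono N')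
  mul_mem' := by
    rintro f g ⟨f1, f2, f3, ⟨N, f4⟩, ⟨N', f5⟩⟩ ⟨g1, g2, g3, ⟨M, g4⟩, ⟨M', g5⟩⟩
    refine ⟨?_, fun τ z => ?_, fun τ z => ?_, ⟨N + M, f4.mul g4⟩, ⟨N' + M', f5.mul g5⟩⟩
    · exact (f1.mul g1).congr fun p _ => ext_mul f g p
    · rw [ext_mul, ext_mul, f2, g2]
    · rw [ext_mul, ext_mul, f3, g3]

/-! ### The action of the Jacobi group and quasi-Jacobi forms -/

/-- The set underlying the Jacobi group `SL(2, ℤ) ⋉ ℤ²`: pairs `(g, (l, m))`. -/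
abbrev JacobiGroup : Type := SL(2, ℤ) × (ℤ × ℤ)

/-- `J(A)(τ, z) = cτ + d`. -/
def autJ (A : JacobiGroup) (p : dom) : ℂ := (A.1 1 0 : ℂ) * p.1.1 + (A.1 1 1 : ℂ)

/-- `X(A)(τ, z) = c / (cτ + d)`. -/
def autX (A : JacobiGroup) (p : dom) : ℂ := (A.1 1 0 : ℂ) / autJ A p

/-- `Y(A)(τ, z) = (cz + cm - dl) / (cτ + d)`, where `A = (g, (l, m))`. -/
def autY (A : JacobiGroup) (p : dom) : ℂ :=
  ((A.1 1 0 : ℂ) * p.1.2 + (A.1 1 0 : ℂ) * (A.2.2 : ℂ) - (A.1 1 1 : ℂ) * (A.2.1 : ℂ)) / autJ A p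

/-- `A · (τ, z) = ((aτ + b) / (cτ + d), (z + lτ + m) / (cτ + d))`. -/
def actPoint (A : JacobiGroup) (p : dom) : ℂ × ℂ :=
  (((A.1 0 0 : ℂ) * p.1.1 + (A.1 0 1 : ℂ)) / autJ A p,
    (p.1.2 + (A.2.1 : ℂ) * p.1.1 + (A.2.2 : ℂ)) / autJ A p)

lemma actPoint_mem (A : JacobiGroup) (p : dom) : actPoint A p ∈ dom := by
  obtain ⟨g, l, m⟩ := A
  obtain ⟨⟨τ, z⟩, hτ, hz⟩ := p
  have hdet : (g 0 0 : ℂ) * g 1 1 - g 0 1 * g 1 0 = 1 := by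
    have h := g.det_coe
    rw [Matrix.det_fin_two] at h
    exact_mod_cast h
  have hJ : (g 1 0 : ℂ) * τ + g 1 1 ≠ 0 := by
    intro h
    have h1 : (g 1 0 : ℝ) * τ.im = 0 := by simpa using congrArg Complex.im h
    have hc : g 1 0 = 0 := by
      rcases mul_eq_zero.mp h1 with h2 | h2
      · exact_mod_cast h2
      · exact absurd h2 (ne_of_gt hτ)
    have hd : (g 1 1 : ℂ) = 0 := by simpa [hc] using h
    rw [hd, hc] at hdet
    simp at hdet
  refine ⟨?_, fun r s e => ?_⟩
  · have h := (g • (⟨τ, hτ⟩ : ℍ)).2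
    rw [UpperHalfPlane.coe_specialLinearGroup_apply] at h
    simpa [actPoint, autJ] using h
  · simp only [actPoint, autJ] at e
    refine hz (r * g 1 1 + s * g 0 1 - m) (r * g 1 0 + s * g 0 0 - l) ?_
    have e' : z + (l : ℂ) * τ + m = r * ((g 1 0 : ℂ) * τ + g 1 1) + s * (g 0 0 * τ + g 0 1) := by
      rw [div_eq_iff hJ] at e
      rw [e, add_mul, mul_assoc (s : ℂ), div_mul_cancel₀ _ hJ]
    push_cast
    linear_combination e'

/-- The weight `k`, index zero action `(f|_k A)(τ, z) = (cτ + d)^(-k) f(A · (τ, z))`. -/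
def slash (k : ℕ) (f : dom → ℂ) (A : JacobiGroup) : dom → ℂ :=
  fun p => (autJ A p ^ k)⁻¹ * f ⟨actPoint A p, actPoint_mem A p⟩

lemma slash_mul (k l : ℕ) (f g : dom → ℂ) (A : JacobiGroup) :
    slash (k + l) (f * g) A = slash k f A * slash l g A := by
  ext p
  simp only [slash, Pi.mul_apply, pow_add, mul_inv]
  ring

/-- The space of singular quasi-Jacobi forms of index zero and weight `k` (and of any depth):
singular functions `f` for which there are finitely many singular functions `f_{i,j}` (the
coefficients of the polynomial `P`) with `f|_k A = ∑ f_{i,j} X(A)^i Y(A)^j` for all `A` in the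
Jacobi group. -/
def quasiJacobi (k : ℕ) : Submodule ℂ (dom → ℂ) where
  carrier := {f | IsSingular f ∧ ∃ P : MvPolynomial (Fin 2) singular, ∀ A : JacobiGroup,
    slash k f A = MvPolynomial.aeval ![autX A, autY A] P}
  zero_mem' := ⟨singular.zero_mem, 0, fun A => by ext p; simp [slash]⟩
  add_mem' := by
    rintro f g ⟨hf, P, hP⟩ ⟨hg, Q, hQ⟩
    refine ⟨singular.add_mem hf hg, P + Q, fun A => ?_⟩
    rw [map_add, ← hP, ← hQ]
    ext p
    simp [slash, mul_add]
  smul_mem' := by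
    rintro c f ⟨hf, P, hP⟩
    refine ⟨singular.smul_mem hf c, MvPolynomial.C (algebraMap ℂ singular c) * P, fun A => ?_⟩
    rw [map_mul, MvPolynomial.aeval_C, ← hP]
    ext p
    simp only [slash, Pi.smul_apply, smul_eq_mul, Pi.mul_apply]
    change _ = c * _
    ring

lemma quasiJacobi_mul {k l : ℕ} {f g : dom → ℂ} (hf : f ∈ quasiJacobi k)
    (hg : g ∈ quasiJacobi l) : f * g ∈ quasiJacobi (k + l) := by
  obtain ⟨hf, P, hP⟩ := hf
  obtain ⟨hg, Q, hQ⟩ := hg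
  refine ⟨singular.mul_mem hf hg, P * Q, fun A => ?_⟩
  rw [slash_mul, map_mul, hP, hQ]

lemma one_mem_quasiJacobi : (1 : dom → ℂ) ∈ quasiJacobi 0 :=
  ⟨singular.one_mem, 1, fun A => by ext p; simp [slash]⟩

/-- The algebra `JS^∞` of quasi-Jacobi singular forms of index zero: the sum over all weights
`k ≥ 0` of the spaces of forms of weight `k`. -/
def JSinf : Subalgebra ℂ (dom → ℂ) :=
  (⨆ k : ℕ, quasiJacobi k).toSubalgebra
    (Submodule.mem_iSup_of_mem 0 one_mem_quasiJacobi)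
    (by
      intro f g hf hg
      induction hf using Submodule.iSup_induction' with
      | zero => simp
      | add x y _ _ hx hy => rw [add_mul]; exact Submodule.add_mem _ hx hy
      | mem k x hx =>
        induction hg using Submodule.iSup_induction' with
        | zero => simp
        | add y z _ _ hy hz => rw [mul_add]; exact Submodule.add_mem _ hy hz
        | mem l y hy => exact Submodule.mem_iSup_of_mem (k + l) (quasiJacobi_mul hx hy))

/-! ### The modular derivation and Rankin-Cohen brackets -/

/-- The modular derivation `∂_τ = (π / 2i) ∂/∂τ`. -/
def dTau (f : dom → ℂ) : dom → ℂ :=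
  fun p => (Real.pi / (2 * I)) * deriv (fun t : ℂ => ext f (t, p.1.2)) p.1.1

/-- `(-1)^r binom(k + n - 1, n - r) binom(l + n - 1, r)`. (For `n = 0` only `r = 0` occurs and
both binomial coefficients are `1`, whatever the upper argument.) -/
def rcCoeff (n k l r : ℕ) : ℂ :=
  (-1) ^ r * ((k + n - 1).choose (n - r) : ℂ) * ((l + n - 1).choose r : ℂ)

/-- A sequence of bilinear maps `JS^∞ × JS^∞ → JS^∞` is the sequence of Rankin-Cohen brackets
built from `∂_τ` if on forms `f` of weight `k` and `g` of weight `l` it is given by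
`[f, g]_n = ∑_r (-1)^r binom(k + n - 1, n - r) binom(l + n - 1, r) ∂_τ^r f ∂_τ^(n - r) g`. -/
def IsRankinCohen (B : ℕ → JSinf →ₗ[ℂ] JSinf →ₗ[ℂ] JSinf) : Prop :=
  ∀ (n k l : ℕ) (f g : JSinf), (f : dom → ℂ) ∈ quasiJacobi k → (g : dom → ℂ) ∈ quasiJacobi l →
    (B n f g : dom → ℂ) =
      ∑ r ∈ Finset.range (n + 1), rcCoeff n k l r • (dTau^[r] f * dTau^[n - r] g)

/-! ### Formal deformations -/

section Deformation

variable {A : Type*} [CommRing A] [Algebra ℂ A]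

/-- The product on `A⟦ħ⟧` with `a ⋆ b = ∑ₙ μₙ(a, b) ħⁿ` for `a, b ∈ A`, extended
`ℂ⟦ħ⟧`-bilinearly (and `ħ`-adically continuously) to formal power series. -/
def starProduct (μ : ℕ → A →ₗ[ℂ] A →ₗ[ℂ] A) (F G : PowerSeries A) : PowerSeries A :=
  PowerSeries.mk fun m => ∑ p ∈ Finset.HasAntidiagonal.antidiagonal m, ∑ q ∈ Finset.HasAntidiagonal.antidiagonal p.2,
    μ p.1 (PowerSeries.coeff q.1 F) (PowerSeries.coeff q.2 G)

/-- A sequence `(μₙ)` of bilinear maps `A × A → A` is a formal deformation of the commutative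
algebra `A` if `μ₀` is the product of `A` and the associated star product on `A⟦ħ⟧` is
associative with unit `1`. -/
structure IsFormalDeformation (μ : ℕ → A →ₗ[ℂ] A →ₗ[ℂ] A) : Prop where
  zero : ∀ a b : A, μ 0 a b = a * b
  assoc : ∀ F G H : PowerSeries A,
    starProduct μ (starProduct μ F G) H = starProduct μ F (starProduct μ G H)
  one_star : ∀ F : PowerSeries A, starProduct μ 1 F = F
  star_one : ∀ F : PowerSeries A, starProduct μ F 1 = F

end Deformation

/-! ### Modular forms -/

/-- A function on `ℍ` regarded as a function of `(τ, z)` not depending on `z`. -/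
def pullTau (a : ℍ → ℂ) : dom → ℂ := fun p => a ⟨p.1.1, p.2.1⟩

/-- The algebra `M` of modular forms on `SL(2, ℤ)`, inside the functions of `(τ, z)`: finite sums
of modular forms of weights `k ≥ 0`. -/
def modularForms : Subalgebra ℂ (dom → ℂ) :=
  (Submodule.span ℂ {F | ∃ (k : ℕ) (f : ModularForm 𝒮ℒ (k : ℤ)), F = pullTau f}).toSubalgebra
    (Submodule.subset_span ⟨0, ModularForm.const 1, rfl⟩)
    (by
      intro F G hF hG
      induction hF using Submodule.span_induction with
      | zero => simp
      | add x y _ _ hx hy => rw [add_mul]; exact Submodule.add_mem _ hx hy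
      | smul c x _ hx => rw [smul_mul_assoc]; exact Submodule.smul_mem _ c hx
      | mem x hx =>
        induction hG using Submodule.span_induction with
        | zero => simp
        | add y z _ _ hy hz => rw [mul_add]; exact Submodule.add_mem _ hy hz
        | smul c y _ hy => rw [mul_smul_comm]; exact Submodule.smul_mem _ c hy
        | mem y hy =>
          obtain ⟨k, f, rfl⟩ := hx
          obtain ⟨l, g, rfl⟩ := hy
          exact Submodule.subset_span
            ⟨k + l, ModularForm.mcast (by push_cast; rfl) (f.mul g), rfl⟩)

/-- The classical `n`-th Rankin-Cohen bracket of modular forms of weights `k` and `l`, built from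
`D = (2 i π)⁻¹ d/dτ`. -/
def classicalRankinCohen (n k l : ℕ) (f g : ℍ → ℂ) : ℍ → ℂ :=
  ∑ r ∈ Finset.range (n + 1),
    rcCoeff n k l r • ((Derivative.normalizedDerivOfComplex)^[r] f *
      (Derivative.normalizedDerivOfComplex)^[n - r] g)

end

end QuasiJacobi

open UpperHalfPlane hiding I
open Complex Filter Topology
open scoped MatrixGroups Manifold Derivative

namespace QuasiJacobi

noncomputable section

/-! ### The Moyal product of two commuting derivations -/

section Moyal

open TensorProduct LinearMap

variable {S : Type*} [CommRing S] [Algebra ℂ S]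

/-! The brackets are transvectants in disguise. To `f(τ)` of weight `k` attach the function `F(x, y)
= y^(-k) f(x/y)` on the plane. The vector fields `∂/∂x` and `∂/∂y` commute, and the `n`-th power of
`∂_x ⊗ ∂_y - ∂_y ⊗ ∂_x`, followed by multiplication, produces `n!` times the function attached to
`[f, g]_n` in weight `k + l + 2n` (`transvectant_eq_rankinCohen`). Associativity of the brackets is
thus associativity of the Moyal product (`moyal_assoc`): by the Leibniz rule, both ways of
bracketing three factors give the exponential of one and the same sum of three commuting operators
on the triple tensor product. This is pure algebra. It holds for every commutative `ℂ`-algebra with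
a derivation, because weights can be recorded by powers of an auxiliary variable
(`rankinCohen_assoc`).

The analytic input is that `∂_τ` is a derivation of `JS^∞` that raises the weight by 2
(`dTau_mem_quasiJacobi`). It preserves singular functions: the poles move with `τ`, but at the cost
of at most one order (`polesBoundedBy_dTau`), and the Laurent expansion at the fixed pole `z = 0`
can be differentiated term by term (`hasSum_fderiv_fst`). It preserves the quasi-Jacobi property
because the chain rule for `f|_k A` (`dTau_slash`) introduces only the corrections `k X` and `Y
∂/∂z`, and polynomials in `X` and `Y` with singular coefficients are stable under both derivations.

The formula for `[f, g]_n` depends on the weights, so existence of a bilinear map needs the sum of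
the weight spaces to be direct. Transformations `τ ↦ -1/(τ + n)` with `n → ∞` separate the weights
(`eq_zero_of_sum_quasiJacobi_eq_zero`).

For modular forms, the derivatives `D^r f`, moved by `γ`, satisfy a recursion twisted by `x =
(2πi)⁻¹ c/(cτ + d)`, where `D x = -x²`. Rankin-Cohen brackets do not see such a twist
(`rankinCohen_twist`), so they are invariant. The relation `∂_τ = π² D` accounts for the factor
`π^(2n)`. -/

/-- The Poisson operator `P ⊗ Q - Q ⊗ P` on `S ⊗ S`. -/
def poissonOp (P Q : Derivation ℂ S S) : Module.End ℂ (S ⊗[ℂ] S) :=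
  TensorProduct.map P.toLinearMap Q.toLinearMap - TensorProduct.map Q.toLinearMap P.toLinearMap

/-- The `n`-th transvectant of two elements. -/
def transvectant (P Q : Derivation ℂ S S) (n : ℕ) : S →ₗ[ℂ] S →ₗ[ℂ] S :=
  TensorProduct.curry (LinearMap.mul' ℂ S ∘ₗ (poissonOp P Q ^ n))

lemma transvectant_apply (P Q : Derivation ℂ S S) (n : ℕ) (F G : S) :
    transvectant P Q n F G = LinearMap.mul' ℂ S ((poissonOp P Q ^ n) (F ⊗ₜ G)) := rfl

/-- If `u` intertwines `a` and `b`, it intertwines their powers. -/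
lemma pow_comp_of_comp_eq {V W : Type*} [AddCommGroup V] [Module ℂ V] [AddCommGroup W]
    [Module ℂ W] {a : Module.End ℂ W} {b : Module.End ℂ V} {u : V →ₗ[ℂ] W}
    (h : a ∘ₗ u = u ∘ₗ b) (n : ℕ) : (a ^ n) ∘ₗ u = u ∘ₗ (b ^ n) := by
  induction n with
  | zero => rfl
  | succ n ih =>
    rw [pow_succ', pow_succ', Module.End.mul_eq_comp, LinearMap.comp_assoc, ih,
      ← LinearMap.comp_assoc, h, LinearMap.comp_assoc, Module.End.mul_eq_comp]

lemma poissonOp_tmul (P Q : Derivation ℂ S S) (F G : S) :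
    poissonOp P Q (F ⊗ₜ G) = P F ⊗ₜ Q G - Q F ⊗ₜ P G := rfl

/-- `P ⊗ Q - Q ⊗ P` on the first two factors. -/
def poisson12 (P Q : Derivation ℂ S S) : Module.End ℂ ((S ⊗[ℂ] S) ⊗[ℂ] S) :=
  TensorProduct.map (poissonOp P Q) LinearMap.id

/-- `P ⊗ Q - Q ⊗ P` on the outer factors. -/
def poisson13 (P Q : Derivation ℂ S S) : Module.End ℂ ((S ⊗[ℂ] S) ⊗[ℂ] S) :=
  TensorProduct.map (TensorProduct.map P.toLinearMap LinearMap.id) Q.toLinearMap -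
    TensorProduct.map (TensorProduct.map Q.toLinearMap LinearMap.id) P.toLinearMap

/-- `P ⊗ Q - Q ⊗ P` on the last two factors. -/
def poisson23 (P Q : Derivation ℂ S S) : Module.End ℂ ((S ⊗[ℂ] S) ⊗[ℂ] S) :=
  TensorProduct.map (TensorProduct.map LinearMap.id P.toLinearMap) Q.toLinearMap -
    TensorProduct.map (TensorProduct.map LinearMap.id Q.toLinearMap) P.toLinearMap

lemma poisson12_tmul (P Q : Derivation ℂ S S) (F G H : S) :
    poisson12 P Q ((F ⊗ₜ G) ⊗ₜ H) = (P F ⊗ₜ Q G) ⊗ₜ H - (Q F ⊗ₜ P G) ⊗ₜ H := by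
  simp [poisson12, poissonOp_tmul, sub_tmul]

lemma poisson13_tmul (P Q : Derivation ℂ S S) (F G H : S) :
    poisson13 P Q ((F ⊗ₜ G) ⊗ₜ H) = (P F ⊗ₜ G) ⊗ₜ Q H - (Q F ⊗ₜ G) ⊗ₜ P H := rfl

lemma poisson23_tmul (P Q : Derivation ℂ S S) (F G H : S) :
    poisson23 P Q ((F ⊗ₜ G) ⊗ₜ H) = (F ⊗ₜ P G) ⊗ₜ Q H - (F ⊗ₜ Q G) ⊗ₜ P H := rfl

variable {P Q : Derivation ℂ S S}

/-- Operators on different tensor factors always commute; on the factor shared by the two Poisson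
operators, `P` has to be exchanged with `Q`. The same reason gives the next two lemmas. -/
lemma commute_poisson12_13 (hPQ : ∀ s, P (Q s) = Q (P s)) :
    Commute (poisson12 P Q) (poisson13 P Q) := by
  refine TensorProduct.ext_threefold fun F G H => ?_
  simp only [Module.End.mul_apply, poisson12_tmul, poisson13_tmul, map_sub, hPQ]
  abel

lemma commute_poisson12_23 (hPQ : ∀ s, P (Q s) = Q (P s)) :
    Commute (poisson12 P Q) (poisson23 P Q) := by
  refine TensorProduct.ext_threefold fun F G H => ?_
  simp only [Module.End.mul_apply, poisson12_tmul, poisson23_tmul, map_sub, hPQ]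
  abel

lemma commute_poisson13_23 (hPQ : ∀ s, P (Q s) = Q (P s)) :
    Commute (poisson13 P Q) (poisson23 P Q) := by
  refine TensorProduct.ext_threefold fun F G H => ?_
  simp only [Module.End.mul_apply, poisson13_tmul, poisson23_tmul, map_sub, hPQ]
  abel

/-- Multiplication of the first two factors. -/
def mulLeft : (S ⊗[ℂ] S) ⊗[ℂ] S →ₗ[ℂ] S ⊗[ℂ] S :=
  TensorProduct.map (LinearMap.mul' ℂ S) LinearMap.id

/-- Multiplication of the last two factors. -/
def mulRight : (S ⊗[ℂ] S) ⊗[ℂ] S →ₗ[ℂ] S ⊗[ℂ] S :=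
  TensorProduct.map LinearMap.id (LinearMap.mul' ℂ S) ∘ₗ (TensorProduct.assoc ℂ S S S).toLinearMap

lemma mulLeft_tmul (F G H : S) : mulLeft ((F ⊗ₜ[ℂ] G) ⊗ₜ[ℂ] H) = (F * G) ⊗ₜ H := rfl

lemma mulRight_tmul (F G H : S) : mulRight ((F ⊗ₜ[ℂ] G) ⊗ₜ[ℂ] H) = F ⊗ₜ (G * H) := rfl

/-- This is the Leibniz rule: a derivation of the product `F G` hits either `F` or `G`, so the
pairing of `F G` with `H` splits into the pairings of `F` with `H` and of `G` with `H`. -/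
lemma poissonOp_comp_mulLeft (P Q : Derivation ℂ S S) :
    poissonOp P Q ∘ₗ mulLeft = mulLeft ∘ₗ (poisson13 P Q + poisson23 P Q) := by
  refine TensorProduct.ext_threefold fun F G H => ?_
  simp only [LinearMap.comp_apply, mulLeft_tmul, poissonOp_tmul, LinearMap.add_apply,
    poisson13_tmul, poisson23_tmul, map_add, map_sub, Derivation.leibniz, smul_eq_mul, add_tmul,
    mul_comm G]
  abel

lemma poissonOp_comp_mulRight (P Q : Derivation ℂ S S) :
    poissonOp P Q ∘ₗ mulRight = mulRight ∘ₗ (poisson12 P Q + poisson13 P Q) := by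
  refine TensorProduct.ext_threefold fun F G H => ?_
  simp only [LinearMap.comp_apply, mulRight_tmul, poissonOp_tmul, LinearMap.add_apply,
    poisson12_tmul, poisson13_tmul, map_add, map_sub, Derivation.leibniz, smul_eq_mul, tmul_add,
    mul_comm H]
  abel

lemma mul'_comp_mulLeft :
    LinearMap.mul' ℂ S ∘ₗ mulLeft = LinearMap.mul' ℂ S ∘ₗ (mulRight (S := S)) := by
  refine TensorProduct.ext_threefold fun F G H => ?_
  simp [mulLeft_tmul, mulRight_tmul, mul_assoc]

/-- The iterated bracket is lifted to three tensor factors so that all multiplications come last.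
There the two bracketings become comparable. -/
lemma transvectant_transvectant_left (P Q : Derivation ℂ S S) (i j : ℕ) (F G H : S) :
    transvectant P Q j (transvectant P Q i F G) H = LinearMap.mul' ℂ S (mulLeft
      (((poisson13 P Q + poisson23 P Q) ^ j * poisson12 P Q ^ i) ((F ⊗ₜ G) ⊗ₜ H))) := by
  have h1 : transvectant P Q i F G ⊗ₜ[ℂ] H =
      mulLeft ((poisson12 P Q ^ i) ((F ⊗ₜ G) ⊗ₜ H)) := by
    rw [poisson12, TensorProduct.map_pow]
    simp [mulLeft, transvectant_apply, ← Module.End.one_eq_id]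
  rw [transvectant_apply, h1, Module.End.mul_apply]
  exact congrArg _ (LinearMap.congr_fun (pow_comp_of_comp_eq (poissonOp_comp_mulLeft P Q) j) _)

lemma transvectant_transvectant_right (P Q : Derivation ℂ S S) (i j : ℕ) (F G H : S) :
    transvectant P Q j F (transvectant P Q i G H) = LinearMap.mul' ℂ S (mulRight
      (((poisson12 P Q + poisson13 P Q) ^ j * poisson23 P Q ^ i) ((F ⊗ₜ G) ⊗ₜ H))) := by
  have h0 : (TensorProduct.map LinearMap.id (poissonOp P Q)) ∘ₗ
      (TensorProduct.assoc ℂ S S S).toLinearMap =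
      (TensorProduct.assoc ℂ S S S).toLinearMap ∘ₗ poisson23 P Q := by
    refine TensorProduct.ext_threefold fun F G H => ?_
    simp [poisson23_tmul, poissonOp_tmul, tmul_sub]
  have h1 : F ⊗ₜ[ℂ] transvectant P Q i G H =
      mulRight ((poisson23 P Q ^ i) ((F ⊗ₜ G) ⊗ₜ H)) := by
    have h2 := LinearMap.congr_fun (pow_comp_of_comp_eq h0 i) ((F ⊗ₜ G) ⊗ₜ H)
    rw [TensorProduct.map_pow] at h2
    rw [mulRight, LinearMap.comp_apply]
    rw [LinearMap.comp_apply, LinearMap.comp_apply] at h2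
    rw [← h2]
    simp [transvectant_apply, ← Module.End.one_eq_id]
  rw [transvectant_apply, h1, Module.End.mul_apply]
  exact congrArg _ (LinearMap.congr_fun (pow_comp_of_comp_eq (poissonOp_comp_mulRight P Q) j) _)

/-- The binomial formula with divided powers. -/
lemma sum_antidiagonal_divided_pow {A : Type*} [Ring A] [Algebra ℂ A] {x y : A}
    (h : Commute x y) (n : ℕ) :
    ∑ p ∈ Finset.HasAntidiagonal.antidiagonal n,
      ((p.1.factorial * p.2.factorial : ℕ) : ℂ)⁻¹ • (y ^ p.2 * x ^ p.1) =
    ((n.factorial : ℕ) : ℂ)⁻¹ • (x + y) ^ n := by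
  rw [h.add_pow', Finset.smul_sum]
  refine Finset.sum_congr rfl fun p hp => ?_
  rw [(h.pow_pow p.1 p.2).eq, ← Nat.cast_smul_eq_nsmul ℂ, smul_smul]
  congr 1
  have hp' := Finset.HasAntidiagonal.mem_antidiagonal.mp hp
  have h1 := Nat.choose_mul_factorial_mul_factorial (n := n) (k := p.1) (by omega)
  rw [show n - p.1 = p.2 by omega] at h1
  have h2 : ((n.factorial : ℕ) : ℂ) ≠ 0 := by exact_mod_cast n.factorial_ne_zero
  rw [← h1] at h2 ⊢
  push_cast at h2 ⊢
  have h3 := left_ne_zero_of_mul (left_ne_zero_of_mul h2)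
  have h4 := right_ne_zero_of_mul (left_ne_zero_of_mul h2)
  have h5 := right_ne_zero_of_mul h2
  field_simp

/-- Associativity of the Moyal product. -/
theorem moyal_assoc (hPQ : ∀ s, P (Q s) = Q (P s)) (n : ℕ) (F G H : S) :
    ∑ p ∈ Finset.HasAntidiagonal.antidiagonal n, ((p.1.factorial * p.2.factorial : ℕ) : ℂ)⁻¹ •
      transvectant P Q p.2 (transvectant P Q p.1 F G) H =
    ∑ p ∈ Finset.HasAntidiagonal.antidiagonal n, ((p.1.factorial * p.2.factorial : ℕ) : ℂ)⁻¹ •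
      transvectant P Q p.2 F (transvectant P Q p.1 G H) := by
  have h1 := sum_antidiagonal_divided_pow (A := Module.End ℂ ((S ⊗[ℂ] S) ⊗[ℂ] S))
    ((commute_poisson12_13 hPQ).add_right (commute_poisson12_23 hPQ)) n
  have h2 := sum_antidiagonal_divided_pow (A := Module.End ℂ ((S ⊗[ℂ] S) ⊗[ℂ] S))
    ((commute_poisson12_23 hPQ).symm.add_right (commute_poisson13_23 hPQ).symm) n
  -- Both bracketings are the divided `n`-th power of the total operator, the sum over the three
  -- pairs of factors.
  have h3 : poisson12 P Q + (poisson13 P Q + poisson23 P Q) =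
      poisson23 P Q + (poisson12 P Q + poisson13 P Q) := by abel
  rw [h3, ← h2] at h1
  have h4 := congrArg (fun u : Module.End ℂ ((S ⊗[ℂ] S) ⊗[ℂ] S) =>
    LinearMap.mul' ℂ S (mulRight (u ((F ⊗ₜ G) ⊗ₜ H)))) h1
  have h5 (v : (S ⊗[ℂ] S) ⊗[ℂ] S) :
      LinearMap.mul' ℂ S (mulLeft v) = LinearMap.mul' ℂ S (mulRight v) :=
    LinearMap.congr_fun mul'_comp_mulLeft v
  simp only [LinearMap.sum_apply, LinearMap.smul_apply, map_sum, map_smul] at h4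
  simpa only [transvectant_transvectant_left, transvectant_transvectant_right, h5] using h4

end Moyal

/-! ### Rankin-Cohen brackets of a differential algebra -/

section RankinCohen

open TensorProduct LinearMap Polynomial

/-- The `n`-th Rankin-Cohen bracket in weights `k` and `l` of an algebra with a derivation. -/
def rankinCohen {R : Type*} [CommRing R] [Algebra ℂ R] (d : Derivation ℂ R R) (n k l : ℕ) :
    R →ₗ[ℂ] R →ₗ[ℂ] R :=
  ∑ r ∈ Finset.range (n + 1), rcCoeff n k l r •
    (LinearMap.mul ℂ R).compl₁₂ ((d : Module.End ℂ R) ^ r) ((d : Module.End ℂ R) ^ (n - r))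

lemma rankinCohen_apply {R : Type*} [CommRing R] [Algebra ℂ R] (d : Derivation ℂ R R)
    (n k l : ℕ) (f g : R) : rankinCohen d n k l f g =
      ∑ r ∈ Finset.range (n + 1), rcCoeff n k l r • (d^[r] f * d^[n - r] g) := by
  simp [rankinCohen, LinearMap.sum_apply, Module.End.pow_apply]

/-- Rising factorials are what repeated differentiation of a homogeneous function produces, so this
is the form in which the coefficients appear from transvectants. The truncated subtractions are
harmless: at `k + r = 0` or `l + (n - r) = 0` both sides still agree. -/
lemma factorial_mul_rcCoeff {n r : ℕ} (k l : ℕ) (hr : r ≤ n) :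
    (n.factorial : ℂ) * rcCoeff n k l r = (-1) ^ r * (n.choose r : ℂ) *
      ((k + r).ascFactorial (n - r) : ℂ) * ((l + (n - r)).ascFactorial r : ℂ) := by
  rw [Nat.ascFactorial_eq_factorial_mul_choose', Nat.ascFactorial_eq_factorial_mul_choose',
    show k + r + (n - r) - 1 = k + n - 1 by omega, show l + (n - r) + r - 1 = l + n - 1 by omega,
    ← Nat.choose_mul_factorial_mul_factorial hr, rcCoeff]
  push_cast
  ring

/-! ### Plane vector fields over a weighted differential algebra. -/

variable {B : Type*} [CommRing B] [Algebra ℂ B]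

/-- The derivation of `B[X]` acting on coefficients by a derivation of `B`. -/
def coeffDerivation (d : Derivation ℂ B B) : Derivation ℂ B[X] B[X] :=
  PolynomialModule.equivPolynomialSelf.compDer d.mapCoeffs

lemma coeff_coeffDerivation (d : Derivation ℂ B B) (p : B[X]) (i : ℕ) :
    (coeffDerivation d p).coeff i = d (p.coeff i) := rfl

lemma coeffDerivation_C (d : Derivation ℂ B B) (b : B) : coeffDerivation d (C b) = C (d b) := by
  ext i
  simp only [coeff_coeffDerivation, coeff_C]
  split_ifs <;> simp

lemma coeffDerivation_X (d : Derivation ℂ B B) : coeffDerivation d X = 0 := by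
  ext i
  simp only [coeff_coeffDerivation, coeff_X]
  split_ifs <;> simp

lemma derivative_coeffDerivation (d : Derivation ℂ B B) (p : B[X]) :
    derivative (coeffDerivation d p) = coeffDerivation d (derivative p) := by
  ext i
  simp [coeff_coeffDerivation, coeff_derivative, mul_comm]

/-- The derivation `d + d/dt` of `B[t]`. -/
def totalDerivation (d : Derivation ℂ B B) : Derivation ℂ B[X] B[X] :=
  coeffDerivation d + (derivative' : Derivation B B[X] B[X]).restrictScalars ℂ

lemma totalDerivation_apply (d : Derivation ℂ B B) (p : B[X]) :
    totalDerivation d p = coeffDerivation d p + derivative p := rfl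

lemma totalDerivation_C (d : Derivation ℂ B B) (b : B) :
    totalDerivation d (C b) = C (d b) := by
  rw [totalDerivation_apply, coeffDerivation_C, derivative_C, add_zero]

lemma derivative_totalDerivation (d : Derivation ℂ B B) (p : B[X]) :
    derivative (totalDerivation d p) = totalDerivation d (derivative p) := by
  simp [totalDerivation_apply, derivative_coeffDerivation]

/-- The vector field `∂/∂x` in the coordinates `t = x / y`, `Y = y⁻¹`. -/
def planeX (d : Derivation ℂ B B) (Y : B) : Derivation ℂ B[X] B[X] :=
  (C Y : B[X]) • totalDerivation d

/-- The vector field `∂/∂y` in the coordinates `t = x / y`, `Y = y⁻¹`. -/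
def planeY (d e : Derivation ℂ B B) (Y : B) : Derivation ℂ B[X] B[X] :=
  -((C Y : B[X]) • (coeffDerivation e + (X : B[X]) • totalDerivation d))

lemma planeX_apply (d : Derivation ℂ B B) (Y : B) (p : B[X]) :
    planeX d Y p = C Y * totalDerivation d p := rfl

lemma planeY_apply (d e : Derivation ℂ B B) (Y : B) (p : B[X]) :
    planeY d e Y p = -(C Y * (coeffDerivation e p + X * totalDerivation d p)) := rfl

variable {d e : Derivation ℂ B B} {Y : B}

/-- The commutator could only have two first-order contributions: one from `t` being differentiated
to `1`, the other from `Y` having weight 1. They cancel. -/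
lemma planeX_planeY (hde : ∀ b, d (e b) = e (d b)) (hd : d Y = 0) (he : e Y = Y) (p : B[X]) :
    planeX d Y (planeY d e Y p) = planeY d e Y (planeX d Y p) := by
  have h1 : totalDerivation d (coeffDerivation e p) = coeffDerivation e (totalDerivation d p) := by
    rw [totalDerivation_apply, totalDerivation_apply, map_add, derivative_coeffDerivation]
    congr 1
    ext i
    simp only [coeff_coeffDerivation, hde]
  have h2 : totalDerivation d X = 1 := by
    rw [totalDerivation_apply, coeffDerivation_X, derivative_X, zero_add]
  simp only [planeX_apply, planeY_apply, map_neg, map_add, Derivation.leibniz, smul_eq_mul, h1, h2,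
    totalDerivation_C, coeffDerivation_C, hd, he, map_zero]
  ring

lemma derivative_planeX (p : B[X]) :
    derivative (planeX d Y p) = planeX d Y (derivative p) := by
  rw [planeX_apply, planeX_apply, derivative_C_mul, derivative_totalDerivation]

/-- The formal `d/dt` sees only the explicit occurrences of `t`. It acts as the infinitesimal shear
that fixes `∂/∂x` and subtracts `∂/∂x` from `∂/∂y`. -/
lemma derivative_planeY (p : B[X]) :
    derivative (planeY d e Y p) = planeY d e Y (derivative p) - planeX d Y p := by
  rw [planeY_apply, planeY_apply, planeX_apply, derivative_neg, derivative_C_mul, derivative_add,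
    derivative_mul, derivative_totalDerivation, derivative_coeffDerivation, derivative_X]
  ring

/-- `d/dt` acting on `B[t] ⊗ B[t]`. -/
def tensorDerivative : Module.End ℂ (B[X] ⊗[ℂ] B[X]) :=
  TensorProduct.map ((derivative : B[X] →ₗ[B] B[X]).restrictScalars ℂ) LinearMap.id +
    TensorProduct.map LinearMap.id ((derivative : B[X] →ₗ[B] B[X]).restrictScalars ℂ)

lemma tensorDerivative_tmul (p q : B[X]) :
    tensorDerivative (p ⊗ₜ[ℂ] q) = derivative p ⊗ₜ q + p ⊗ₜ derivative q := rfl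

/-- The antisymmetric combination `P ⊗ Q - Q ⊗ P` does not change under the shear `Q ↦ Q - P`, since
the extra terms `P ⊗ P` cancel. -/
lemma commute_tensorDerivative_poissonOp :
    tensorDerivative ∘ₗ poissonOp (planeX d Y) (planeY d e Y) =
      poissonOp (planeX d Y) (planeY d e Y) ∘ₗ tensorDerivative := by
  refine TensorProduct.ext' fun p q => ?_
  simp only [LinearMap.comp_apply, poissonOp_tmul, tensorDerivative_tmul, map_sub, map_add,
    derivative_planeX, derivative_planeY, tmul_sub, sub_tmul]
  abel

/-- The transvectants of functions that do not depend on `t` do not depend on `t`. -/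
lemma derivative_transvectant_C (n : ℕ) (f g : B) :
    derivative (transvectant (planeX d Y) (planeY d e Y) n (C f) (C g)) = 0 := by
  have h1 (v : B[X] ⊗[ℂ] B[X]) : derivative (LinearMap.mul' ℂ B[X] v) =
      LinearMap.mul' ℂ B[X] (tensorDerivative v) := by
    induction v with
    | zero => simp
    | add x y hx hy => simp only [map_add, hx, hy]
    | tmul p q => simp [tensorDerivative_tmul, derivative_mul]
  have h2 := LinearMap.congr_fun (pow_comp_of_comp_eq
    (commute_tensorDerivative_poissonOp (d := d) (e := e) (Y := Y)).symm n) (C f ⊗ₜ C g)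
  rw [transvectant_apply, h1]
  rw [LinearMap.comp_apply, LinearMap.comp_apply] at h2
  rw [← h2, tensorDerivative_tmul, derivative_C, derivative_C, zero_tmul, tmul_zero, add_zero,
    map_zero, map_zero]

lemma iterate_planeX_C (hd : d Y = 0) (r : ℕ) (f : B) :
    (planeX d Y)^[r] (C f) = C (Y ^ r * d^[r] f) := by
  induction r with
  | zero => simp
  | succ r ih =>
    rw [Function.iterate_succ_apply', Function.iterate_succ_apply', ih, planeX_apply,
      totalDerivation_C, ← C_mul, Derivation.leibniz, Derivation.leibniz_pow, hd]
    simp [pow_succ']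
    ring

lemma iterate_derivation_weight (hde : ∀ b, d (e b) = e (d b)) {k : ℕ} {f : B}
    (hf : e f = (k : B) * f) (r : ℕ) : e (d^[r] f) = (k : B) * d^[r] f := by
  induction r with
  | zero => exact hf
  | succ r ih =>
    rw [Function.iterate_succ_apply', ← hde, ih, Derivation.leibniz]
    simp

lemma pow_mul_weight (he : e Y = Y) {k : ℕ} {f : B} (hf : e f = (k : B) * f) (r : ℕ) :
    e (Y ^ r * f) = ((k + r : ℕ) : B) * (Y ^ r * f) := by
  rw [Derivation.leibniz, Derivation.leibniz_pow, he, hf]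
  rcases r with _ | r
  · simp
  · simp only [smul_eq_mul, nsmul_eq_mul, Nat.add_sub_cancel, pow_succ]
    push_cast
    ring

/-- At `t = 0` the field `∂/∂y` reduces to `-Y e`. Each application multiplies by `-Y` and by the
current weight, which is `m + b` after `b` steps; the product of these weights is the rising
factorial. -/
lemma coeff_zero_iterate_planeY (he : e Y = Y) {m : ℕ} {h : B} (hh : e h = (m : B) * h) (b : ℕ) :
    ((planeY d e Y)^[b] (C h)).coeff 0 = (-1) ^ b * (m.ascFactorial b : B) * (Y ^ b * h) := by
  induction b with
  | zero => simp
  | succ b ih =>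
    have h1 (c : ℕ) (u : B) (hu : e u = 0) (w : B) : e (u * w) = u * e w := by
      rw [Derivation.leibniz, hu, smul_zero, add_zero, smul_eq_mul]
    have h2 : e ((-1) ^ b * (m.ascFactorial b : B)) = 0 := by
      have h3 : ((-1) ^ b * (m.ascFactorial b : B)) =
          algebraMap ℂ B ((-1) ^ b * (m.ascFactorial b : ℂ)) := by simp
      rw [h3, Derivation.map_algebraMap]
    rw [Function.iterate_succ_apply', planeY_apply, coeff_neg, coeff_C_mul, coeff_add,
      coeff_coeffDerivation, mul_coeff_zero, coeff_X_zero, zero_mul, add_zero, ih,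
      h1 b _ h2, pow_mul_weight he hh, Nat.ascFactorial_succ]
    push_cast
    ring

/-- The binomial theorem for two commuting operators. The powers of `P` are applied before those of
`Q`, because `planeX` keeps constants of `B[t]` constant while `planeY` does not. -/
lemma poissonOp_pow_tmul {S : Type*} [CommRing S] [Algebra ℂ S] {P Q : Derivation ℂ S S}
    (hPQ : ∀ s, P (Q s) = Q (P s)) (n : ℕ) (F G : S) :
    (poissonOp P Q ^ n) (F ⊗ₜ G) = ∑ r ∈ Finset.range (n + 1),
      ((-1) ^ (n - r) * (n.choose r : ℂ)) • (Q^[n - r] (P^[r] F) ⊗ₜ[ℂ] Q^[r] (P^[n - r] G)) := by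
  have hc : Commute (P : Module.End ℂ S) (Q : Module.End ℂ S) := LinearMap.ext hPQ
  have h1 : Commute (TensorProduct.map P.toLinearMap Q.toLinearMap)
      (-TensorProduct.map Q.toLinearMap P.toLinearMap) := by
    refine Commute.neg_right (show Commute (TensorProduct.map P.toLinearMap Q.toLinearMap)
      (TensorProduct.map Q.toLinearMap P.toLinearMap) from TensorProduct.ext' fun x y => ?_)
    change P (Q x) ⊗ₜ[ℂ] Q (P y) = Q (P x) ⊗ₜ[ℂ] P (Q y)
    rw [hPQ, hPQ]
  rw [poissonOp, sub_eq_add_neg, h1.add_pow, LinearMap.sum_apply]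
  refine Finset.sum_congr rfl fun r _ => ?_
  have h3 : Q^[n - r] (P^[r] F) = P^[r] (Q^[n - r] F) := by
    have := LinearMap.congr_fun (hc.pow_pow r (n - r)) F
    simpa [Module.End.mul_apply, Module.End.pow_apply] using this.symm
  rw [h3, ← nsmul_eq_mul', LinearMap.smul_apply, ← Nat.cast_smul_eq_nsmul ℂ,
    mul_comm ((-1 : ℂ) ^ _), mul_smul, ← neg_one_smul ℂ (TensorProduct.map Q.toLinearMap _),
    _root_.smul_pow, TensorProduct.map_pow, TensorProduct.map_pow, mul_smul_comm, LinearMap.smul_apply,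
    Module.End.mul_apply, TensorProduct.map_tmul, TensorProduct.map_tmul, Module.End.pow_apply,
    Module.End.pow_apply, Module.End.pow_apply, Module.End.pow_apply]
  rfl

/-- The integers `i + 1` are invertible in a `ℂ`-algebra, so `B` need not be a domain. -/
lemma eq_C_of_derivative_eq_zero {p : B[X]} (hp : derivative p = 0) : p = C (p.coeff 0) := by
  ext (_ | i)
  · simp
  · have h1 := congrArg (fun q : B[X] => q.coeff i) hp
    simp only [coeff_derivative, coeff_zero] at h1
    have h2 : (algebraMap ℂ B (i + 1)) * algebraMap ℂ B (i + 1 : ℂ)⁻¹ = 1 := by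
      rw [← map_mul, mul_inv_cancel₀ (Nat.cast_add_one_ne_zero i), map_one]
    rw [map_add, map_natCast, map_one] at h2
    rw [coeff_C_succ, ← mul_one (p.coeff (i + 1)), ← h2, ← mul_assoc, h1, zero_mul]

/-- Transvectants of homogeneous functions on the plane are Rankin-Cohen brackets. -/
theorem transvectant_eq_rankinCohen (hde : ∀ b, d (e b) = e (d b)) (hd : d Y = 0) (he : e Y = Y)
    {k l : ℕ} {f g : B} (hf : e f = (k : B) * f) (hg : e g = (l : B) * g) (n : ℕ) :
    transvectant (planeX d Y) (planeY d e Y) n (C f) (C g) =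
      C ((n.factorial : ℂ) • (Y ^ (2 * n) * rankinCohen d n k l f g)) := by
  -- As the transvectant is independent of `t`, it may be computed at `t = 0`, where the action of
  -- `∂/∂y` is explicit.
  rw [eq_C_of_derivative_eq_zero (derivative_transvectant_C (d := d) (e := e) (Y := Y) n f g)]
  congr 1
  rw [transvectant_apply, poissonOp_pow_tmul (planeX_planeY hde hd he), map_sum, finsetSum_coeff,
    rankinCohen_apply, Finset.mul_sum, Finset.smul_sum]
  refine Finset.sum_congr rfl fun r hr => ?_
  have hr' : r ≤ n := Nat.lt_succ_iff.mp (Finset.mem_range.mp hr)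
  rw [map_smul, coeff_smul, LinearMap.mul'_apply, mul_coeff_zero, iterate_planeX_C hd,
    iterate_planeX_C hd,
    coeff_zero_iterate_planeY he (pow_mul_weight he (iterate_derivation_weight hde hf r) r),
    coeff_zero_iterate_planeY he (pow_mul_weight he (iterate_derivation_weight hde hg (n - r)) _),
    mul_smul_comm, smul_smul, factorial_mul_rcCoeff k l hr']
  -- The sign of the binomial expansion cancels the one produced by the `n - r` applications of
  -- `∂/∂y` to the first factor. Only the sign `(-1)^r` from the second factor survives.
  have h1 : ((-1) ^ (n - r) * (n.choose r : ℂ) * ((-1) ^ (n - r) *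
      ((k + r).ascFactorial (n - r) : ℂ)) * ((-1) ^ r * ((l + (n - r)).ascFactorial r : ℂ))) =
      (-1) ^ r * (n.choose r : ℂ) * ((k + r).ascFactorial (n - r) : ℂ) *
        ((l + (n - r)).ascFactorial r : ℂ) := by
    have : ((-1 : ℂ) ^ (n - r)) * (-1) ^ (n - r) = 1 := by rw [← mul_pow]; simp
    linear_combination ((n.choose r : ℂ) * ((k + r).ascFactorial (n - r) : ℂ) * ((-1) ^ r *
      ((l + (n - r)).ascFactorial r : ℂ))) * this
  rw [← h1]
  simp only [Algebra.smul_def, map_mul, map_pow, map_neg, map_one, map_natCast]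
  have h2 : (Y ^ (2 * n) : B) = Y ^ (n - r) * Y ^ r * (Y ^ r * Y ^ (n - r)) := by
    rw [← pow_add, ← pow_add, ← pow_add]
    congr 1
    omega
  rw [h2]
  ring

lemma iterate_mul_of_eq_zero {c : B} (hc : d c = 0) (f : B) (r : ℕ) :
    d^[r] (c * f) = c * d^[r] f := by
  induction r with
  | zero => rfl
  | succ r ih => simp [Function.iterate_succ_apply', ih, hc]

lemma rankinCohen_mul_left {c : B} (hc : d c = 0) (n k l : ℕ) (f g : B) :
    rankinCohen d n k l (c * f) g = c * rankinCohen d n k l f g := by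
  simp only [rankinCohen_apply, iterate_mul_of_eq_zero hc, Finset.mul_sum, mul_smul_comm, mul_assoc]

lemma rankinCohen_mul_right {c : B} (hc : d c = 0) (n k l : ℕ) (f g : B) :
    rankinCohen d n k l f (c * g) = c * rankinCohen d n k l f g := by
  simp only [rankinCohen_apply, iterate_mul_of_eq_zero hc, Finset.mul_sum, mul_smul_comm,
    mul_left_comm]

lemma rankinCohen_weight (hde : ∀ b, d (e b) = e (d b)) {k l : ℕ} {f g : B}
    (hf : e f = (k : B) * f) (hg : e g = (l : B) * g) (n : ℕ) :
    e (rankinCohen d n k l f g) = ((k + l : ℕ) : B) * rankinCohen d n k l f g := by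
  rw [rankinCohen_apply, map_sum, Finset.mul_sum]
  refine Finset.sum_congr rfl fun r _ => ?_
  rw [Derivation.map_smul, Derivation.leibniz, iterate_derivation_weight hde hf,
    iterate_derivation_weight hde hg, mul_smul_comm]
  congr 1
  push_cast
  simp only [smul_eq_mul]
  ring

/-- The brackets of homogeneous functions form an associative product. -/
lemma rankinCohen_assoc_of_weight (hde : ∀ b, d (e b) = e (d b)) (hd : d Y = 0) (he : e Y = Y)
    {k l m : ℕ} {f g h : B} (hf : e f = (k : B) * f) (hg : e g = (l : B) * g)
    (hh : e h = (m : B) * h) (n : ℕ) :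
    Y ^ (2 * n) * ∑ p ∈ Finset.HasAntidiagonal.antidiagonal n,
      rankinCohen d p.2 (k + l + 2 * p.1) m (rankinCohen d p.1 k l f g) h =
    Y ^ (2 * n) * ∑ p ∈ Finset.HasAntidiagonal.antidiagonal n,
      rankinCohen d p.2 k (l + m + 2 * p.1) f (rankinCohen d p.1 l m g h) := by
  have hY (i : ℕ) : d (Y ^ i) = 0 := by rw [Derivation.leibniz_pow, hd, smul_zero, smul_zero]
  have h1 := moyal_assoc (planeX_planeY hde hd he) n (C f) (C g) (C h)
  have hsm (a : ℂ) (b : B) : (C (a • b) : B[X]) = a • C b := (smul_C a b).symm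
  -- The bracket of order `i` keeps the weight `a + b`, since `d` commutes with `e`. The factor
  -- `Y^(2i)` raises it to `a + b + 2i`, the weight used by the outer bracket.
  have hw {a b : ℕ} {u v : B} (hu : e u = (a : B) * u) (hv : e v = (b : B) * v) (i : ℕ) :=
    pow_mul_weight he (rankinCohen_weight hde hu hv i) (2 * i)
  simp only [transvectant_eq_rankinCohen hde hd he hf hg,
    transvectant_eq_rankinCohen hde hd he hg hh, hsm, map_smul, LinearMap.smul_apply,
    transvectant_eq_rankinCohen hde hd he (hw hf hg _) hh,
    transvectant_eq_rankinCohen hde hd he hf (hw hg hh _), rankinCohen_mul_left (hY _),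
    rankinCohen_mul_right (hY _)] at h1
  simp only [← hsm, ← map_sum] at h1
  have h2 := C_injective h1
  -- The factorials carried by the two transvectants cancel the divided powers of the Moyal product,
  -- and the powers of `Y` add up to the same `Y^(2n)` in every term.
  have h3 {p : ℕ × ℕ} (hp : p ∈ Finset.HasAntidiagonal.antidiagonal n) (u : B) :
      ((p.1.factorial * p.2.factorial : ℕ) : ℂ)⁻¹ • (p.1.factorial : ℂ) • (p.2.factorial : ℂ) •
        (Y ^ (2 * p.2) * (Y ^ (2 * p.1) * u)) = Y ^ (2 * n) * u := by
    have h4 : ((p.1.factorial * p.2.factorial : ℕ) : ℂ) ≠ 0 := by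
      exact_mod_cast Nat.mul_ne_zero p.1.factorial_ne_zero p.2.factorial_ne_zero
    rw [smul_smul, smul_smul, mul_assoc, ← Nat.cast_mul, inv_mul_cancel₀ h4, one_smul, ← mul_assoc,
      ← pow_add, ← mul_add, add_comm p.2, Finset.HasAntidiagonal.mem_antidiagonal.mp hp]
  rw [Finset.mul_sum, Finset.mul_sum]
  refine (Finset.sum_congr rfl fun p hp => (h3 hp _).symm).trans
    (h2.trans (Finset.sum_congr rfl fun p hp => h3 hp _))

/-- The sum of the Rankin-Cohen brackets of a differential algebra is an associative product. -/
theorem rankinCohen_assoc {R : Type*} [CommRing R] [Algebra ℂ R] (d : Derivation ℂ R R)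
    (n k l m : ℕ) (f g h : R) :
    ∑ p ∈ Finset.HasAntidiagonal.antidiagonal n,
      rankinCohen d p.2 (k + l + 2 * p.1) m (rankinCohen d p.1 k l f g) h =
    ∑ p ∈ Finset.HasAntidiagonal.antidiagonal n,
      rankinCohen d p.2 k (l + m + 2 * p.1) f (rankinCohen d p.1 l m g h) := by
  -- No grading of `R` is assumed. In `R[X]` the Euler field `X d/dX` measures the weight: `f`, `g`,
  -- `h` are replaced by `X^k f`, `X^l g`, `X^m h`, and `X` itself serves as `Y`, of weight 1 and
  -- killed by the extended derivation.
  set e : Derivation ℂ R[X] R[X] :=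
    (X : R[X]) • (derivative' : Derivation R R[X] R[X]).restrictScalars ℂ with he
  have he' (p : R[X]) : e p = X * derivative p := rfl
  have hX (a : ℕ) (u : R) : e (X ^ a * C u) = (a : R[X]) * (X ^ a * C u) := by
    rw [he', derivative_mul, derivative_X_pow, derivative_C]
    rcases a with _ | a
    · simp
    · simp only [Nat.add_sub_cancel, pow_succ', C_eq_natCast]
      ring
  have hd (a : ℕ) : coeffDerivation d (X ^ a) = 0 := by
    rw [Derivation.leibniz_pow, coeffDerivation_X, smul_zero, smul_zero]
  have hC (i a b : ℕ) (u v : R) : rankinCohen (coeffDerivation d) i a b (C u) (C v) =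
      C (rankinCohen d i a b u v) := by
    have hit (r : ℕ) (u : R) : (coeffDerivation d)^[r] (C u) = C (d^[r] u) := by
      induction r with
      | zero => rfl
      | succ r ih => rw [Function.iterate_succ_apply', Function.iterate_succ_apply', ih,
          coeffDerivation_C]
    have hsm (a : ℂ) (b : R) : (C (a • b) : R[X]) = a • C b := (smul_C a b).symm
    simp only [rankinCohen_apply, hit, map_sum, hsm, C_mul]
  have h1 := rankinCohen_assoc_of_weight (d := coeffDerivation d) (e := e) (Y := X)
    (fun b => by
      rw [he', he', Derivation.leibniz, coeffDerivation_X, smul_zero, add_zero,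
        derivative_coeffDerivation, smul_eq_mul])
    (coeffDerivation_X d) (by rw [he', derivative_X, mul_one]) (hX k f) (hX l g) (hX m h) n
  simp only [rankinCohen_mul_left (hd _), rankinCohen_mul_right (hd _), hC, ← Finset.mul_sum,
    ← map_sum] at h1
  -- Both sides are constants times the same power of `X`; reading off that coefficient returns to
  -- `R`.
  have h2 := congrArg (fun p : R[X] => p.coeff (2 * n + (k + (l + m)))) h1
  simpa only [← mul_assoc, ← pow_add, add_assoc, coeff_X_pow_mul', coeff_C, le_refl, if_true,
    Nat.sub_self] using h2

/-! ### Invariance of the brackets under a twist of the derivation. -/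

section Twist

variable {R : Type*} [CommRing R] [Algebra ℂ R]

/-- The iterates of `d` on an element of weight `k`, twisted by a variable `X` with
`d X = -X ^ 2`. -/
def twistedIterate (d : Derivation ℂ R R) (k : ℕ) (f : R) : ℕ → R[X]
  | 0 => C f
  | r + 1 => coeffDerivation d (twistedIterate d k f r) -
      X ^ 2 * derivative (twistedIterate d k f r) +
      ((k + 2 * r : ℕ) : R[X]) * (X * twistedIterate d k f r)

/-- Commuting `d/dX` past the step of weight `w = k + 2r` leaves `w` and turns that step into the
one of weight `w - 2`. The weights add up to `k + (k + 2) + ... + (k + 2r) = (r + 1)(k + r)`. -/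
lemma derivative_twistedIterate (d : Derivation ℂ R R) (k : ℕ) (f : R) (r : ℕ) :
    derivative (twistedIterate d k f (r + 1)) =
      (((r + 1) * (k + r) : ℕ) : R[X]) * twistedIterate d k f r := by
  induction r with
  | zero => simp [twistedIterate, coeffDerivation_C]
  | succ r ih =>
    have h1 : twistedIterate d k f (r + 1 + 1) = coeffDerivation d (twistedIterate d k f (r + 1)) -
      X ^ 2 * derivative (twistedIterate d k f (r + 1)) +
      ((k + 2 * (r + 1) : ℕ) : R[X]) * (X * twistedIterate d k f (r + 1)) := rfl
    have h2 : twistedIterate d k f (r + 1) = coeffDerivation d (twistedIterate d k f r) -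
      X ^ 2 * derivative (twistedIterate d k f r) +
      ((k + 2 * r : ℕ) : R[X]) * (X * twistedIterate d k f r) := rfl
    rw [h1, derivative_add, derivative_sub, derivative_coeffDerivation, derivative_mul,
      derivative_mul, derivative_mul, derivative_X_pow, derivative_X, derivative_natCast, ih,
      derivative_mul, derivative_natCast, Derivation.leibniz, Derivation.map_natCast, smul_zero,
      smul_eq_mul, ← sub_eq_zero]
    have h3 := sub_eq_zero.mpr h2
    push_cast at h3 ⊢
    simp only [map_ofNat]
    linear_combination (-((r : R[X]) + 1) * (k + r)) * h3

lemma coeff_zero_twistedIterate (d : Derivation ℂ R R) (k : ℕ) (f : R) (r : ℕ) :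
    (twistedIterate d k f r).coeff 0 = d^[r] f := by
  induction r with
  | zero => simp [twistedIterate]
  | succ r ih =>
    rw [Function.iterate_succ_apply', ← ih]
    simp [twistedIterate, coeff_coeffDerivation, mul_coeff_zero]

/-- This recursion is exactly what makes consecutive terms cancel when `d/dX` is applied to the
bracket of twisted iterates. -/
lemma rcCoeff_succ {n r : ℕ} (hr : r ≤ n) (k l : ℕ) :
    rcCoeff (n + 1) k l (r + 1) * ((r + 1) * (k + r)) =
      -(rcCoeff (n + 1) k l r * ((n - r + 1) * (l + (n - r)))) := by
  have h1 := Nat.choose_succ_right_eq (k + n) (n - r)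
  have h2 := Nat.choose_succ_right_eq (l + n) r
  rw [show k + n - (n - r) = k + r by omega] at h1
  rw [show l + n - r = l + (n - r) by omega] at h2
  have h1' := congrArg (Nat.cast : ℕ → ℂ) h1
  have h2' := congrArg (Nat.cast : ℕ → ℂ) h2
  simp only [rcCoeff, show n + 1 - (r + 1) = n - r by omega, show n + 1 - r = n - r + 1 by omega,
    show k + (n + 1) - 1 = k + n by omega, show l + (n + 1) - 1 = l + n by omega, pow_succ]
  push_cast [Nat.cast_sub hr] at h1' h2' ⊢
  linear_combination ((-1) ^ r * ((l + n).choose (r + 1) : ℂ) * (r + 1)) * h1' -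
    ((-1) ^ r * ((k + n).choose (n - r + 1) : ℂ) * (n - r + 1)) * h2'

/-- The `X`-derivative of the left side vanishes, so the sum equals its value at `X = 0`, where the
twisted iterates are the ordinary ones. -/
lemma rankinCohen_twistedIterate (d : Derivation ℂ R R) (n k l : ℕ) (f g : R) :
    ∑ r ∈ Finset.range (n + 1), rcCoeff n k l r •
      (twistedIterate d k f r * twistedIterate d l g (n - r)) = C (rankinCohen d n k l f g) := by
  rw [eq_C_of_derivative_eq_zero (p := ∑ r ∈ Finset.range (n + 1), rcCoeff n k l r •
      (twistedIterate d k f r * twistedIterate d l g (n - r))) ?_, finsetSum_coeff,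
      rankinCohen_apply]
  · simp only [coeff_smul, mul_coeff_zero, coeff_zero_twistedIterate]
  rcases n with _ | n
  · simp [twistedIterate]
  have h0 (k : ℕ) (f : R) : derivative (twistedIterate d k f 0) = 0 := derivative_C
  simp only [derivative_sum, derivative_smul, derivative_mul, smul_add, Finset.sum_add_distrib]
  -- The Leibniz rule gives two sums. The `r = 0` term of the first and the `r = n + 1` term of the
  -- second vanish; after a shift of the first, the rest cancels in pairs.
  rw [Finset.sum_range_succ', Finset.sum_range_succ _ (n + 1), Nat.sub_self, h0, h0, zero_mul,
    mul_zero, smul_zero, smul_zero, add_zero, add_zero, ← Finset.sum_add_distrib]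
  refine Finset.sum_eq_zero fun r hr => ?_
  have hr' : r ≤ n := Nat.lt_succ_iff.mp (Finset.mem_range.mp hr)
  rw [derivative_twistedIterate, show n + 1 - (r + 1) = n - r by omega,
    show n + 1 - r = n - r + 1 by omega, derivative_twistedIterate]
  have h1 := congrArg (algebraMap ℂ R[X]) (rcCoeff_succ hr' k l)
  simp only [Algebra.smul_def]
  push_cast [← Nat.cast_sub hr'] at h1 ⊢
  linear_combination (twistedIterate d k f r * twistedIterate d l g (n - r)) * h1

lemma eval_coeffDerivation (d : Derivation ℂ R R) (x : R) (p : R[X]) :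
    d (eval x p) = eval x (coeffDerivation d p) + eval x (derivative p) * d x := by
  induction p using Polynomial.induction_on' with
  | add p q hp hq => simp only [eval_add, map_add, hp, hq]; ring
  | monomial n a =>
    rw [← C_mul_X_pow_eq_monomial, eval_mul, eval_C, eval_pow, eval_X, Derivation.leibniz, Derivation.leibniz,
      coeffDerivation_C, Derivation.leibniz_pow, Derivation.leibniz_pow, coeffDerivation_X]
    simp [derivative_X_pow]
    ring

/-- Rankin-Cohen brackets do not change when the derivation is twisted by `x`. -/
theorem rankinCohen_twist (d : Derivation ℂ R R) {x : R} (hx : d x = -x ^ 2) {k l : ℕ}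
    {u v : ℕ → R} (hu : ∀ r, u (r + 1) = d (u r) + ((k + 2 * r : ℕ) : R) * (x * u r))
    (hv : ∀ r, v (r + 1) = d (v r) + ((l + 2 * r : ℕ) : R) * (x * v r)) (n : ℕ) :
    ∑ r ∈ Finset.range (n + 1), rcCoeff n k l r • (u r * v (n - r)) =
      rankinCohen d n k l (u 0) (v 0) := by
  -- A twisted sequence is the universal one evaluated at `X = x`: the term `-X² d/dX` of the
  -- universal recursion is the chain-rule contribution of `d x = -x²`.
  have key {k : ℕ} {u : ℕ → R}
      (hu : ∀ r, u (r + 1) = d (u r) + ((k + 2 * r : ℕ) : R) * (x * u r)) (r : ℕ) :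
      eval x (twistedIterate d k (u 0) r) = u r := by
    induction r with
    | zero => simp [twistedIterate]
    | succ r ih =>
      rw [hu, ← ih, eval_coeffDerivation, hx]
      simp only [twistedIterate, eval_add, eval_sub, eval_mul, eval_pow, eval_X, eval_natCast]
      ring
  have h1 := congrArg (eval x) (rankinCohen_twistedIterate d n k l (u 0) (v 0))
  simpa only [eval_finsetSum, eval_smul, eval_mul, key hu, key hv, eval_C] using h1

end Twist

end RankinCohen

/-! ### Partial derivatives of holomorphic functions of two variables -/

section PartialDerivatives

open Metric MeasureTheory

variable {U : Set (ℂ × ℂ)} {f : ℂ × ℂ → ℂ}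

lemma hasDerivAt_lineMap {p v : ℂ × ℂ} {s : ℂ} (hf : DifferentiableAt ℂ f (p + s • v)) :
    HasDerivAt (fun t : ℂ => f (p + t • v)) (fderiv ℂ f (p + s • v) v) s := by
  have h1 : HasDerivAt (fun t : ℂ => p + t • v) v s := by
    simpa using ((hasDerivAt_id s).smul_const v).const_add p
  exact hf.hasFDerivAt.comp_hasDerivAt s h1

/-- A Cauchy estimate for the Fréchet derivative. -/
lemma norm_fderiv_le_of_bound {p : ℂ × ℂ} {r C : ℝ} (hr : 0 < r)
    (hf : DifferentiableOn ℂ f (ball p (2 * r))) (hC : ∀ q ∈ ball p (2 * r), ‖f q‖ ≤ C)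
    {q : ℂ × ℂ} (hq : q ∈ ball p r) : ‖fderiv ℂ f q‖ ≤ 2 * C / r := by
  have hC0 : 0 ≤ C := (norm_nonneg _).trans (hC p (mem_ball_self (by linarith)))
  refine ContinuousLinearMap.opNorm_le_bound _ (by positivity) fun v => ?_
  rcases eq_or_ne v 0 with rfl | hv
  · simp
  have hv' : 0 < ‖v‖ := norm_pos_iff.mpr hv
  -- On this disc the point moves by at most `r / 2`, hence stays in the ball of radius `2r`. The
  -- one-variable Cauchy estimate on it gives `C / (r / (2‖v‖)) = (2C / r) ‖v‖`.
  have hmem : ∀ s ∈ closedBall (0 : ℂ) (r / (2 * ‖v‖)), q + s • v ∈ ball p (2 * r) := by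
    intro s hs
    rw [mem_closedBall_zero_iff, le_div_iff₀ (by positivity)] at hs
    rw [mem_ball, dist_eq_norm] at hq ⊢
    have h1 : q + s • v - p = (q - p) + s • v := by abel
    rw [h1]
    refine (norm_add_le _ _).trans_lt ?_
    rw [norm_smul]
    nlinarith
  have hd : ∀ s ∈ closedBall (0 : ℂ) (r / (2 * ‖v‖)),
      HasDerivAt (fun t : ℂ => f (q + t • v)) (fderiv ℂ f (q + s • v) v) s := fun s hs =>
    hasDerivAt_lineMap ((hf _ (hmem s hs)).differentiableAt (isOpen_ball.mem_nhds (hmem s hs)))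
  have hr' : 0 < r / (2 * ‖v‖) := by positivity
  have h2 := norm_deriv_le_of_forall_mem_sphere_norm_le (f := fun t : ℂ => f (q + t • v))
    (C := C) hr' (DifferentiableOn.diffContOnCl fun s hs =>
      (hd s (closure_ball_subset_closedBall hs)).differentiableAt.differentiableWithinAt)
    (fun s hs => hC _ (hmem s (sphere_subset_closedBall hs)))
  rw [(hd 0 (mem_closedBall_self hr'.le)).deriv, zero_smul, add_zero] at h2
  refine h2.trans (le_of_eq ?_)
  field_simp

/-- Directional derivatives of a holomorphic function of two variables are holomorphic. -/
theorem differentiableOn_fderiv_apply (hU : IsOpen U) (hf : DifferentiableOn ℂ f U)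
    (v : ℂ × ℂ) : DifferentiableOn ℂ (fun p => fderiv ℂ f p v) U := by
  intro p hp
  refine DifferentiableAt.differentiableWithinAt ?_
  obtain ⟨r, hr, hrU, C, hC⟩ : ∃ r > 0, ball p (4 * r) ⊆ U ∧ ∃ C, ∀ q ∈ ball p (4 * r),
      ‖f q‖ ≤ C := by
    have h1 := ((hf p hp).differentiableAt (hU.mem_nhds hp)).continuousAt
    have h2 : ∀ᶠ q in 𝓝 p, q ∈ U ∧ ‖f q‖ ≤ ‖f p‖ + 1 :=
      (hU.eventually_mem hp).and ((h1.norm.eventually_lt_const (lt_add_one _)).mono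
        fun _ h => h.le)
    obtain ⟨ε, hε, h3⟩ := Metric.eventually_nhds_iff_ball.mp h2
    refine ⟨ε / 4, by linarith, fun q hq => (h3 q ?_).1, ‖f p‖ + 1, fun q hq => (h3 q ?_).2⟩ <;>
    rwa [show 4 * (ε / 4) = ε by ring] at hq
  have hbound : ∀ q ∈ ball p (2 * r), ‖fderiv ℂ f q‖ ≤ 2 * C / (2 * r) := fun q hq =>
    norm_fderiv_le_of_bound (by linarith)
      (hf.mono (by rwa [show 2 * (2 * r) = 4 * r by ring]))
      (by rwa [show 2 * (2 * r) = 4 * r by ring]) hq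
  -- The `+ 1` allows `v = 0` and makes `ε ‖v‖ < r`.
  set ε : ℝ := r / (‖v‖ + 1) with hε
  have hv0 : 0 < ‖v‖ + 1 := by positivity
  have hε0 : 0 < ε := by positivity
  have hmem : ∀ q ∈ ball p r, ∀ s ∈ closedBall (0 : ℂ) ε, q + s • v ∈ ball p (2 * r) := by
    intro q hq s hs
    rw [mem_closedBall_zero_iff, hε, le_div_iff₀ hv0] at hs
    rw [mem_ball, dist_eq_norm] at hq ⊢
    rw [show q + s • v - p = (q - p) + s • v by abel]
    refine (norm_add_le _ _).trans_lt ?_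
    rw [norm_smul]
    nlinarith [norm_nonneg s]
  have hmemU : ∀ q ∈ ball p r, ∀ s ∈ closedBall (0 : ℂ) ε, q + s • v ∈ U := fun q hq s hs =>
    hrU (ball_subset_ball (by linarith) (hmem q hq s hs))
  have hdiff : ∀ q ∈ ball p r, ∀ s ∈ closedBall (0 : ℂ) ε, DifferentiableAt ℂ f (q + s • v) :=
    fun q hq s hs => (hf _ (hmemU q hq s hs)).differentiableAt (hU.mem_nhds (hmemU q hq s hs))
  have hcirc (θ : ℝ) : circleMap 0 ε θ ∈ closedBall (0 : ℂ) ε :=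
    circleMap_mem_closedBall 0 hε0.le θ
  set c : ℝ → ℂ := fun θ => deriv (circleMap 0 ε) θ * ((circleMap 0 ε θ) ^ 2)⁻¹ with hc
  have hc_cont : Continuous c := by
    refine Continuous.mul ?_ (Continuous.inv₀ ((continuous_circleMap 0 ε).pow 2) fun θ => ?_)
    · rw [show deriv (circleMap 0 ε) = fun θ => circleMap 0 ε θ * I from
        funext fun θ => deriv_circleMap 0 ε θ]
      exact (continuous_circleMap 0 ε).mul continuous_const
    · exact pow_ne_zero 2 (by simpa using hε0.ne')
  -- Cauchy's formula on the complex line through `q` in direction `v` expresses the derivative by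
  -- values of `f` alone. Differentiating in `q` under the integral then uses only first derivatives
  -- of `f`.
  have hformula : ∀ q ∈ ball p r, fderiv ℂ f q v =
      (2 * Real.pi * I : ℂ)⁻¹ • ∫ θ in (0 : ℝ)..2 * Real.pi,
        c θ * f (q + circleMap 0 ε θ • v) := by
    intro q hq
    have h1 := two_pi_I_inv_smul_circleIntegral_sub_sq_inv_smul_of_differentiable
      (U := {s : ℂ | q + s • v ∈ U}) (f := fun t : ℂ => f (q + t • v)) (c := 0) (w₀ := 0) (R := ε)
      (hU.preimage (by fun_prop)) (fun s hs => hmemU q hq s hs)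
      (fun s hs => (hasDerivAt_lineMap
        ((hf _ hs).differentiableAt (hU.mem_nhds hs))).differentiableAt.differentiableWithinAt)
      (mem_ball_self hε0)
    rw [(hasDerivAt_lineMap (hdiff q hq 0 (mem_closedBall_self hε0.le))).deriv] at h1
    rw [zero_smul, add_zero] at h1
    rw [← h1, circleIntegral]
    simp only [hc, sub_zero, smul_eq_mul, mul_assoc]
  have hcontF : ∀ q ∈ ball p r, Continuous fun θ : ℝ => c θ * f (q + circleMap 0 ε θ • v) := by
    intro q hq
    refine hc_cont.mul (continuous_iff_continuousAt.mpr fun θ => ?_)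
    exact (hdiff q hq _ (hcirc θ)).continuousAt.comp (f := fun θ : ℝ => q + circleMap 0 ε θ • v)
      (by fun_prop)
  have hint := intervalIntegral.hasFDerivAt_integral_of_dominated_of_fderiv_le
    (𝕜 := ℂ) (μ := volume) (a := 0) (b := 2 * Real.pi) (s := ball p r) (x₀ := p)
    (F := fun q θ => c θ * f (q + circleMap 0 ε θ • v))
    (F' := fun q θ => c θ • fderiv ℂ f (q + circleMap 0 ε θ • v))
    (bound := fun θ => ‖c θ‖ * (2 * C / (2 * r))) (ball_mem_nhds p hr)
    (eventually_of_mem (ball_mem_nhds p hr) fun q hq => (hcontF q hq).aestronglyMeasurable)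
    ((hcontF p (mem_ball_self hr)).intervalIntegrable _ _)
    (by
      refine AEStronglyMeasurable.smul hc_cont.aestronglyMeasurable ?_
      refine Measurable.aestronglyMeasurable ?_
      -- Measurability of the derivative is automatic; its continuity need not be known.
      exact (measurable_fderiv ℂ f).comp (by fun_prop))
    (Eventually.of_forall fun θ _ q hq => by
      rw [norm_smul]
      exact mul_le_mul_of_nonneg_left (hbound _ (hmem q hq _ (hcirc θ))) (norm_nonneg _))
    ((hc_cont.norm.mul continuous_const).intervalIntegrable _ _)
    (Eventually.of_forall fun θ _ q hq => by
      have h1 : HasFDerivAt (fun q : ℂ × ℂ => f (q + circleMap 0 ε θ • v))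
          (fderiv ℂ f (q + circleMap 0 ε θ • v)) q :=
        HasFDerivAt.comp (g := f) (f := fun q : ℂ × ℂ => q + circleMap 0 ε θ • v) q
          (hdiff q hq _ (hcirc θ)).hasFDerivAt ((hasFDerivAt_id q).add_const _)
      exact h1.const_mul (c θ))
  refine (hint.differentiableAt.const_smul ((2 * Real.pi * I : ℂ)⁻¹)).congr_of_eventuallyEq ?_
  exact eventually_of_mem (ball_mem_nhds p hr) hformula

end PartialDerivatives

/-! ### Poles and Laurent expansions in families -/

section Poles

open Metric

/-- `z ↦ (z - z₀) ^ N * h z` is bounded on a punctured neighbourhood of `z₀`. -/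
def PoleBound (h : ℂ → ℂ) (z₀ : ℂ) (N : ℕ) : Prop :=
  ∃ C : ℝ, ∃ δ > 0, ∀ w : ℂ, w ≠ 0 → ‖w‖ < δ → ‖w ^ N * h (z₀ + w)‖ ≤ C

lemma poleBound_iff_eventually {h : ℂ → ℂ} {z₀ : ℂ} {N : ℕ} : PoleBound h z₀ N ↔
    ∃ C : ℝ, ∀ᶠ z in 𝓝[≠] z₀, ‖(z - z₀) ^ N * h z‖ ≤ C := by
  refine exists_congr fun C => ?_
  rw [eventually_nhdsWithin_iff, Metric.eventually_nhds_iff_ball]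
  refine exists_congr fun δ => and_congr_right fun _ => ⟨fun H z hz hne => ?_, fun H w hw hδ => ?_⟩
  · simpa using H (z - z₀) (sub_ne_zero.mpr hne) (by rwa [mem_ball, dist_eq_norm] at hz)
  · simpa using H (z₀ + w) (by simpa [dist_eq_norm] using hδ) (by simpa using hw)

/-- Extension of a bounded holomorphic function over a puncture. -/
lemma exists_extension {h : ℂ → ℂ} {r : ℝ} (hr : 0 < r)
    (hd : DifferentiableOn ℂ h (ball 0 r \ {0})) {C δ : ℝ} (hδ : 0 < δ)
    (hb : ∀ w : ℂ, w ≠ 0 → ‖w‖ < δ → ‖h w‖ ≤ C) :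
    ∃ g : ℂ → ℂ, DifferentiableOn ℂ g (ball 0 r) ∧ ∀ w ≠ 0, g w = h w := by
  refine ⟨Function.update h 0 (limUnder (𝓝[≠] 0) h),
    differentiableOn_update_limUnder_of_isLittleO (ball_mem_nhds 0 hr) hd ?_,
    fun w hw => Function.update_of_ne hw _ _⟩
  refine IsBoundedUnder.isLittleO_sub_self_inv ⟨C + ‖h 0‖, eventually_map.2 ?_⟩
  rw [eventually_nhdsWithin_iff]
  filter_upwards [ball_mem_nhds (0 : ℂ) hδ] with w hw hne
  exact norm_sub_le_of_le (hb w hne (by simpa using hw)) le_rfl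

/-- Riemann's removable singularity theorem for `(z - z₀)^N h`. It replaces the meromorphic order by
a bound, which Cauchy estimates can propagate to derivatives. -/
lemma poleBound_iff {h : ℂ → ℂ} {z₀ : ℂ} {N : ℕ}
    (hd : ∀ᶠ z in 𝓝[≠] z₀, DifferentiableAt ℂ h z) :
    (MeromorphicAt h z₀ ∧ ((-(N : ℤ) : ℤ) : WithTop ℤ) ≤ meromorphicOrderAt h z₀) ↔
      PoleBound h z₀ N := by
  have hpow (n : ℤ) : MeromorphicAt ((· - z₀) ^ n : ℂ → ℂ) z₀ := by fun_prop
  constructor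
  · rintro ⟨hm, ho⟩
    rw [poleBound_iff_eventually]
    have h1 : 0 ≤ meromorphicOrderAt (((· - z₀) ^ (N : ℤ) : ℂ → ℂ) * h) z₀ := by
      rw [meromorphicOrderAt_mul (hpow _) hm, meromorphicOrderAt_zpow_id_sub_const]
      calc (0 : WithTop ℤ) = ((N : ℤ) : WithTop ℤ) + ((-(N : ℤ) : ℤ) : WithTop ℤ) := by
            rw [← WithTop.coe_add, add_neg_cancel, WithTop.coe_zero]
        _ ≤ _ := add_le_add le_rfl ho
    obtain ⟨c, hc⟩ := tendsto_nhds_of_meromorphicOrderAt_nonneg ((hpow _).mul hm) h1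
    refine ⟨‖c‖ + 1, (hc.norm.eventually_lt_const (lt_add_one _)).mono fun z hz => ?_⟩
    simpa using hz.le
  · rw [poleBound_iff_eventually]
    rintro ⟨C, hC⟩
    set H : ℂ → ℂ := fun z => (z - z₀) ^ N * h z with hH
    have h1 : ∀ᶠ z in 𝓝[≠] z₀, DifferentiableAt ℂ H z := hd.mono fun z hz => by fun_prop
    have h2 := (h1.and hC)
    rw [eventually_nhdsWithin_iff] at h2
    have h3 : DifferentiableOn ℂ (Function.update H z₀ (limUnder (𝓝[≠] z₀) H))
        {z | z ∈ ({z₀}ᶜ : Set ℂ) → DifferentiableAt ℂ H z ∧ ‖H z‖ ≤ C} := by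
      refine differentiableOn_update_limUnder_of_bddAbove h2
        (fun z hz => (hz.1 hz.2).1.differentiableWithinAt) ⟨C, ?_⟩
      rintro _ ⟨z, hz, rfl⟩
      exact (hz.1 hz.2).2
    have h4 := h3.analyticAt h2
    have h5 : h =ᶠ[𝓝[≠] z₀] ((· - z₀) ^ (-(N : ℤ)) : ℂ → ℂ) *
        Function.update H z₀ (limUnder (𝓝[≠] z₀) H) := by
      filter_upwards [self_mem_nhdsWithin] with z hz
      have hz' : z - z₀ ≠ 0 := sub_ne_zero.mpr hz
      rw [Pi.mul_apply, Function.update_of_ne hz, hH]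
      simp only [Pi.pow_apply, zpow_neg, zpow_natCast]
      field_simp
    refine ⟨((hpow _).mul h4.meromorphicAt).congr h5.symm, ?_⟩
    rw [meromorphicOrderAt_congr h5, meromorphicOrderAt_mul (hpow _) h4.meromorphicAt,
      meromorphicOrderAt_zpow_id_sub_const]
    exact le_add_of_nonneg_right h4.meromorphicOrderAt_nonneg

/-- Cauchy's estimate on the circle of radius `‖w‖ / 2` about `z₀ + w`. Its points are at distance
at least `‖w‖ / 2` from `z₀`, which costs `2^N` in the bound for `h`; the radius costs another
factor `2 / ‖w‖`. -/
lemma PoleBound.deriv {h : ℂ → ℂ} {z₀ : ℂ} {N : ℕ}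
    (hd : ∀ᶠ z in 𝓝[≠] z₀, DifferentiableAt ℂ h z) (hb : PoleBound h z₀ N) :
    PoleBound (deriv h) z₀ (N + 1) := by
  obtain ⟨C, δ₁, hδ₁, hb⟩ := hb
  rw [eventually_nhdsWithin_iff, Metric.eventually_nhds_iff_ball] at hd
  obtain ⟨δ₂, hδ₂, hd⟩ := hd
  set δ := min δ₁ δ₂
  have hδ : 0 < δ := lt_min hδ₁ hδ₂
  refine ⟨C * 2 ^ (N + 1), δ / 2, by positivity, fun w hw hwδ => ?_⟩
  have hw0 : 0 < ‖w‖ := norm_pos_iff.mpr hw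
  have hmem : ∀ s ∈ closedBall (z₀ + w) (‖w‖ / 2),
      ‖w‖ / 2 ≤ ‖s - z₀‖ ∧ ‖s - z₀‖ < δ := by
    intro s hs
    rw [mem_closedBall, dist_eq_norm] at hs
    have h1 : s - z₀ = w + (s - (z₀ + w)) := by ring
    constructor
    · have := norm_sub_norm_le w (-(s - (z₀ + w)))
      rw [norm_neg, sub_neg_eq_add, ← h1] at this
      linarith
    · rw [h1]
      refine (norm_add_le _ _).trans_lt ?_
      linarith
  have hne : ∀ s ∈ closedBall (z₀ + w) (‖w‖ / 2), s ≠ z₀ := by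
    rintro s hs rfl
    have := (hmem s hs).1
    rw [sub_self, norm_zero] at this
    linarith
  have h1 := norm_deriv_le_of_forall_mem_sphere_norm_le (f := h) (c := z₀ + w) (R := ‖w‖ / 2)
    (C := C / (‖w‖ / 2) ^ N) (by positivity)
    (DifferentiableOn.diffContOnCl fun s hs => by
      have hs' := closure_ball_subset_closedBall hs
      refine (hd s ?_ (hne s hs')).differentiableWithinAt
      rw [mem_ball, dist_eq_norm]
      exact (hmem s hs').2.trans_le (min_le_right _ _))
    (fun s hs => by
      have hs' := sphere_subset_closedBall hs
      have h2 := hb (s - z₀) (sub_ne_zero.mpr (hne s hs')) ((hmem s hs').2.trans_le (min_le_left _ _))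
      rw [add_sub_cancel, norm_mul, norm_pow] at h2
      rw [le_div_iff₀ (by positivity)]
      refine le_trans ?_ h2
      rw [mul_comm]
      gcongr
      exact (hmem s hs').1)
  rw [norm_mul, norm_pow]
  calc ‖w‖ ^ (N + 1) * ‖_root_.deriv h (z₀ + w)‖
      ≤ ‖w‖ ^ (N + 1) * (C / (‖w‖ / 2) ^ N / (‖w‖ / 2)) := by gcongr
    _ = C * 2 ^ (N + 1) := by
      rw [div_pow, pow_succ, pow_succ]
      field_simp

/-- Uniqueness of Taylor coefficients, on a punctured neighbourhood. -/
lemma eq_taylor_coeff {g : ℂ → ℂ} {r : ℝ} (hr : 0 < r) (hg : DifferentiableOn ℂ g (ball 0 r))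
    {a : ℕ → ℂ} (ha : ∀ᶠ w in 𝓝[≠] (0 : ℂ), HasSum (fun n => a n * w ^ n) (g w)) (n : ℕ) :
    a n = (n.factorial : ℂ)⁻¹ * iteratedDeriv n g 0 := by
  have hga : AnalyticAt ℂ g 0 := hg.analyticAt (ball_mem_nhds 0 hr)
  have h0 : HasSum (fun n => a n * (0 : ℂ) ^ n) (a 0) := by
    convert hasSum_ite_eq (0 : ℕ) (a 0) using 2 with n
    rcases n with _ | n <;> simp
  -- The expansion is assumed only off `0`, so the value `a 0` is imposed there. Continuity then
  -- shows that `g` already had this value.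
  have h1 : HasFPowerSeriesAt (Function.update g 0 (a 0))
      (FormalMultilinearSeries.ofScalars ℂ a) 0 := by
    rw [hasFPowerSeriesAt_iff]
    rw [eventually_nhdsWithin_iff] at ha
    filter_upwards [ha] with w hw
    rw [zero_add]
    rcases eq_or_ne w 0 with rfl | hne
    · simpa [FormalMultilinearSeries.coeff_ofScalars, mul_comm] using h0
    · rw [Function.update_of_ne hne]
      simpa [FormalMultilinearSeries.coeff_ofScalars, mul_comm] using hw hne
  have h2 : Function.update g 0 (a 0) =ᶠ[𝓝 0] g := by
    rw [← h1.analyticAt.continuousAt.eventuallyEq_nhds_iff_eventuallyEq_nhdsNE hga.continuousAt]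
    filter_upwards [self_mem_nhdsWithin] with w hw
    exact Function.update_of_ne hw _ _
  have h3 := (h1.congr h2).eq_formalMultilinearSeries hga.hasFPowerSeriesAt
  have h4 := congrArg (fun p => FormalMultilinearSeries.coeff p n) h3
  simp only [FormalMultilinearSeries.coeff_ofScalars] at h4
  rw [h4, div_eq_inv_mul]

/-- A family of holomorphic functions with removable singularities is locally bounded, uniformly
in the parameter. -/
lemma exists_uniform_bound {G : ℂ × ℂ → ℂ} {τ : ℂ} {ε r : ℝ} (hr : 0 < r)
    (hG : ∀ t ∈ closedBall τ ε, ∀ w ∈ ball (0 : ℂ) r, w ≠ 0 → DifferentiableAt ℂ G (t, w))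
    (hb : ∀ t ∈ closedBall τ ε, PoleBound (fun w => G (t, w)) 0 0) {ρ : ℝ} (hρ : 0 < ρ)
    (hρr : ρ < r) :
    ∃ C : ℝ, ∀ t ∈ closedBall τ ε, ∃ g : ℂ → ℂ, DifferentiableOn ℂ g (ball 0 r) ∧
      (∀ w ≠ 0, g w = G (t, w)) ∧ ∀ w ∈ closedBall (0 : ℂ) ρ, ‖g w‖ ≤ C := by
  -- On this compact set `w` stays away from `0`, so `G` is bounded. The maximum principle carries
  -- the bound from the circle to the disc, uniformly in `t`.
  have hcomp : IsCompact (closedBall τ ε ×ˢ sphere (0 : ℂ) ρ) :=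
    (isCompact_closedBall _ _).prod (isCompact_sphere _ _)
  obtain ⟨C, hC⟩ := hcomp.exists_bound_of_continuousOn (f := G) (by
    rintro ⟨t, w⟩ ⟨ht, hw⟩
    have hw' : ‖w‖ = ρ := by simpa using hw
    refine (hG t ht w (by simpa [hw'] using hρr) ?_).continuousAt.continuousWithinAt
    rintro rfl
    simp [hρ.ne] at hw')
  refine ⟨C, fun t ht => ?_⟩
  obtain ⟨C', δ, hδ, hb'⟩ := hb t ht
  obtain ⟨g, hg, hgG⟩ := exists_extension (h := fun w => G (t, w)) hr
    (fun w hw => by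
      have h1 : DifferentiableAt ℂ (fun w : ℂ => (t, w)) w := by fun_prop
      exact ((hG t ht w hw.1 hw.2).comp w h1).differentiableWithinAt) hδ
    (fun w hw hwδ => by simpa using hb' w hw hwδ)
  refine ⟨g, hg, hgG, fun w hw => ?_⟩
  rw [← closure_ball _ hρ.ne'] at hw
  refine norm_le_of_forall_mem_frontier_norm_le isBounded_ball
    (hg.mono ?_).diffContOnCl (fun s hs => ?_) hw
  · rw [closure_ball _ hρ.ne']
    exact closedBall_subset_ball hρr
  · rw [frontier_ball _ hρ.ne'] at hs
    have hs0 : s ≠ 0 := by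
      rintro rfl
      simp [hρ.ne] at hs
    rw [hgG s hs0]
    exact hC (t, s) ⟨ht, hs⟩

lemma hasDerivAt_fst {G : ℂ × ℂ → ℂ} {t w : ℂ} (h : DifferentiableAt ℂ G (t, w)) :
    HasDerivAt (fun s => G (s, w)) (fderiv ℂ G (t, w) (1, 0)) t :=
  HasFDerivAt.comp_hasDerivAt (l := G) (f := fun s => (s, w)) t h.hasFDerivAt
    ((hasDerivAt_id t).prodMk (hasDerivAt_const t w))

lemma hasDerivAt_snd {G : ℂ × ℂ → ℂ} {t w : ℂ} (h : DifferentiableAt ℂ G (t, w)) :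
    HasDerivAt (fun s => G (t, s)) (fderiv ℂ G (t, w) (0, 1)) w :=
  HasFDerivAt.comp_hasDerivAt (l := G) (f := fun s => (t, s)) w h.hasFDerivAt
    ((hasDerivAt_const w t).prodMk (hasDerivAt_id w))

variable {G : ℂ × ℂ → ℂ} {τ : ℂ} {ε r : ℝ}

/-- The derivative in the parameter of a family with removable singularities is bounded. -/
lemma poleBound_fderiv_fst (hε : 0 < ε) (hr : 0 < r)
    (hG : ∀ t ∈ closedBall τ ε, ∀ w ∈ ball (0 : ℂ) r, w ≠ 0 → DifferentiableAt ℂ G (t, w))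
    (hb : ∀ t ∈ closedBall τ ε, PoleBound (fun w => G (t, w)) 0 0) :
    PoleBound (fun w => fderiv ℂ G (τ, w) (1, 0)) 0 0 := by
  obtain ⟨C, hC⟩ := exists_uniform_bound hr hG hb (half_pos hr) (half_lt_self hr)
  refine ⟨C / ε, r / 2, half_pos hr, fun w hw hwr => ?_⟩
  have hw' : w ∈ ball (0 : ℂ) r := by
    rw [mem_ball_zero_iff]
    linarith
  simp only [pow_zero, one_mul, zero_add]
  rw [← (hasDerivAt_fst (hG τ (mem_closedBall_self hε.le) w hw'
    hw)).deriv]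
  refine norm_deriv_le_of_forall_mem_sphere_norm_le hε (DifferentiableOn.diffContOnCl
    fun t ht => ?_) fun t ht => ?_
  · exact (hasDerivAt_fst (hG t (closure_ball_subset_closedBall ht) w hw'
      hw)).differentiableAt.differentiableWithinAt
  · obtain ⟨g, -, hg, hgC⟩ := hC t (sphere_subset_closedBall ht)
    rw [← hg w hw]
    exact hgC w (by simpa using hwr.le)

/-- Taylor expansions can be differentiated with respect to a parameter. -/
lemma hasSum_fderiv_fst (hε : 0 < ε) (hr : 0 < r)
    (hG : ∀ t ∈ closedBall τ ε, ∀ w ∈ ball (0 : ℂ) r, w ≠ 0 → DifferentiableAt ℂ G (t, w))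
    (hb : ∀ t ∈ closedBall τ ε, PoleBound (fun w => G (t, w)) 0 0) {A : ℕ → ℂ → ℂ}
    (hA : ∀ n, DifferentiableOn ℂ (A n) (ball τ ε))
    (hs : ∀ t ∈ closedBall τ ε, ∀ᶠ w in 𝓝[≠] (0 : ℂ), HasSum (fun n => A n t * w ^ n) (G (t, w))) :
    ∀ᶠ w in 𝓝[≠] (0 : ℂ),
      HasSum (fun n => deriv (A n) τ * w ^ n) (fderiv ℂ G (τ, w) (1, 0)) := by
  have hr2 := half_pos hr
  obtain ⟨C, hC⟩ := exists_uniform_bound hr hG hb hr2 (half_lt_self hr)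
  -- The radius on which `hs` holds may depend on `t`. Uniqueness of Taylor coefficients gives the
  -- expansion on the fixed disc, and Cauchy's inequalities bound the coefficients uniformly in `t`;
  -- a geometric series then dominates and permits termwise differentiation.
  have key : ∀ t ∈ closedBall τ ε, (∀ n, ‖A n t‖ ≤ C / (r / 2) ^ n) ∧
      ∀ w ∈ ball (0 : ℂ) r, w ≠ 0 → HasSum (fun n => A n t * w ^ n) (G (t, w)) := by
    intro t ht
    obtain ⟨g, hgd, hg, hgC⟩ := hC t ht
    have h1 := eq_taylor_coeff hr hgd (a := fun n => A n t) (by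
      filter_upwards [hs t ht, self_mem_nhdsWithin] with w hw hw0
      rwa [hg w hw0])
    constructor
    · intro n
      have h2 := norm_iteratedDeriv_le_of_forall_mem_sphere_norm_le (f := g) (c := 0) n hr2
        (hgd.mono (closure_ball_subset_closedBall.trans
          (closedBall_subset_ball (half_lt_self hr)))).diffContOnCl
        (fun z hz => hgC z (sphere_subset_closedBall hz))
      rw [h1, norm_mul, norm_inv, norm_natCast, inv_mul_le_iff₀ (by positivity)]
      exact h2.trans (le_of_eq (by ring))
    · intro w hw hw0
      have h2 := hasSum_taylorSeries_on_ball hgd hw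
      rw [hg w hw0] at h2
      have h3 : (fun n => A n t * w ^ n) =
          fun n => (n.factorial : ℂ)⁻¹ • (w - 0) ^ n • iteratedDeriv n g 0 := by
        funext n
        rw [h1, sub_zero, smul_eq_mul, smul_eq_mul]
        ring
      rw [h3]
      exact h2
  rw [eventually_nhdsWithin_iff]
  filter_upwards [ball_mem_nhds (0 : ℂ) hr2] with w hw hw0
  have hw' : w ∈ ball (0 : ℂ) r := ball_subset_ball (by linarith) hw
  have hwn : ‖w‖ < r / 2 := by simpa using hw
  have hsum : Summable fun n : ℕ => C * (‖w‖ / (r / 2)) ^ n :=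
    (summable_geometric_of_lt_one (by positivity) ((div_lt_one hr2).mpr hwn)).mul_left C
  have hAd (n : ℕ) : DifferentiableOn ℂ (fun t => A n t * w ^ n) (ball τ ε) :=
    (hA n).mul_const _
  have h1 := hasSum_deriv_of_summable_norm hsum hAd isOpen_ball (fun n t ht => by
    have h2 := (key t (ball_subset_closedBall ht)).1 n
    rw [norm_mul, norm_pow]
    calc ‖A n t‖ * ‖w‖ ^ n ≤ C / (r / 2) ^ n * ‖w‖ ^ n := by gcongr
      _ = _ := by rw [div_pow ‖w‖, div_mul_eq_mul_div, mul_div_assoc]) (mem_ball_self hε)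
  have h2 : deriv (fun t => ∑' n, A n t * w ^ n) τ = fderiv ℂ G (τ, w) (1, 0) := by
    rw [← (hasDerivAt_fst (hG τ (mem_closedBall_self hε.le) w hw' hw0)).deriv]
    refine Filter.EventuallyEq.deriv_eq ?_
    filter_upwards [ball_mem_nhds τ hε] with t ht
    exact ((key t (ball_subset_closedBall ht)).2 w hw' hw0).tsum_eq
  rw [h2] at h1
  have h3 (n : ℕ) : deriv (fun t => A n t * w ^ n) τ = deriv (A n) τ * w ^ n :=
    deriv_mul_const ((hA n).differentiableAt (ball_mem_nhds τ hε)) _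
  simpa only [h3] using h1

end Poles

/-! ### Derivatives of singular functions -/

section SingularDerivatives

open Metric

/-- The derivative with respect to `z`. -/
def dZ (f : dom → ℂ) : dom → ℂ :=
  fun p => deriv (fun w : ℂ => ext f (p.1.1, w)) p.1.2

/-- In the real coordinates `z = u + v τ`, which depend continuously on `(τ, z)`, the lattice
becomes the fixed closed set `ℤ × ℤ`. -/
lemma isOpen_dom : IsOpen dom := by
  set U : Set (ℂ × ℂ) := {p | 0 < p.1.im} with hU
  have hUo : IsOpen U := isOpen_lt continuous_const (by fun_prop)
  set φ : ℂ × ℂ → ℝ × ℝ := fun p => (p.2.re - p.2.im / p.1.im * p.1.re, p.2.im / p.1.im) with hφ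
  have hφc : ContinuousOn φ U := by
    intro p hp
    have : p.1.im ≠ 0 := ne_of_gt hp
    refine ContinuousAt.continuousWithinAt ?_
    fun_prop (disch := assumption)
  have hcl : IsClosed ((Set.range ((↑) : ℤ → ℝ)) ×ˢ (Set.range ((↑) : ℤ → ℝ))) :=
    Int.isClosedEmbedding_coe_real.isClosed_range.prod
      Int.isClosedEmbedding_coe_real.isClosed_range
  have h := hφc.isOpen_inter_preimage hUo hcl.isOpen_compl
  convert h using 1
  ext ⟨τ, z⟩
  simp only [dom, Set.mem_ofPred_eq, Set.mem_inter_iff, Set.mem_preimage, Set.mem_compl_iff, hφ,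
    Set.mem_prod, Set.mem_range, hU]
  refine and_congr_right fun hτ => ?_
  have hτ' : τ.im ≠ 0 := ne_of_gt hτ
  constructor
  · rintro h ⟨⟨m, hm⟩, n, hn⟩
    refine h m n (Complex.ext ?_ ?_)
    · simp only [add_re, intCast_re, mul_re, intCast_im, zero_mul, sub_zero, hm, hn]
      ring
    · simp only [add_im, intCast_im, mul_im, intCast_re, zero_mul, add_zero, zero_add, hn]
      field_simp
  · rintro h m n rfl
    refine h ⟨⟨m, ?_⟩, n, ?_⟩
    · simp [hτ']
    · simp [hτ']

lemma dom_add_lattice {τ z : ℂ} (m n : ℤ) : (τ, (m : ℂ) + n * τ + z) ∈ dom ↔ (τ, z) ∈ dom := by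
  refine and_congr_right fun _ => ⟨fun h r s e => h (r + m) (s + n) ?_,
    fun h r s e => h (r - m) (s - n) ?_⟩
  · simp only at e ⊢
    rw [e]
    push_cast
    ring
  · simp only at e ⊢
    push_cast
    linear_combination e

/-- A lattice point `m + n τ` with `n ≠ 0` has imaginary part at least `Im τ` in absolute value, and
a nonzero integer has absolute value at least 1. -/
lemma mem_dom_of_norm_lt {τ w : ℂ} (hw : w ≠ 0) (h1 : ‖w‖ < 1) (h2 : ‖w‖ < τ.im) :
    (τ, w) ∈ dom := by
  have hτ : 0 < τ.im := (norm_nonneg w).trans_lt h2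
  refine ⟨hτ, fun m n e => ?_⟩
  simp only at e
  have hn : n = 0 := by
    by_contra hn
    have h3 : (1 : ℝ) ≤ |(n : ℝ)| := by exact_mod_cast Int.one_le_abs hn
    have h4 := Complex.abs_im_le_norm w
    have h5 : w.im = n * τ.im := by rw [e]; simp
    rw [h5, abs_mul, abs_of_pos hτ] at h4
    nlinarith
  rw [hn] at e
  have hm : m = 0 := by
    by_contra hm
    have h3 : (1 : ℝ) ≤ |(m : ℝ)| := by exact_mod_cast Int.one_le_abs hm
    have h4 : ‖w‖ = |(m : ℝ)| := by rw [e]; simp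
    linarith
  exact hw (by simpa [hm] using e)

section

variable {f : dom → ℂ} (hf : DifferentiableOn ℂ (ext f) dom)

include hf

lemma differentiableAt_ext {p : ℂ × ℂ} (hp : p ∈ dom) : DifferentiableAt ℂ (ext f) p :=
  (hf p hp).differentiableAt (isOpen_dom.mem_nhds hp)

lemma ext_dTau {p : ℂ × ℂ} (hp : p ∈ dom) :
    ext (dTau f) p = (Real.pi / (2 * I)) * fderiv ℂ (ext f) p (1, 0) := by
  rw [ext_of_mem _ hp, dTau, (hasDerivAt_fst (differentiableAt_ext hf hp)).deriv]

lemma ext_dZ {p : ℂ × ℂ} (hp : p ∈ dom) : ext (dZ f) p = fderiv ℂ (ext f) p (0, 1) := by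
  rw [ext_of_mem _ hp, dZ, (hasDerivAt_snd (differentiableAt_ext hf hp)).deriv]

lemma differentiableOn_ext_dTau : DifferentiableOn ℂ (ext (dTau f)) dom :=
  ((differentiableOn_fderiv_apply isOpen_dom hf (1, 0)).const_mul _).congr fun _ hp =>
    ext_dTau hf hp

lemma differentiableOn_ext_dZ : DifferentiableOn ℂ (ext (dZ f)) dom :=
  (differentiableOn_fderiv_apply isOpen_dom hf (0, 1)).congr fun _ hp => ext_dZ hf hp

lemma eventually_differentiableAt_snd (τ : ℍ) (w : ℂ) :
    ∀ᶠ z in 𝓝[≠] w, DifferentiableAt ℂ (fun z => ext f (τ, z)) z :=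
  (eventually_mem_dom τ w).mono fun _ hz =>
    (hasDerivAt_snd (differentiableAt_ext hf hz)).differentiableAt

lemma polesBoundedBy_iff (N : ℕ) : PolesBoundedBy f N ↔ ∀ (τ : ℍ) (m n : ℤ),
    PoleBound (fun z : ℂ => ext f (τ, z)) ((m : ℂ) + (n : ℂ) * (τ : ℂ)) N :=
  forall_congr' fun τ => forall_congr' fun _ => forall_congr' fun _ =>
    poleBound_iff (eventually_differentiableAt_snd hf τ _)

/-- Used to differentiate at a fixed distance `w` from the moving lattice point `m + n τ`. -/
lemma hasDerivAt_shift {t w : ℂ} (h : (t, w) ∈ dom) (m n : ℤ) :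
    HasDerivAt (fun s : ℂ => ext f (s, (m : ℂ) + n * s + w))
      (fderiv ℂ (ext f) (t, (m : ℂ) + n * t + w) (1, (n : ℂ))) t := by
  have h1 : HasDerivAt (fun s : ℂ => (m : ℂ) + n * s + w) (n : ℂ) t := by
    simpa using (((hasDerivAt_id t).const_mul (n : ℂ)).const_add (m : ℂ)).add_const w
  exact HasFDerivAt.comp_hasDerivAt (l := ext f) (f := fun s => (s, (m : ℂ) + n * s + w)) t
    (differentiableAt_ext hf ((dom_add_lattice m n).mpr h)).hasFDerivAt
    ((hasDerivAt_id t).prodMk h1)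

end

lemma PoleBound.mono {h : ℂ → ℂ} {z₀ : ℂ} {N M : ℕ} (hb : PoleBound h z₀ N) (hNM : N ≤ M) :
    PoleBound h z₀ M := by
  obtain ⟨C, δ, hδ, hb⟩ := hb
  refine ⟨C, min δ 1, lt_min hδ one_pos, fun w hw hwδ => ?_⟩
  obtain ⟨k, rfl⟩ := Nat.exists_eq_add_of_le hNM
  rw [pow_add, mul_right_comm, norm_mul, norm_pow]
  have h1 := hb w hw (hwδ.trans_le (min_le_left _ _))
  calc _ ≤ ‖w ^ N * h (z₀ + w)‖ * 1 := by
        gcongr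
        exact pow_le_one₀ (norm_nonneg _) (hwδ.trans_le (min_le_right _ _)).le
    _ ≤ C := by rwa [mul_one]

lemma PoleBound.linearComb {h₁ h₂ : ℂ → ℂ} {z₀ : ℂ} {N : ℕ} (hb₁ : PoleBound h₁ z₀ N)
    (hb₂ : PoleBound h₂ z₀ N) (a b : ℂ) : PoleBound (fun z => a * h₁ z + b * h₂ z) z₀ N := by
  rw [poleBound_iff_eventually] at *
  obtain ⟨C₁, hC₁⟩ := hb₁
  obtain ⟨C₂, hC₂⟩ := hb₂
  refine ⟨‖a‖ * C₁ + ‖b‖ * C₂, ?_⟩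
  filter_upwards [hC₁, hC₂] with z h1 h2
  have e : (z - z₀) ^ N * (a * h₁ z + b * h₂ z) =
      a * ((z - z₀) ^ N * h₁ z) + b * ((z - z₀) ^ N * h₂ z) := by ring
  rw [e]
  refine (norm_add_le _ _).trans ?_
  rw [norm_mul a, norm_mul b]
  gcongr

lemma PoleBound.congr {h₁ h₂ : ℂ → ℂ} {z₀ : ℂ} {N : ℕ} (hb : PoleBound h₁ z₀ N)
    (h : h₁ =ᶠ[𝓝[≠] z₀] h₂) : PoleBound h₂ z₀ N := by
  rw [poleBound_iff_eventually] at *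
  obtain ⟨C, hC⟩ := hb
  refine ⟨C, ?_⟩
  filter_upwards [hC, h] with z h1 h2
  rwa [← h2]

lemma polesBoundedBy_dZ {f : dom → ℂ} (hf : DifferentiableOn ℂ (ext f) dom) {N : ℕ}
    (hN : PolesBoundedBy f N) : PolesBoundedBy (dZ f) (N + 1) := by
  rw [polesBoundedBy_iff (differentiableOn_ext_dZ hf)]
  rw [polesBoundedBy_iff hf] at hN
  intro τ m n
  refine ((hN τ m n).deriv (eventually_differentiableAt_snd hf τ _)).congr ?_
  filter_upwards [eventually_mem_dom τ _] with z hz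
  rw [ext_dZ hf hz, (hasDerivAt_snd (differentiableAt_ext hf hz)).deriv]

/-- The family `w ^ N * f (t, m + n t + w)` near `w = 0`. -/
lemma shifted_family {f : dom → ℂ} (hf : DifferentiableOn ℂ (ext f) dom) {N : ℕ}
    (hN : PolesBoundedBy f N) (τ : ℍ) (m n : ℤ) :
    (∀ t ∈ closedBall (τ : ℂ) ((τ : ℂ).im / 2), ∀ w ∈ ball (0 : ℂ) (min 1 ((τ : ℂ).im / 2)),
      w ≠ 0 → (t, w) ∈ dom ∧ DifferentiableAt ℂ
        (fun p : ℂ × ℂ => p.2 ^ N * ext f (p.1, (m : ℂ) + n * p.1 + p.2)) (t, w)) ∧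
    ∀ t ∈ closedBall (τ : ℂ) ((τ : ℂ).im / 2),
      PoleBound (fun w => w ^ N * ext f (t, (m : ℂ) + n * t + w)) 0 0 := by
  have hτ : 0 < (τ : ℂ).im := τ.2
  have him : ∀ t ∈ closedBall (τ : ℂ) ((τ : ℂ).im / 2), (τ : ℂ).im / 2 ≤ t.im := by
    intro t ht
    rw [mem_closedBall, dist_eq_norm] at ht
    have h1 := (abs_le.mp ((Complex.abs_im_le_norm (t - τ)).trans ht)).1
    rw [sub_im] at h1
    linarith
  constructor
  · intro t ht w hw hw0
    rw [mem_ball_zero_iff, lt_min_iff] at hw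
    have hmem := mem_dom_of_norm_lt hw0 hw.1 (hw.2.trans_le (him t ht))
    refine ⟨hmem, DifferentiableAt.mul (by fun_prop) ?_⟩
    exact DifferentiableAt.comp (g := ext f)
      (f := fun p : ℂ × ℂ => (p.1, (m : ℂ) + n * p.1 + p.2)) (t, w)
      (differentiableAt_ext hf ((dom_add_lattice m n).mpr hmem)) (by fun_prop)
  · intro t ht
    rw [polesBoundedBy_iff hf] at hN
    obtain ⟨C, δ, hδ, h⟩ := hN ⟨t, (half_pos hτ).trans_le (him t ht)⟩ m n
    refine ⟨C, δ, hδ, fun w hw hwδ => ?_⟩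
    simpa using h w hw hwδ

/-- The pole `m + n τ` moves with `τ`. Differentiation along it, in the direction `(1, n)`, does not
raise the pole order; the difference from the direction `(1, 0)` is `n ∂/∂z`, which raises it by
one. -/
lemma polesBoundedBy_dTau {f : dom → ℂ} (hf : DifferentiableOn ℂ (ext f) dom) {N : ℕ}
    (hN : PolesBoundedBy f N) : PolesBoundedBy (dTau f) (N + 1) := by
  have hZ := polesBoundedBy_dZ hf hN
  rw [polesBoundedBy_iff (differentiableOn_ext_dZ hf)] at hZ
  rw [polesBoundedBy_iff (differentiableOn_ext_dTau hf)]
  intro τ m n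
  have hτ : 0 < (τ : ℂ).im := τ.2
  have hr : 0 < min 1 ((τ : ℂ).im / 2) := lt_min one_pos (half_pos hτ)
  obtain ⟨h1, h2⟩ := shifted_family hf hN τ m n
  have h3 := poleBound_fderiv_fst
    (G := fun p : ℂ × ℂ => p.2 ^ N * ext f (p.1, (m : ℂ) + n * p.1 + p.2)) (half_pos hτ) hr
    (fun t ht w hw hw0 => (h1 t ht w hw hw0).2) h2
  have h4 : PoleBound (fun z => fderiv ℂ (ext f) (τ, z) (1, (n : ℂ)))
      ((m : ℂ) + (n : ℂ) * (τ : ℂ)) N := by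
    obtain ⟨C, δ, hδ, h⟩ := h3
    refine ⟨C, min δ (min 1 ((τ : ℂ).im / 2)), lt_min hδ hr, fun w hw hwδ => ?_⟩
    have hw' : w ∈ ball (0 : ℂ) (min 1 ((τ : ℂ).im / 2)) := by
      simpa using hwδ.trans_le (min_le_right _ _)
    have h5 := h1 τ (mem_closedBall_self (half_pos hτ).le) w hw' hw
    have h6 := h w hw (hwδ.trans_le (min_le_left _ _))
    simp only [pow_zero, one_mul, zero_add] at h6
    rw [(hasDerivAt_fst h5.2).unique ((hasDerivAt_shift hf h5.1 m n).const_mul (w ^ N))] at h6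
    exact h6
  refine ((h4.mono N.le_succ).linearComb (hZ τ m n) (Real.pi / (2 * I))
    (-(Real.pi / (2 * I) * n))).congr ?_
  filter_upwards [eventually_mem_dom τ _] with z hz
  have h5 : ((1, (n : ℂ)) : ℂ × ℂ) = (1, 0) + (n : ℂ) • (0, 1) := by simp
  rw [ext_dTau hf hz, ext_dZ hf hz, h5, map_add, map_smul, smul_eq_mul]
  ring

open Derivative in
/-- The derivative of a function holomorphic at infinity is holomorphic at infinity. -/
lemma IsHoloAtInfty.normalizedDeriv {a : ℍ → ℂ} (ha : IsHoloAtInfty a) :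
    IsHoloAtInfty (normalizedDerivOfComplex a) := by
  obtain ⟨hd, c, hc⟩ := ha
  refine ⟨normalizedDerivOfComplex_mdifferentiable hd, fun r => r * c r, fun τ => ?_⟩
  have hτ : 0 < (τ : ℂ).im := τ.2
  -- The series at half the height of `τ` converges absolutely and dominates the series at every
  -- point above that height, a neighbourhood of `τ`.
  set y : ℍ := ⟨((τ : ℂ).im / 2 : ℝ) * I, by simpa using hτ⟩ with hy
  have hU : IsOpen {t : ℂ | (τ : ℂ).im / 2 < t.im} := isOpen_lt continuous_const continuous_im
  have hF (r : ℕ) (t : ℂ) : HasDerivAt (fun t : ℂ => c r * cexp (2 * Real.pi * I * r * t))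
      (2 * Real.pi * I * (r * c r * cexp (2 * Real.pi * I * r * t))) t := by
    have h1 := (((hasDerivAt_id t).const_mul (2 * Real.pi * I * r)).cexp).const_mul (c r)
    refine h1.congr_deriv ?_
    simp only [id_eq]
    ring
  have hnorm (r : ℕ) (t : ℂ) : ‖cexp (2 * Real.pi * I * r * t)‖ =
      Real.exp (-(2 * Real.pi * r * t.im)) := by
    rw [norm_exp]
    congr 1
    have : (2 * Real.pi * I * r * t : ℂ) = ((2 * Real.pi * r : ℝ) : ℂ) * (I * t) := by
      push_cast
      ring
    rw [this, re_ofReal_mul]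
    simp
  have h1 := hasSum_deriv_of_summable_norm (hc y).summable.norm
    (fun r t _ => (hF r t).differentiableAt.differentiableWithinAt) hU (fun r t ht => by
      rw [norm_mul, norm_mul, hnorm, hnorm]
      have h2 : (τ : ℂ).im / 2 = (y : ℂ).im := by simp [hy]
      have h3 : (y : ℂ).im ≤ t.im := by
        rw [← h2]
        exact le_of_lt ht
      gcongr) (z := τ) (by simpa using hτ)
  have h2 : deriv (fun t : ℂ => ∑' r : ℕ, c r * cexp (2 * Real.pi * I * r * t)) τ =
      deriv (a ∘ ofComplex) τ := by
    refine Filter.EventuallyEq.deriv_eq ?_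
    filter_upwards [isOpen_upperHalfPlaneSet.mem_nhds τ.2] with t ht
    rw [Function.comp_apply, ofComplex_apply_of_im_pos ht]
    exact (hc ⟨t, ht⟩).tsum_eq
  simp only [(hF _ _).deriv] at h1
  rw [h2] at h1
  have h3 := h1.mul_left ((2 * Real.pi * I : ℂ)⁻¹)
  simp only [inv_mul_cancel_left₀ two_pi_I_ne_zero] at h3
  exact h3

lemma IsHoloAtInfty.const_mul {a : ℍ → ℂ} (ha : IsHoloAtInfty a) (c : ℂ) :
    IsHoloAtInfty (fun τ => c * a τ) :=
  (isHoloAtInfty_const c).mul ha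

/-- `∂_τ = π² D`. -/
lemma pi_div_two_I : (Real.pi / (2 * I) : ℂ) = (Real.pi : ℂ) ^ 2 * (2 * Real.pi * I)⁻¹ := by
  have h1 : (Real.pi : ℂ) ≠ 0 := by exact_mod_cast Real.pi_ne_zero
  field_simp

open Derivative in
-- The pole `z = 0` does not move, so the coefficients are differentiated one by one and the order
-- stays `N`. The bound on poles supplies the uniformity in `τ`.
lemma hasLaurent_dTau {f : dom → ℂ} (hf : DifferentiableOn ℂ (ext f) dom) {N : ℕ}
    (hN : PolesBoundedBy f N) (hL : HasLaurent f N) : HasLaurent (dTau f) N := by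
  rw [hasLaurent_iff] at hL ⊢
  obtain ⟨A, hA, hs⟩ := hL
  refine ⟨fun n τ => (Real.pi : ℂ) ^ 2 * normalizedDerivOfComplex (A n) τ,
    fun n => (hA n).normalizedDeriv.const_mul _, fun τ => ?_⟩
  have hτ : 0 < (τ : ℂ).im := τ.2
  have hr : 0 < min 1 ((τ : ℂ).im / 2) := lt_min one_pos (half_pos hτ)
  obtain ⟨h1, h2⟩ := shifted_family hf hN τ 0 0
  have hpos : ∀ t ∈ closedBall (τ : ℂ) ((τ : ℂ).im / 2), 0 < t.im := by
    intro t ht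
    rw [mem_closedBall, dist_eq_norm] at ht
    have h1 := (abs_le.mp ((Complex.abs_im_le_norm (t - τ)).trans ht)).1
    rw [sub_im] at h1
    linarith
  have h3 := hasSum_fderiv_fst
    (G := fun p : ℂ × ℂ => p.2 ^ N * ext f (p.1, ((0 : ℤ) : ℂ) + ((0 : ℤ) : ℂ) * p.1 + p.2))
    (A := fun n => A n ∘ ofComplex) (half_pos hτ) hr
    (fun t ht w hw hw0 => (h1 t ht w hw hw0).2) h2
    (fun n => (UpperHalfPlane.mdifferentiable_iff.mp (hA n).1).mono
      fun t ht => hpos t (ball_subset_closedBall ht))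
    (fun t ht => by
      filter_upwards [hs ⟨t, hpos t ht⟩] with w hw
      simpa [ofComplex_apply_of_im_pos (hpos t ht)] using hw)
  rw [eventually_nhdsWithin_iff] at h3 ⊢
  filter_upwards [h3, ball_mem_nhds (0 : ℂ) hr] with w hw hwr hw0
  have h5 := h1 τ (mem_closedBall_self (half_pos hτ).le) w hwr hw0
  have h6 := hw hw0
  rw [(hasDerivAt_fst h5.2).unique ((hasDerivAt_shift hf h5.1 0 0).const_mul (w ^ N))] at h6
  have h7 := h6.mul_left ((Real.pi : ℂ) / (2 * I))
  rw [ext_dTau hf h5.1]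
  simp only [Int.cast_zero, zero_mul, zero_add] at h7
  rw [mul_left_comm]
  have h8 (n : ℕ) : (Real.pi : ℂ) ^ 2 * normalizedDerivOfComplex (A n) τ * w ^ n =
      Real.pi / (2 * I) * (deriv (A n ∘ ofComplex) τ * w ^ n) := by
    rw [normalizedDerivOfComplex, pi_div_two_I]
    ring
  simpa only [h8] using h7

/-- Termwise differentiation applies to the power series of `z^N f`, and `z^(N+1) ∂f/∂z = z ∂(z^N
f)/∂z - N z^N f` multiplies each coefficient by its exponent `n - N`. -/
lemma hasLaurent_dZ {f : dom → ℂ} (hf : DifferentiableOn ℂ (ext f) dom) {N : ℕ}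
    (hL : HasLaurent f N) : HasLaurent (dZ f) (N + 1) := by
  rw [hasLaurent_iff] at hL ⊢
  obtain ⟨A, hA, hs⟩ := hL
  refine ⟨fun n τ => ((n : ℂ) - N) * A n τ, fun n => (hA n).const_mul _, fun τ => ?_⟩
  have h1 := (hs τ).and (eventually_mem_dom τ 0)
  rw [eventually_nhdsWithin_iff, Metric.eventually_nhds_iff_ball] at h1
  obtain ⟨δ, hδ, h1⟩ := h1
  have hδ2 : ((δ / 2 : ℝ) : ℂ) ∈ ball (0 : ℂ) δ := by
    rw [mem_ball_zero_iff, norm_real, Real.norm_of_nonneg (half_pos hδ).le]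
    exact half_lt_self hδ
  have h2 := (h1 _ hδ2 (by simpa using hδ.ne')).1.summable.norm
  rw [eventually_nhdsWithin_iff]
  filter_upwards [ball_mem_nhds (0 : ℂ) (half_pos hδ)] with z hz hz0
  have hzδ : z ∈ ball (0 : ℂ) δ := ball_subset_ball (half_le_self hδ.le) hz
  have hF (n : ℕ) (w : ℂ) :
      HasDerivAt (fun w : ℂ => A n τ * w ^ n) (A n τ * (n * w ^ (n - 1))) w :=
    (hasDerivAt_pow n w).const_mul _
  have h3 := hasSum_deriv_of_summable_norm h2
    (fun n w _ => (hF n w).differentiableAt.differentiableWithinAt)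
    (isOpen_ball (x := (0 : ℂ)) (ε := δ / 2)) (fun n w hw => by
      rw [mem_ball_zero_iff] at hw
      rw [norm_mul, norm_mul, norm_pow, norm_pow, norm_real,
        Real.norm_of_nonneg (half_pos hδ).le]
      gcongr) hz
  have hd := hasDerivAt_snd (differentiableAt_ext hf (h1 z hzδ hz0).2)
  have h4 : deriv (fun w : ℂ => ∑' n, A n τ * w ^ n) z =
      N * z ^ (N - 1) * ext f (τ, z) + z ^ N * fderiv ℂ (ext f) (τ, z) (0, 1) := by
    rw [← ((hasDerivAt_pow N z).mul hd).deriv]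
    refine Filter.EventuallyEq.deriv_eq ?_
    filter_upwards [isOpen_ball.mem_nhds hzδ, isOpen_compl_singleton.mem_nhds hz0] with w hw hw0
    exact (h1 w hw hw0).1.tsum_eq
  rw [h4] at h3
  simp only [(hF _ _).deriv] at h3
  have h5 := (h3.mul_left z).sub ((h1 z hzδ hz0).1.mul_left (N : ℂ))
  rw [ext_dZ hf (h1 z hzδ hz0).2]
  have h6 (n : ℕ) : ((n : ℂ) - N) * A n τ * z ^ n =
      z * (A n τ * (n * z ^ (n - 1))) - N * (A n τ * z ^ n) := by
    rcases n with _ | n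
    · simp
    · rw [Nat.add_sub_cancel, pow_succ]
      ring
  have h7 : z ^ (N + 1) * fderiv ℂ (ext f) (τ, z) (0, 1) =
      z * (N * z ^ (N - 1) * ext f (τ, z) + z ^ N * fderiv ℂ (ext f) (τ, z) (0, 1)) -
        N * (z ^ N * ext f (τ, z)) := by
    rcases N with _ | N
    · simp
    · rw [Nat.add_sub_cancel, pow_succ, pow_succ]
      ring
  rw [h7]
  simpa only [h6] using h5

lemma exists_common_bound {f : dom → ℂ} (hf : IsSingular f) :
    ∃ N, PolesBoundedBy f N ∧ HasLaurent f N := by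
  obtain ⟨N, hN⟩ := hf.poles
  obtain ⟨M, hM⟩ := hf.laurent
  exact ⟨N + M, hN.mono (N.le_add_right M), hM.mono N⟩

/-- `∂_τ` preserves singular functions. -/
theorem IsSingular.dTau {f : dom → ℂ} (hf : IsSingular f) : IsSingular (dTau f) := by
  obtain ⟨N, hN, hL⟩ := exists_common_bound hf
  refine ⟨differentiableOn_ext_dTau hf.holo, fun τ z => ?_, fun τ z => ?_,
    ⟨_, polesBoundedBy_dTau hf.holo hN⟩, ⟨_, hasLaurent_dTau hf.holo hN hL⟩⟩
  · by_cases h : (τ, z) ∈ dom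
    · rw [ext_of_mem _ h, ext_of_mem _ (dom_add_one_right.mpr h), QuasiJacobi.dTau,
        QuasiJacobi.dTau]
      simp only [hf.periodic_z]
    · rw [ext, ext, dif_neg h, dif_neg (mt dom_add_one_right.mp h)]
  · by_cases h : (τ, z) ∈ dom
    · rw [ext_of_mem _ h, ext_of_mem _ (dom_add_one_left.mpr h), QuasiJacobi.dTau,
        QuasiJacobi.dTau, ← deriv_comp_add_const]
      simp only [hf.periodic_tau]
    · rw [ext, ext, dif_neg h, dif_neg (mt dom_add_one_left.mp h)]

/-- `∂/∂z` preserves singular functions. -/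
theorem IsSingular.dZ {f : dom → ℂ} (hf : IsSingular f) : IsSingular (dZ f) := by
  obtain ⟨N, hN, hL⟩ := exists_common_bound hf
  refine ⟨differentiableOn_ext_dZ hf.holo, fun τ z => ?_, fun τ z => ?_,
    ⟨_, polesBoundedBy_dZ hf.holo hN⟩, ⟨_, hasLaurent_dZ hf.holo hL⟩⟩
  · by_cases h : (τ, z) ∈ dom
    · rw [ext_of_mem _ h, ext_of_mem _ (dom_add_one_right.mpr h), QuasiJacobi.dZ,
        QuasiJacobi.dZ, ← deriv_comp_add_const]
      simp only [hf.periodic_z]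
    · rw [ext, ext, dif_neg h, dif_neg (mt dom_add_one_right.mp h)]
  · by_cases h : (τ, z) ∈ dom
    · rw [ext_of_mem _ h, ext_of_mem _ (dom_add_one_left.mpr h), QuasiJacobi.dZ,
        QuasiJacobi.dZ]
      simp only [hf.periodic_tau]
    · rw [ext, ext, dif_neg h, dif_neg (mt dom_add_one_left.mp h)]

end SingularDerivatives

/-! ### The transformation of derivatives of quasi-Jacobi forms -/

section Transformation

/-- Holomorphic functions on `dom`. -/
def IsHol (f : dom → ℂ) : Prop := DifferentiableOn ℂ (ext f) dom

lemma IsHol.add {f g : dom → ℂ} (hf : IsHol f) (hg : IsHol g) : IsHol (f + g) :=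
  (DifferentiableOn.add hf hg).congr fun p _ => ext_add f g p

lemma IsHol.mul {f g : dom → ℂ} (hf : IsHol f) (hg : IsHol g) : IsHol (f * g) :=
  (DifferentiableOn.mul hf hg).congr fun p _ => ext_mul f g p

lemma IsHol.hasDerivAt_fst {f : dom → ℂ} (hf : IsHol f) (p : dom) :
    HasDerivAt (fun t => ext f (t, p.1.2)) (fderiv ℂ (ext f) p.1 (1, 0)) p.1.1 :=
  QuasiJacobi.hasDerivAt_fst (differentiableAt_ext hf p.2)

lemma IsHol.hasDerivAt_snd {f : dom → ℂ} (hf : IsHol f) (p : dom) :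
    HasDerivAt (fun w => ext f (p.1.1, w)) (fderiv ℂ (ext f) p.1 (0, 1)) p.1.2 :=
  QuasiJacobi.hasDerivAt_snd (differentiableAt_ext hf p.2)

lemma ext_coe (f : dom → ℂ) (p : dom) : ext f p.1 = f p := ext_of_mem f p.2

lemma eventually_fst_mem_dom (p : dom) : ∀ᶠ t in 𝓝 p.1.1, (t, p.1.2) ∈ dom := by
  have h1 : ContinuousAt (fun t : ℂ => (t, p.1.2)) p.1.1 := by fun_prop
  exact h1.eventually_mem (isOpen_dom.mem_nhds p.2)

lemma eventually_snd_mem_dom (p : dom) : ∀ᶠ w in 𝓝 p.1.2, (p.1.1, w) ∈ dom := by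
  have h1 : ContinuousAt (fun w : ℂ => (p.1.1, w)) p.1.2 := by fun_prop
  exact h1.eventually_mem (isOpen_dom.mem_nhds p.2)

lemma dTau_add {f g : dom → ℂ} (hf : IsHol f) (hg : IsHol g) :
    dTau (f + g) = dTau f + dTau g := by
  funext p
  simp only [dTau, Pi.add_apply, ext_add]
  rw [deriv_fun_add (hf.hasDerivAt_fst p).differentiableAt (hg.hasDerivAt_fst p).differentiableAt,
    mul_add]

lemma dTau_mul {f g : dom → ℂ} (hf : IsHol f) (hg : IsHol g) :
    dTau (f * g) = dTau f * g + f * dTau g := by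
  funext p
  simp only [dTau, Pi.add_apply, Pi.mul_apply, ext_mul]
  rw [deriv_fun_mul (hf.hasDerivAt_fst p).differentiableAt (hg.hasDerivAt_fst p).differentiableAt]
  have h (f : dom → ℂ) : ext f (p.1.1, p.1.2) = f p := ext_coe f p
  rw [h, h]
  ring

lemma dZ_add {f g : dom → ℂ} (hf : IsHol f) (hg : IsHol g) : dZ (f + g) = dZ f + dZ g := by
  funext p
  simp only [dZ, Pi.add_apply, ext_add]
  rw [deriv_fun_add (hf.hasDerivAt_snd p).differentiableAt (hg.hasDerivAt_snd p).differentiableAt]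

lemma dZ_mul {f g : dom → ℂ} (hf : IsHol f) (hg : IsHol g) :
    dZ (f * g) = dZ f * g + f * dZ g := by
  funext p
  simp only [dZ, Pi.add_apply, Pi.mul_apply, ext_mul]
  rw [deriv_fun_mul (hf.hasDerivAt_snd p).differentiableAt (hg.hasDerivAt_snd p).differentiableAt]
  have h (f : dom → ℂ) : ext f (p.1.1, p.1.2) = f p := ext_coe f p
  rw [h, h]

lemma det_eq_one (A : JacobiGroup) :
    (A.1 0 0 : ℂ) * A.1 1 1 - A.1 0 1 * A.1 1 0 = 1 := by
  have h := A.1.det_coe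
  rw [Matrix.det_fin_two] at h
  exact_mod_cast h

lemma cocycle_ne_zero (A : JacobiGroup) {τ : ℂ} (hτ : 0 < τ.im) :
    (A.1 1 0 : ℂ) * τ + A.1 1 1 ≠ 0 := by
  intro h
  have h1 : (A.1 1 0 : ℝ) * τ.im = 0 := by simpa using congrArg Complex.im h
  have hc : A.1 1 0 = 0 := by
    rcases mul_eq_zero.mp h1 with h2 | h2
    · exact_mod_cast h2
    · exact absurd h2 hτ.ne'
  have hd : (A.1 1 1 : ℂ) = 0 := by simpa [hc] using h
  have hdet := det_eq_one A
  rw [hd, hc] at hdet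
  simp at hdet

lemma autJ_ne_zero (A : JacobiGroup) (p : dom) : autJ A p ≠ 0 := cocycle_ne_zero A p.2.1

variable (A : JacobiGroup) (p : dom)

lemma hasDerivAt_cocycle (τ : ℂ) :
    HasDerivAt (fun t : ℂ => (A.1 1 0 : ℂ) * t + A.1 1 1) (A.1 1 0 : ℂ) τ := by
  simpa using ((hasDerivAt_id τ).const_mul (A.1 1 0 : ℂ)).add_const (A.1 1 1 : ℂ)

lemma isHol_autX : IsHol (autX A) := by
  have h : DifferentiableOn ℂ (fun p : ℂ × ℂ => (A.1 1 0 : ℂ) / ((A.1 1 0 : ℂ) * p.1 + A.1 1 1))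
      dom := fun p hp => by
    have := cocycle_ne_zero A hp.1
    refine DifferentiableAt.differentiableWithinAt ?_
    fun_prop (disch := assumption)
  exact h.congr fun p hp => ext_of_mem _ hp

lemma isHol_autY : IsHol (autY A) := by
  have h : DifferentiableOn ℂ (fun p : ℂ × ℂ => ((A.1 1 0 : ℂ) * p.2 + (A.1 1 0 : ℂ) * (A.2.2 : ℂ) -
      (A.1 1 1 : ℂ) * (A.2.1 : ℂ)) / ((A.1 1 0 : ℂ) * p.1 + A.1 1 1)) dom := fun p hp => by
    have := cocycle_ne_zero A hp.1
    refine DifferentiableAt.differentiableWithinAt ?_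
    fun_prop (disch := assumption)
  exact h.congr fun p hp => ext_of_mem _ hp

lemma dTau_eq_of_hasDerivAt {f : dom → ℂ} {F : ℂ → ℂ} {c : ℂ} (hF : HasDerivAt F c p.1.1)
    (h : ∀ t, ∀ ht : (t, p.1.2) ∈ dom, f ⟨(t, p.1.2), ht⟩ = F t) :
    dTau f p = (Real.pi / (2 * I)) * c := by
  rw [dTau, ← hF.deriv]
  congr 1
  refine Filter.EventuallyEq.deriv_eq ?_
  filter_upwards [eventually_fst_mem_dom p] with t ht
  rw [ext_of_mem _ ht, h]

lemma dZ_eq_of_hasDerivAt {f : dom → ℂ} {F : ℂ → ℂ} {c : ℂ} (hF : HasDerivAt F c p.1.2)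
    (h : ∀ w, ∀ hw : (p.1.1, w) ∈ dom, f ⟨(p.1.1, w), hw⟩ = F w) : dZ f p = c := by
  rw [dZ, ← hF.deriv]
  refine Filter.EventuallyEq.deriv_eq ?_
  filter_upwards [eventually_snd_mem_dom p] with t ht
  rw [ext_of_mem _ ht, h]

lemma dTau_autX : dTau (autX A) p = -(Real.pi / (2 * I)) * autX A p ^ 2 := by
  have hJ := cocycle_ne_zero A p.2.1
  rw [dTau_eq_of_hasDerivAt p
    ((hasDerivAt_const _ (A.1 1 0 : ℂ)).div (hasDerivAt_cocycle A p.1.1) hJ) fun _ _ => rfl]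
  simp only [autX, autJ]
  field_simp
  ring

lemma dTau_autY : dTau (autY A) p = -(Real.pi / (2 * I)) * (autX A p * autY A p) := by
  have hJ := cocycle_ne_zero A p.2.1
  rw [dTau_eq_of_hasDerivAt p ((hasDerivAt_const _ ((A.1 1 0 : ℂ) * p.1.2 +
    (A.1 1 0 : ℂ) * (A.2.2 : ℂ) - (A.1 1 1 : ℂ) * (A.2.1 : ℂ))).div
      (hasDerivAt_cocycle A p.1.1) hJ) fun _ _ => rfl]
  simp only [autX, autY, autJ]
  field_simp
  ring

lemma dZ_autX : dZ (autX A) p = 0 :=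
  dZ_eq_of_hasDerivAt p (hasDerivAt_const _ (autX A p)) fun _ _ => rfl

lemma dZ_autY : dZ (autY A) p = autX A p := by
  have h1 : HasDerivAt (fun w : ℂ => ((A.1 1 0 : ℂ) * w + (A.1 1 0 : ℂ) * (A.2.2 : ℂ) -
      (A.1 1 1 : ℂ) * (A.2.1 : ℂ)) / autJ A p) ((A.1 1 0 : ℂ) / autJ A p) p.1.2 := by
    simpa using ((((hasDerivAt_id p.1.2).const_mul (A.1 1 0 : ℂ)).add_const
      ((A.1 1 0 : ℂ) * (A.2.2 : ℂ))).sub_const ((A.1 1 1 : ℂ) * (A.2.1 : ℂ))).div_const (autJ A p)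
  exact dZ_eq_of_hasDerivAt p h1 fun _ _ => rfl

variable {A p}

lemma dZ_slash {f : dom → ℂ} (hf : IsHol f) (k : ℕ) :
    dZ (slash k f A) = slash (k + 1) (dZ f) A := by
  funext p
  have hJ : autJ A p ≠ 0 := autJ_ne_zero A p
  have h0 : HasDerivAt (fun w : ℂ => (((A.1 0 0 : ℂ) * p.1.1 + (A.1 0 1 : ℂ)) / autJ A p,
      (w + (A.2.1 : ℂ) * p.1.1 + (A.2.2 : ℂ)) / autJ A p)) ((0, 1 / autJ A p) : ℂ × ℂ) p.1.2 := by
    refine (hasDerivAt_const _ _).prodMk ?_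
    exact (((hasDerivAt_id p.1.2).add_const _).add_const _).div_const _
  have h1 := HasFDerivAt.comp_hasDerivAt (l := ext f) p.1.2
    (differentiableAt_ext hf (actPoint_mem A p)).hasFDerivAt h0
  have h2 : ((0, 1 / autJ A p) : ℂ × ℂ) = (1 / autJ A p) • (0, 1) := by simp
  rw [dZ_eq_of_hasDerivAt p (h1.const_mul (autJ A p ^ k)⁻¹) fun w hw => ?_]
  · rw [h2, map_smul, ← ext_dZ hf (actPoint_mem A p), slash,
      ext_of_mem _ (actPoint_mem A p), smul_eq_mul]
    field_simp
    ring
  · rw [slash, ← ext_of_mem f]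
    rfl

/-- By the chain rule and `det = 1`, the `τ`-derivative of `A · (τ, z)` is `(J⁻², -Y / J)`, and that
of `J^(-k)` is `-k X J^(-k)`. Solving for the term with `∂_τ f` gives the two corrections. -/
lemma dTau_slash {f : dom → ℂ} (hf : IsHol f) (k : ℕ) :
    slash (k + 2) (dTau f) A = dTau (slash k f A) +
      ((Real.pi / (2 * I) : ℂ)) • ((k : ℂ) • (autX A * slash k f A) +
        autY A * dZ (slash k f A)) := by
  rw [dZ_slash hf]
  funext p
  have hJ : autJ A p ≠ 0 := autJ_ne_zero A p
  have hJ' := hasDerivAt_cocycle A p.1.1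
  have hdet := det_eq_one A
  have h0 : HasDerivAt (fun t : ℂ => (((A.1 0 0 : ℂ) * t + (A.1 0 1 : ℂ)) /
      ((A.1 1 0 : ℂ) * t + A.1 1 1), (p.1.2 + (A.2.1 : ℂ) * t + (A.2.2 : ℂ)) /
      ((A.1 1 0 : ℂ) * t + A.1 1 1))) ((1 / autJ A p ^ 2, -autY A p / autJ A p) : ℂ × ℂ)
      p.1.1 := by
    refine HasDerivAt.prodMk ?_ ?_
    · refine ((((hasDerivAt_id p.1.1).const_mul (A.1 0 0 : ℂ)).add_const (A.1 0 1 : ℂ)).div hJ'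
        hJ).congr_deriv ?_
      simp only [autJ, id_eq]
      congr 1
      linear_combination hdet
    · refine (((((hasDerivAt_id p.1.1).const_mul (A.2.1 : ℂ)).const_add p.1.2).add_const
        (A.2.2 : ℂ)).div hJ' hJ).congr_deriv ?_
      rw [autY, neg_div, div_div, ← pow_two, ← neg_div]
      simp only [autJ, id_eq]
      congr 1
      ring
  have h1 := HasFDerivAt.comp_hasDerivAt (l := ext f) p.1.1
    (differentiableAt_ext hf (actPoint_mem A p)).hasFDerivAt h0
  have h2 : ((1 / autJ A p ^ 2, -autY A p / autJ A p) : ℂ × ℂ) =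
      (1 / autJ A p ^ 2) • (1, 0) + (-autY A p / autJ A p) • (0, 1) := by simp
  have h3 := ((hJ'.pow k).inv (pow_ne_zero k hJ)).mul h1
  simp only [Pi.add_apply, Pi.smul_apply, Pi.mul_apply, smul_eq_mul]
  rw [dTau_eq_of_hasDerivAt p h3 fun t ht => ?_]
  · have h4 := ext_dTau hf (actPoint_mem A p)
    have h5 := ext_dZ hf (actPoint_mem A p)
    rw [ext_of_mem _ (actPoint_mem A p)] at h4 h5
    simp only [slash, h4, h5, h2, map_add, map_smul, smul_eq_mul, Function.comp_apply]
    have h6 : (A.1 1 0 : ℂ) = autX A p * autJ A p := by rw [autX, div_mul_cancel₀ _ hJ]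
    have h7 : ext f (((A.1 0 0 : ℂ) * p.1.1 + (A.1 0 1 : ℂ)) / ((A.1 1 0 : ℂ) * p.1.1 + A.1 1 1),
        (p.1.2 + (A.2.1 : ℂ) * p.1.1 + (A.2.2 : ℂ)) / ((A.1 1 0 : ℂ) * p.1.1 + A.1 1 1)) =
        f ⟨actPoint A p, actPoint_mem A p⟩ := ext_of_mem f (actPoint_mem A p)
    have h8 : (A.1 1 0 : ℂ) * p.1.1 + A.1 1 1 = autJ A p := rfl
    rw [h7, Pi.inv_apply, Pi.pow_apply, h8, h6]
    generalize autJ A p = J at hJ ⊢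
    generalize autX A p = X
    generalize autY A p = Y
    generalize f ⟨actPoint A p, actPoint_mem A p⟩ = F
    generalize fderiv ℂ (ext f) (actPoint A p) (1, 0) = E₁
    generalize fderiv ℂ (ext f) (actPoint A p) (0, 1) = E₂
    rcases k with _ | k
    · simp
      field_simp
      ring
    · rw [Nat.add_sub_cancel]
      push_cast
      field_simp
      ring
  · rw [slash, ← ext_of_mem f]
    rfl

lemma IsHol.aeval (A : JacobiGroup) (P : MvPolynomial (Fin 2) singular) :
    IsHol (MvPolynomial.aeval ![autX A, autY A] P) := by
  induction P using MvPolynomial.induction_on with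
  | C a => rw [MvPolynomial.aeval_C]; exact a.2.holo
  | add P Q hP hQ => rw [map_add]; exact hP.add hQ
  | mul_X P i hP =>
    rw [map_mul, MvPolynomial.aeval_X]
    refine hP.mul ?_
    fin_cases i
    · exact isHol_autX A
    · exact isHol_autY A

/-- A derivation that preserves singular functions, and maps `X` and `Y` to polynomials in `X` and
`Y`, preserves polynomials in `X` and `Y` with singular coefficients. -/
lemma exists_aeval_eq_derivation {δ : (dom → ℂ) → dom → ℂ}
    (hadd : ∀ {f g}, IsHol f → IsHol g → δ (f + g) = δ f + δ g)
    (hmul : ∀ {f g}, IsHol f → IsHol g → δ (f * g) = δ f * g + f * δ g)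
    (hs : ∀ {f}, IsSingular f → IsSingular (δ f)) (q : Fin 2 → MvPolynomial (Fin 2) singular)
    (hX : ∀ A, δ (autX A) = MvPolynomial.aeval ![autX A, autY A] (q 0))
    (hY : ∀ A, δ (autY A) = MvPolynomial.aeval ![autX A, autY A] (q 1))
    (P : MvPolynomial (Fin 2) singular) : ∃ Q : MvPolynomial (Fin 2) singular,
      ∀ A : JacobiGroup, δ (MvPolynomial.aeval ![autX A, autY A] P) =
        MvPolynomial.aeval ![autX A, autY A] Q := by
  induction P using MvPolynomial.induction_on with
  | C a =>
    refine ⟨MvPolynomial.C ⟨δ a, hs a.2⟩, fun A => ?_⟩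
    rw [MvPolynomial.aeval_C, MvPolynomial.aeval_C]
    rfl
  | add P Q hP hQ =>
    obtain ⟨P', hP⟩ := hP
    obtain ⟨Q', hQ⟩ := hQ
    refine ⟨P' + Q', fun A => ?_⟩
    rw [map_add, hadd (IsHol.aeval A P) (IsHol.aeval A Q), hP, hQ, map_add]
  | mul_X P i hP =>
    obtain ⟨P', hP⟩ := hP
    refine ⟨P' * MvPolynomial.X i + P * q i, fun A => ?_⟩
    rw [map_mul, MvPolynomial.aeval_X, map_add, map_mul, map_mul, MvPolynomial.aeval_X, ← hP]
    fin_cases i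
    · exact (hmul (IsHol.aeval A P) (isHol_autX A)).trans (by rw [hX]; rfl)
    · exact (hmul (IsHol.aeval A P) (isHol_autY A)).trans (by rw [hY]; rfl)

/-- `∂_τ` maps forms of weight `k` to forms of weight `k + 2`. -/
theorem dTau_mem_quasiJacobi {k : ℕ} {f : dom → ℂ} (hf : f ∈ quasiJacobi k) :
    dTau f ∈ quasiJacobi (k + 2) := by
  obtain ⟨hf, P, hP⟩ := hf
  set c : singular := algebraMap ℂ singular (Real.pi / (2 * I)) with hc
  have hc' : algebraMap singular (dom → ℂ) c = algebraMap ℂ (dom → ℂ) (Real.pi / (2 * I)) := rfl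
  obtain ⟨Q₁, hQ₁⟩ := exists_aeval_eq_derivation dTau_add dTau_mul IsSingular.dTau
    ![MvPolynomial.C (-c) * MvPolynomial.X 0 ^ 2,
      MvPolynomial.C (-c) * (MvPolynomial.X 0 * MvPolynomial.X 1)]
    (fun A => by
      funext p
      rw [dTau_autX]
      simp [hc'])
    (fun A => by
      funext p
      rw [dTau_autY]
      simp [hc']) P
  obtain ⟨Q₂, hQ₂⟩ := exists_aeval_eq_derivation dZ_add dZ_mul IsSingular.dZ
    ![0, MvPolynomial.X 0]
    (fun A => by
      funext p
      rw [dZ_autX]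
      simp)
    (fun A => by
      funext p
      rw [dZ_autY]
      simp) P
  refine ⟨hf.dTau, Q₁ + MvPolynomial.C c * ((k : MvPolynomial (Fin 2) singular) *
    (MvPolynomial.X 0 * P) + MvPolynomial.X 1 * Q₂), fun A => ?_⟩
  rw [dTau_slash hf.holo, hP, hQ₁, hQ₂]
  simp only [map_add, map_mul, map_natCast, MvPolynomial.aeval_X, MvPolynomial.aeval_C, hc']
  funext p
  simp
  ring

end Transformation

/-! ### Formal deformations from associative families of brackets -/

section Deformation

variable {A : Type*} [CommRing A] [Algebra ℂ A]

lemma coeff_starProduct (μ : ℕ → A →ₗ[ℂ] A →ₗ[ℂ] A) (F G : PowerSeries A) (m : ℕ) :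
    PowerSeries.coeff m (starProduct μ F G) =
      ∑ p ∈ Finset.HasAntidiagonal.antidiagonal m, ∑ q ∈ Finset.HasAntidiagonal.antidiagonal p.2,
        μ p.1 (PowerSeries.coeff q.1 F) (PowerSeries.coeff q.2 G) :=
  PowerSeries.coeff_mk _ _

/-- Each side is a sum over an outer order `a`, an inner order `b` and three coefficient indices
`u`, `v`, `w`. Grouping by `a + b` with `u`, `v`, `w` fixed isolates the sums that `h` compares. -/
lemma starProduct_assoc {μ : ℕ → A →ₗ[ℂ] A →ₗ[ℂ] A}
    (h : ∀ n a b c, ∑ p ∈ Finset.HasAntidiagonal.antidiagonal n, μ p.2 (μ p.1 a b) c =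
      ∑ p ∈ Finset.HasAntidiagonal.antidiagonal n, μ p.2 a (μ p.1 b c)) (F G H : PowerSeries A) :
    starProduct μ (starProduct μ F G) H = starProduct μ F (starProduct μ G H) := by
  ext m
  have hl : PowerSeries.coeff m (starProduct μ (starProduct μ F G) H) =
      ∑ s ∈ Finset.HasAntidiagonal.antidiagonal m, ∑ q ∈ Finset.HasAntidiagonal.antidiagonal s.2,
        ∑ t ∈ Finset.HasAntidiagonal.antidiagonal q.2,
          ∑ p ∈ Finset.HasAntidiagonal.antidiagonal s.1, μ p.2 (μ p.1 (PowerSeries.coeff q.1 F)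
            (PowerSeries.coeff t.1 G)) (PowerSeries.coeff t.2 H) := by
    simp only [coeff_starProduct, map_sum, LinearMap.sum_apply, Finset.sum_sigma']
    refine Finset.sum_nbij'
      (fun ⟨⟨a, _⟩, ⟨_, w⟩, ⟨b, _⟩, u, v⟩ =>
        ⟨(a + b, u + v + w), (u, v + w), (v, w), (b, a)⟩)
      (fun ⟨_, ⟨u, _⟩, ⟨v, w⟩, b, a⟩ =>
        ⟨(a, b + u + v + w), (b + u + v, w), (b, u + v), (u, v)⟩) ?_ ?_ ?_ ?_ ?_
    · rintro ⟨⟨a, s⟩, ⟨i, w⟩, ⟨b, t⟩, u, v⟩ hx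
      simp only [Finset.mem_sigma, Finset.HasAntidiagonal.mem_antidiagonal] at hx ⊢
      refine ⟨?_, ?_, ?_, ?_⟩ <;> first | trivial | omega
    · rintro ⟨⟨a, s⟩, ⟨i, w⟩, ⟨b, t⟩, u, v⟩ hx
      simp only [Finset.mem_sigma, Finset.HasAntidiagonal.mem_antidiagonal] at hx ⊢
      refine ⟨?_, ?_, ?_, ?_⟩ <;> first | trivial | omega
    · rintro ⟨⟨a, s⟩, ⟨i, w⟩, ⟨b, t⟩, u, v⟩ hx
      simp only [Finset.mem_sigma, Finset.HasAntidiagonal.mem_antidiagonal] at hx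
      obtain ⟨h1, h2, h3, h4⟩ := hx
      subst h4 h3 h2
      simp only [add_assoc]
    · rintro ⟨⟨a, s⟩, ⟨i, w⟩, ⟨b, t⟩, u, v⟩ hx
      simp only [Finset.mem_sigma, Finset.HasAntidiagonal.mem_antidiagonal] at hx
      obtain ⟨h1, h2, h3, h4⟩ := hx
      subst h4 h3 h2
      simp only [add_comm, add_left_comm]
    · intro x _
      rfl
  have hr : PowerSeries.coeff m (starProduct μ F (starProduct μ G H)) =
      ∑ s ∈ Finset.HasAntidiagonal.antidiagonal m, ∑ q ∈ Finset.HasAntidiagonal.antidiagonal s.2,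
        ∑ t ∈ Finset.HasAntidiagonal.antidiagonal q.2,
          ∑ p ∈ Finset.HasAntidiagonal.antidiagonal s.1, μ p.2 (PowerSeries.coeff q.1 F)
            (μ p.1 (PowerSeries.coeff t.1 G) (PowerSeries.coeff t.2 H)) := by
    simp only [coeff_starProduct, map_sum, Finset.sum_sigma']
    refine Finset.sum_nbij'
      (fun ⟨⟨a, _⟩, ⟨u, _⟩, ⟨b, _⟩, v, w⟩ =>
        ⟨(a + b, u + v + w), (u, v + w), (v, w), (b, a)⟩)
      (fun ⟨_, ⟨u, _⟩, ⟨v, w⟩, b, a⟩ =>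
        ⟨(a, u + b + v + w), (u, b + v + w), (b, v + w), (v, w)⟩) ?_ ?_ ?_ ?_ ?_
    · rintro ⟨⟨a, s⟩, ⟨i, w⟩, ⟨b, t⟩, u, v⟩ hx
      simp only [Finset.mem_sigma, Finset.HasAntidiagonal.mem_antidiagonal] at hx ⊢
      refine ⟨?_, ?_, ?_, ?_⟩ <;> first | trivial | omega
    · rintro ⟨⟨a, s⟩, ⟨i, w⟩, ⟨b, t⟩, u, v⟩ hx
      simp only [Finset.mem_sigma, Finset.HasAntidiagonal.mem_antidiagonal] at hx ⊢
      refine ⟨?_, ?_, ?_, ?_⟩ <;> first | trivial | omega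
    · rintro ⟨⟨a, s⟩, ⟨i, w⟩, ⟨b, t⟩, u, v⟩ hx
      simp only [Finset.mem_sigma, Finset.HasAntidiagonal.mem_antidiagonal] at hx
      obtain ⟨h1, h2, h3, h4⟩ := hx
      subst h4 h3 h2
      simp only [add_assoc]
    · rintro ⟨⟨a, s⟩, ⟨i, w⟩, ⟨b, t⟩, u, v⟩ hx
      simp only [Finset.mem_sigma, Finset.HasAntidiagonal.mem_antidiagonal] at hx
      obtain ⟨h1, h2, h3, h4⟩ := hx
      subst h4 h3 h2
      simp only [add_comm, add_left_comm]
    · intro x _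
      rfl
  rw [hl, hr]
  exact Finset.sum_congr rfl fun s _ => Finset.sum_congr rfl fun q _ =>
    Finset.sum_congr rfl fun t _ => h _ _ _ _

/-- Brackets that are associative in the formal sense, start with the product and vanish on `1` in
positive degree form a formal deformation. -/
lemma IsFormalDeformation.of_brackets {μ : ℕ → A →ₗ[ℂ] A →ₗ[ℂ] A} (h0 : ∀ a b, μ 0 a b = a * b)
    (h : ∀ n a b c, ∑ p ∈ Finset.HasAntidiagonal.antidiagonal n, μ p.2 (μ p.1 a b) c =
      ∑ p ∈ Finset.HasAntidiagonal.antidiagonal n, μ p.2 a (μ p.1 b c))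
    (h1 : ∀ n a, μ (n + 1) 1 a = 0) (h2 : ∀ n a, μ (n + 1) a 1 = 0) :
    IsFormalDeformation μ where
  zero := h0
  assoc := starProduct_assoc h
  one_star F := by
    ext m
    rw [coeff_starProduct, Finset.sum_eq_single (0, m), Finset.sum_eq_single (0, m)]
    · simp [h0]
    · rintro ⟨i, j⟩ hq hne
      have hi : i ≠ 0 := by
        rintro rfl
        simp only [Finset.HasAntidiagonal.mem_antidiagonal] at hq
        exact hne (by simpa using hq)
      simp [PowerSeries.coeff_one, hi]
    · simp
    · rintro ⟨i, j⟩ hp hne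
      refine Finset.sum_eq_zero fun q _ => ?_
      rcases i with _ | i
      · simp only [Finset.HasAntidiagonal.mem_antidiagonal] at hp
        exact absurd (by simpa using hp) hne
      · rw [PowerSeries.coeff_one]
        split_ifs
        · exact h1 _ _
        · simp
    · simp
  star_one F := by
    ext m
    rw [coeff_starProduct, Finset.sum_eq_single (0, m), Finset.sum_eq_single (m, 0)]
    · simp [h0]
    · rintro ⟨i, j⟩ hq hne
      have hj : j ≠ 0 := by
        rintro rfl
        simp only [Finset.HasAntidiagonal.mem_antidiagonal] at hq
        exact hne (by simpa using hq)
      simp [PowerSeries.coeff_one, hj]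
    · simp
    · rintro ⟨i, j⟩ hp hne
      refine Finset.sum_eq_zero fun q _ => ?_
      rcases i with _ | i
      · simp only [Finset.HasAntidiagonal.mem_antidiagonal] at hp
        exact absurd (by simpa using hp) hne
      · rw [PowerSeries.coeff_one]
        split_ifs
        · exact h2 _ _
        · simp
    · simp

end Deformation

/-! ### The algebra of quasi-Jacobi forms is graded by the weight -/

lemma slash_one (k : ℕ) (f : dom → ℂ) : slash k f (1, (0, 0)) = f := by
  funext p
  have h1 : autJ (1, (0, 0)) p = 1 := by simp [autJ]
  have h2 : actPoint (1, (0, 0)) p = p.1 := by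
    ext <;> simp [actPoint, h1]
  simp [slash, h1, h2]

lemma tendsto_aeval {u v : ℕ → dom → ℂ} {a b : dom → ℂ} {p : dom}
    (hu : Tendsto (fun n => u n p) atTop (𝓝 (a p)))
    (hv : Tendsto (fun n => v n p) atTop (𝓝 (b p))) (P : MvPolynomial (Fin 2) singular) :
    Tendsto (fun n => MvPolynomial.aeval ![u n, v n] P p) atTop
      (𝓝 (MvPolynomial.aeval ![a, b] P p)) := by
  induction P using MvPolynomial.induction_on with
  | C c => simp only [MvPolynomial.aeval_C]; exact tendsto_const_nhds
  | add P Q hP hQ => simp only [map_add]; exact hP.add hQ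
  | mul_X P i hP =>
    simp only [map_mul, MvPolynomial.aeval_X]
    refine hP.mul ?_
    fin_cases i
    · exact hu
    · exact hv

/-- The element `τ ↦ -1 / (τ + n)` of the Jacobi group. -/
def invShift (n : ℕ) : JacobiGroup :=
  (⟨!![0, -1; 1, n], by simp [Matrix.det_fin_two]⟩, (0, 0))

lemma autJ_invShift (n : ℕ) (p : dom) : autJ (invShift n) p = p.1.1 + n := by
  simp [autJ, invShift]

lemma autX_invShift (n : ℕ) (p : dom) : autX (invShift n) p = (autJ (invShift n) p)⁻¹ := by
  simp [autX, invShift]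

lemma autY_invShift (n : ℕ) (p : dom) :
    autY (invShift n) p = p.1.2 * (autJ (invShift n) p)⁻¹ := by
  simp [autY, invShift, div_eq_mul_inv]

lemma tendsto_autJ_invShift_inv (p : dom) :
    Tendsto (fun n => (autJ (invShift n) p)⁻¹) atTop (𝓝 0) := by
  simp only [autJ_invShift]
  refine tendsto_inv₀_cobounded.comp ?_
  exact tendsto_const_add_cobounded p.1.1 |>.comp tendsto_natCast_atTop_cobounded

/-- Along `invShift n` both `X` and `Y` tend to `0`, their values at the identity. Hence `f|_k A`, a
fixed polynomial in `X` and `Y`, tends to its value at the identity, which is `f`. -/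
lemma tendsto_slash_invShift {k : ℕ} {f : dom → ℂ} (hf : f ∈ quasiJacobi k) (p : dom) :
    Tendsto (fun n => slash k f (invShift n) p) atTop (𝓝 (f p)) := by
  obtain ⟨_, P, hP⟩ := hf
  have h0 : MvPolynomial.aeval ![autX (1, (0, 0)), autY (1, (0, 0))] P p = f p := by rw [← hP, slash_one]
  have hX : autX (1, (0, 0)) p = 0 := by simp [autX]
  have hY : autY (1, (0, 0)) p = 0 := by simp [autY]
  simp only [hP]
  rw [← h0]
  refine tendsto_aeval ?_ ?_ P
  · simpa only [autX_invShift, hX] using tendsto_autJ_invShift_inv p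
  · simpa only [autY_invShift, hY, mul_zero] using (tendsto_autJ_invShift_inv p).const_mul p.1.2

/-- Let `a` be the largest weight. The relation at the image point, divided by `J^a`, reads `f_a|_a
A + ∑ J^(k - a) f_k|_k A = 0`. Along `invShift n` the lower weights disappear and the first term
tends to `f_a`, so `f_a = 0`; induction does the rest. -/
lemma eq_zero_of_sum_quasiJacobi_eq_zero (s : Finset ℕ) {f : ℕ → dom → ℂ}
    (hf : ∀ k ∈ s, f k ∈ quasiJacobi k) (h : ∑ k ∈ s, f k = 0) : ∀ k ∈ s, f k = 0 := by
  induction s using Finset.induction_on_max with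
  | empty => simp
  | insert a s has ih =>
    have hna : a ∉ s := fun h => lt_irrefl _ (has a h)
    have ha : f a = 0 := by
      funext p
      have h1 : Tendsto (fun n => slash a (f a) (invShift n) p + ∑ k ∈ s,
          (autJ (invShift n) p)⁻¹ ^ (a - k) * slash k (f k) (invShift n) p) atTop
          (𝓝 (f a p + ∑ k ∈ s, 0 ^ (a - k) * f k p)) := by
        refine (tendsto_slash_invShift (hf a (Finset.mem_insert_self a s)) p).add
          (tendsto_finsetSum s fun k hk => ?_)
        exact ((tendsto_autJ_invShift_inv p).pow _).mul
          (tendsto_slash_invShift (hf k (Finset.mem_insert_of_mem hk)) p)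
      have h2 : ∑ k ∈ s, 0 ^ (a - k) * f k p = 0 := by
        refine Finset.sum_eq_zero fun k hk => ?_
        rw [zero_pow (Nat.sub_ne_zero_of_lt (has k hk)), zero_mul]
      rw [h2, add_zero] at h1
      refine tendsto_nhds_unique h1 (tendsto_const_nhds.congr fun n => ?_)
      set A := invShift n
      have h3 := congrFun h ⟨actPoint A p, actPoint_mem A p⟩
      rw [Finset.sum_insert hna, Pi.add_apply, Finset.sum_apply, Pi.zero_apply] at h3
      have hJ := autJ_ne_zero A p
      have h4 : ∀ k ∈ s, (autJ A p)⁻¹ ^ (a - k) * slash k (f k) A p =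
          (autJ A p ^ a)⁻¹ * f k ⟨actPoint A p, actPoint_mem A p⟩ := by
        intro k hk
        rw [slash, ← mul_assoc, ← inv_pow, ← inv_pow, ← pow_add, Nat.sub_add_cancel (has k hk).le]
      rw [Finset.sum_congr rfl h4, ← Finset.mul_sum, slash, ← mul_add, h3, mul_zero, Pi.zero_apply]
    rw [Finset.sum_insert hna, ha, zero_add] at h
    intro k hk
    rcases Finset.mem_insert.mp hk with rfl | hk
    · exact ha
    · exact ih (fun k hk => hf k (Finset.mem_insert_of_mem hk)) h k hk

/-- The forms of weight `k`, as a subspace of `JSinf`. -/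
def weightSpace (k : ℕ) : Submodule ℂ JSinf := (quasiJacobi k).comap JSinf.val.toLinearMap

lemma quasiJacobi_le_JSinf {k : ℕ} {f : dom → ℂ} (hf : f ∈ quasiJacobi k) : f ∈ JSinf :=
  Submodule.mem_iSup_of_mem k hf

@[elab_as_elim]
lemma JSinf_induction {motive : JSinf → Prop} (mem : ∀ k, ∀ f ∈ weightSpace k, motive f)
    (add : ∀ f g, motive f → motive g → motive (f + g)) (f : JSinf) : motive f := by
  obtain ⟨f, hf⟩ := f
  refine Submodule.iSup_induction' quasiJacobi (motive := fun f hf => motive ⟨f, hf⟩) ?_ ?_ ?_ hf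
  · exact fun k f hf => mem k ⟨f, quasiJacobi_le_JSinf hf⟩ hf
  · exact mem 0 0 (zero_mem _)
  · exact fun f g hf hg => add ⟨f, hf⟩ ⟨g, hg⟩

lemma iSup_weightSpace : ⨆ k, weightSpace k = ⊤ :=
  eq_top_iff.mpr fun f _ => JSinf_induction (motive := (· ∈ ⨆ k, weightSpace k))
    (fun k _ hf => Submodule.mem_iSup_of_mem k hf) (fun _ _ => Submodule.add_mem _) f

lemma iSupIndep_weightSpace : iSupIndep weightSpace := by
  rw [iSupIndep_iff_finsetSum_eq_zero_imp_eq_zero]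
  intro s f hf h k hk
  refine Subtype.ext (eq_zero_of_sum_quasiJacobi_eq_zero s (f := fun k => (f k : dom → ℂ))
    hf ?_ k hk)
  simpa using congrArg Subtype.val h

lemma isInternal_weightSpace : DirectSum.IsInternal weightSpace :=
  DirectSum.isInternal_submodule_of_iSupIndep_of_iSup_eq_top iSupIndep_weightSpace iSup_weightSpace

/-! ### The derivation of the algebra of quasi-Jacobi forms -/

lemma isHol_of_mem_JSinf {f : dom → ℂ} (hf : f ∈ JSinf) : IsHol f := by
  have h : JSinf ≤ singular := (iSup_le fun _ _ hf => hf.1 : ⨆ k, quasiJacobi k ≤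
    Subalgebra.toSubmodule singular)
  exact (h hf).holo

lemma dTau_smul (c : ℂ) (f : dom → ℂ) : dTau (c • f) = c • dTau f := by
  funext p
  have h (q : ℂ × ℂ) : ext (c • f) q = c * ext f q := by
    by_cases hq : q ∈ dom <;> simp [ext, hq]
  simp only [dTau, h, Pi.smul_apply, smul_eq_mul, deriv_const_mul_field]
  ring

lemma dTau_mem_JSinf (f : JSinf) : dTau f ∈ JSinf := by
  induction f using JSinf_induction with
  | mem k f hf => exact quasiJacobi_le_JSinf (dTau_mem_quasiJacobi hf)
  | add f g hf hg =>
    rw [Subalgebra.coe_add, dTau_add (isHol_of_mem_JSinf f.2) (isHol_of_mem_JSinf g.2)]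
    exact add_mem hf hg

/-- `∂_τ` as a derivation of `JSinf`. -/
def dTauDer : Derivation ℂ JSinf JSinf :=
  Derivation.mk'
    { toFun := fun f => ⟨dTau f, dTau_mem_JSinf f⟩
      map_add' := fun f g =>
        Subtype.ext (dTau_add (isHol_of_mem_JSinf f.2) (isHol_of_mem_JSinf g.2))
      map_smul' := fun c f => Subtype.ext (dTau_smul c f) }
    (fun f g => Subtype.ext <| by
      change dTau (f * g : dom → ℂ) = (f : dom → ℂ) * dTau g + (g : dom → ℂ) * dTau f
      rw [dTau_mul (isHol_of_mem_JSinf f.2) (isHol_of_mem_JSinf g.2)]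
      ring)

lemma coe_dTauDer_iterate (r : ℕ) (f : JSinf) : (dTauDer^[r] f : dom → ℂ) = dTau^[r] f := by
  induction r with
  | zero => rfl
  | succ r ih => rw [Function.iterate_succ_apply', Function.iterate_succ_apply', ← ih]; rfl

lemma dTau_iterate_mem_quasiJacobi (r : ℕ) {k : ℕ} {f : dom → ℂ} (hf : f ∈ quasiJacobi k) :
    dTau^[r] f ∈ quasiJacobi (k + 2 * r) := by
  induction r with
  | zero => exact hf
  | succ r ih => rw [Function.iterate_succ_apply']; exact dTau_mem_quasiJacobi ih

/-! ### Rankin-Cohen brackets of quasi-Jacobi forms -/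

lemma isRankinCohen_iff {B : ℕ → JSinf →ₗ[ℂ] JSinf →ₗ[ℂ] JSinf} :
    IsRankinCohen B ↔ ∀ n k l, ∀ f ∈ weightSpace k, ∀ g ∈ weightSpace l,
      B n f g = rankinCohen dTauDer n k l f g := by
  have h (n k l : ℕ) (f g : JSinf) : (rankinCohen dTauDer n k l f g : dom → ℂ) =
      ∑ r ∈ Finset.range (n + 1), rcCoeff n k l r • (dTau^[r] f * dTau^[n - r] g) := by
    rw [rankinCohen_apply]
    simp [coe_dTauDer_iterate]
  refine ⟨fun H n k l f hf g hg => Subtype.ext ?_, fun H n k l f g hf hg => ?_⟩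
  · rw [H n k l f g hf hg, h]
  · rw [H n k l f hf g hg, h]

/-- A bilinear map given on the weight spaces extends to `JSinf`. -/
lemma exists_bilinear_extension (b : ℕ → ℕ → JSinf →ₗ[ℂ] JSinf →ₗ[ℂ] JSinf) :
    ∃ B : JSinf →ₗ[ℂ] JSinf →ₗ[ℂ] JSinf,
      ∀ k l, ∀ f ∈ weightSpace k, ∀ g ∈ weightSpace l, B f g = b k l f g := by
  have key {M : Type} [AddCommMonoid M] [Module ℂ M] (φ : ℕ → JSinf →ₗ[ℂ] M) :
      ∃ Φ : JSinf →ₗ[ℂ] M, ∀ k, ∀ f ∈ weightSpace k, Φ f = φ k f := by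
    let e := LinearEquiv.ofBijective (DirectSum.coeLinearMap weightSpace) isInternal_weightSpace
    refine ⟨DirectSum.toModule ℂ ℕ M (fun k => φ k ∘ₗ (weightSpace k).subtype) ∘ₗ
      e.symm.toLinearMap, fun k f hf => ?_⟩
    have he : e.symm f = DirectSum.lof ℂ ℕ (fun k => weightSpace k) k ⟨f, hf⟩ := by
      rw [LinearEquiv.symm_apply_eq]
      exact (DirectSum.coeLinearMap_lof weightSpace k ⟨f, hf⟩).symm
    simp [he]
  -- The extension of linear maps from the weight spaces is used twice: first in `g` for each weight
  -- of `f`, then in `f`.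
  choose Φ hΦ using fun k => key fun l => (b k l).flip
  obtain ⟨B, hB⟩ := key fun k => (Φ k).flip
  exact ⟨B, fun k l f hf g hg => by
    rw [hB k f hf, LinearMap.flip_apply, hΦ k l g hg, LinearMap.flip_apply]⟩

/-- Uniqueness holds because forms of pure weight span. Existence uses that the sum of the weight
spaces is direct, without which the weight-dependent formulas could conflict. -/
lemma existsUnique_isRankinCohen :
    ∃! B : ℕ → JSinf →ₗ[ℂ] JSinf →ₗ[ℂ] JSinf, IsRankinCohen B := by
  choose B hB using fun n => exists_bilinear_extension (rankinCohen dTauDer n)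
  refine ⟨B, isRankinCohen_iff.mpr hB, fun B' hB' => ?_⟩
  replace hB' := isRankinCohen_iff.mp hB'
  funext n
  ext f g : 2
  induction f using JSinf_induction with
  | add f f' h h' => simp only [map_add, LinearMap.add_apply, h, h']
  | mem k f hf =>
    induction g using JSinf_induction with
    | add g g' h h' => simp only [map_add, h, h']
    | mem l g hg => rw [hB' n k l f hf g hg, hB n k l f hf g hg]

variable {B : ℕ → JSinf →ₗ[ℂ] JSinf →ₗ[ℂ] JSinf}

lemma IsRankinCohen.mem_quasiJacobi (hB : IsRankinCohen B) {n k l : ℕ} {f g : JSinf}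
    (hf : (f : dom → ℂ) ∈ quasiJacobi k) (hg : (g : dom → ℂ) ∈ quasiJacobi l) :
    (B n f g : dom → ℂ) ∈ quasiJacobi (k + l + 2 * n) := by
  rw [hB n k l f g hf hg]
  refine sum_mem fun r hr => Submodule.smul_mem _ _ ?_
  have h := quasiJacobi_mul (dTau_iterate_mem_quasiJacobi r hf)
    (dTau_iterate_mem_quasiJacobi (n - r) hg)
  have e : k + 2 * r + (l + 2 * (n - r)) = k + l + 2 * n := by
    have := Finset.mem_range.mp hr
    omega
  rwa [e] at h

lemma IsRankinCohen.isFormalDeformation (hB : IsRankinCohen B) : IsFormalDeformation B := by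
  have hB' := isRankinCohen_iff.mp hB
  have hone : (1 : JSinf) ∈ weightSpace 0 := one_mem_quasiJacobi
  have hd : dTauDer 1 = 0 := dTauDer.map_one_eq_zero
  have hit (r : ℕ) : dTauDer^[r + 1] 1 = 0 := by
    rw [Function.iterate_succ_apply, hd]
    exact iterate_map_zero dTauDer r
  refine .of_brackets ?_ ?_ ?_ ?_
  · intro f g
    induction f using JSinf_induction with
    | add f f' h h' => simp only [map_add, LinearMap.add_apply, h, h', add_mul]
    | mem k f hf =>
      induction g using JSinf_induction with
      | add g g' h h' => simp only [map_add, h, h', mul_add]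
      | mem l g hg =>
        rw [hB' 0 k l f hf g hg, rankinCohen_apply]
        simp [rcCoeff]
  · intro n f g h
    induction f using JSinf_induction with
    | add f f' h h' =>
      simp only [map_add, LinearMap.add_apply, Finset.sum_add_distrib, h, h']
    | mem k f hf =>
      induction g using JSinf_induction with
      | add g g' h h' =>
        simp only [map_add, LinearMap.add_apply, Finset.sum_add_distrib, h, h']
      | mem l g hg =>
        induction h using JSinf_induction with
        | add g g' h h' => simp only [map_add, Finset.sum_add_distrib, h, h']
        | mem m h hh =>
          -- The inner bracket again has a weight, so the formula applies to the outer one.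
          have hl (p : ℕ × ℕ) : B p.2 (B p.1 f g) h =
              rankinCohen dTauDer p.2 (k + l + 2 * p.1) m (rankinCohen dTauDer p.1 k l f g) h := by
            rw [hB' p.2 (k + l + 2 * p.1) m _ (hB.mem_quasiJacobi hf hg) h hh,
              hB' p.1 k l f hf g hg]
          have hr (p : ℕ × ℕ) : B p.2 f (B p.1 g h) =
              rankinCohen dTauDer p.2 k (l + m + 2 * p.1) f (rankinCohen dTauDer p.1 l m g h) := by
            rw [hB' p.2 k (l + m + 2 * p.1) f hf _ (hB.mem_quasiJacobi hg hh),
              hB' p.1 l m g hg h hh]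
          simp only [hl, hr]
          exact rankinCohen_assoc dTauDer n k l m f g h
  · intro n f
    induction f using JSinf_induction with
    | add f f' h h' => simp only [map_add, h, h', add_zero]
    | mem k f hf =>
      rw [hB' _ 0 k 1 hone f hf, rankinCohen_apply]
      refine Finset.sum_eq_zero fun r _ => ?_
      rcases r with _ | r
      -- The only term without a derivative of `1` has the factor `binom(n, n + 1) = 0`, because `1`
      -- has weight 0.
      · simp [rcCoeff, Nat.choose_succ_self]
      · rw [hit, zero_mul, smul_zero]
  · intro n f
    induction f using JSinf_induction with
    | add f f' h h' => simp only [map_add, LinearMap.add_apply, h, h', add_zero]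
    | mem k f hf =>
      rw [hB' _ k 0 f hf 1 hone, rankinCohen_apply]
      refine Finset.sum_eq_zero fun r hr => ?_
      rcases (Finset.mem_range_succ_iff.mp hr).lt_or_eq with h | rfl
      · rw [show n + 1 - r = (n - r) + 1 by omega, hit, mul_zero, smul_zero]
      · simp [rcCoeff, Nat.choose_succ_self]

/-! ### Classical Rankin-Cohen brackets of modular forms -/

open Derivative ModularForm
open UpperHalfPlane hiding I

lemma qParam_one_pow (τ : ℍ) (r : ℕ) :
    Function.Periodic.qParam 1 τ ^ r = cexp (2 * Real.pi * I * r * τ) := by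
  rw [Function.Periodic.qParam, ← Complex.exp_nat_mul]
  congr 1
  push_cast
  ring

lemma IsHoloAtInfty.isBoundedAtImInfty {a : ℍ → ℂ} (ha : IsHoloAtInfty a) :
    IsBoundedAtImInfty a := by
  obtain ⟨-, c, hc⟩ := ha
  refine isBoundedAtImInfty_of_hasSum_qExpansion (c := c) one_pos fun τ => ?_
  simp only [qParam_one_pow, smul_eq_mul]
  exact hc τ

lemma isHoloAtInfty_modularForm {k : ℤ} (f : ModularForm 𝒮ℒ k) : IsHoloAtInfty f := by
  refine ⟨f.holo', fun r => (qExpansion 1 f).coeff r, fun τ => ?_⟩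
  have h := ModularForm.hasSum_qExpansion f one_pos one_mem_strictPeriods_SL τ
  simp only [qParam_one_pow] at h
  exact h

lemma slash_modularForm {k : ℤ} (f : ModularForm 𝒮ℒ k) (γ : SL(2, ℤ)) :
    (f : ℍ → ℂ) ∣[k] γ = f :=
  SlashInvariantForm.slash_action_eqn f _ ⟨γ, rfl⟩

/-- A function holomorphic on `ℍ` and at infinity that is invariant under the weight `k` action is
a modular form. -/
lemma exists_modularForm {k : ℤ} {a : ℍ → ℂ} (ha : IsHoloAtInfty a)
    (h : ∀ γ : SL(2, ℤ), a ∣[k] γ = a) : ∃ f : ModularForm 𝒮ℒ k, (f : ℍ → ℂ) = a := by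
  refine ⟨{ toFun := a, slash_action_eq' := ?_, holo' := ha.1, bdd_at_cusps' := fun {c} hc => ?_ },
    rfl⟩
  · rintro _ ⟨γ, rfl⟩
    exact h γ
  -- The cusp is moved to infinity by an element of `SL(2, ℤ)`, and invariance reduces the claim to
  -- boundedness there.
  · rw [OnePoint.isBoundedAt_iff_forall_SL2Z hc]
    intro γ _
    rw [h γ]
    exact ha.isBoundedAtImInfty

/-- The algebra of holomorphic functions on `ℍ`. -/
def holomorphic : Subalgebra ℂ (ℍ → ℂ) where
  carrier := {a | MDiff a}
  add_mem' ha hb := ha.add hb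
  mul_mem' ha hb := ha.mul hb
  algebraMap_mem' _ := mdifferentiable_const

/-- The normalized derivative as a derivation of the algebra of holomorphic functions. -/
def holomorphicDer : Derivation ℂ holomorphic holomorphic :=
  Derivation.mk'
    { toFun := fun a => ⟨normalizedDerivOfComplex a, normalizedDerivOfComplex_mdifferentiable a.2⟩
      map_add' := fun a b => Subtype.ext (normalizedDerivOfComplex_add _ _ a.2 b.2)
      map_smul' := fun c a => Subtype.ext (normalizedDerivOfComplex_smul c _ a.2) }
    (fun a b => Subtype.ext <| by
      refine (normalizedDerivOfComplex_mul _ _ a.2 b.2).trans ?_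
      change _ = (a : ℍ → ℂ) * normalizedDerivOfComplex b + (b : ℍ → ℂ) * normalizedDerivOfComplex a
      ring)

lemma coe_holomorphicDer_iterate (r : ℕ) (a : holomorphic) :
    (holomorphicDer^[r] a : ℍ → ℂ) = normalizedDerivOfComplex^[r] a := by
  induction r with
  | zero => rfl
  | succ r ih => rw [Function.iterate_succ_apply', Function.iterate_succ_apply', ← ih]; rfl

lemma coe_rankinCohen_holomorphicDer (n k l : ℕ) (a b : holomorphic) :
    (rankinCohen holomorphicDer n k l a b : ℍ → ℂ) = classicalRankinCohen n k l a b := by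
  rw [rankinCohen_apply, classicalRankinCohen]
  simp [coe_holomorphicDer_iterate]

lemma denom_SL (γ : SL(2, ℤ)) (τ : ℍ) : denom γ τ = γ 1 0 * τ + γ 1 1 := by simp [denom]

/-- The function `τ ↦ (2πi)⁻¹ c / (cτ + d)`. -/
def automorphyFactor (γ : SL(2, ℤ)) (τ : ℍ) : ℂ := (2 * Real.pi * I)⁻¹ * (γ 1 0 / denom γ τ)

lemma hasDerivAt_automorphyFactor (γ : SL(2, ℤ)) (τ : ℍ) :
    HasDerivAt (automorphyFactor γ ∘ ofComplex)
      ((2 * Real.pi * I)⁻¹ * -((γ 1 0 : ℂ) / denom γ τ) ^ 2) τ := by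
  have h0 : (γ 1 0 : ℂ) * τ + γ 1 1 ≠ 0 := cocycle_ne_zero (γ, (0, 0)) τ.2
  have h1 : HasDerivAt (fun t : ℂ => (2 * Real.pi * I : ℂ)⁻¹ * ((γ 1 0 : ℂ) / (γ 1 0 * t + γ 1 1)))
      ((2 * Real.pi * I)⁻¹ * -((γ 1 0 : ℂ) / (γ 1 0 * τ + γ 1 1)) ^ 2) τ := by
    have h2 := ((hasDerivAt_const (τ : ℂ) (γ 1 0 : ℂ)).div
      (((hasDerivAt_id (τ : ℂ)).const_mul (γ 1 0 : ℂ)).add_const (γ 1 1 : ℂ)) h0).const_mul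
      (2 * Real.pi * I : ℂ)⁻¹
    refine h2.congr_deriv ?_
    simp only [id_eq]
    field_simp
    ring
  rw [denom_SL]
  refine h1.congr_of_eventuallyEq ?_
  filter_upwards [isOpen_upperHalfPlaneSet.mem_nhds τ.2] with t ht
  rw [Function.comp_apply, ofComplex_apply_of_im_pos ht, automorphyFactor, denom_SL]

lemma mdifferentiable_automorphyFactor (γ : SL(2, ℤ)) : MDiff (automorphyFactor γ) := fun τ =>
  mdifferentiableAt_iff.mpr (hasDerivAt_automorphyFactor γ τ).differentiableAt

/-- This is the Riccati equation that `rankinCohen_twist` requires of `x`. -/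
lemma normalizedDeriv_automorphyFactor (γ : SL(2, ℤ)) :
    normalizedDerivOfComplex (automorphyFactor γ) = -automorphyFactor γ ^ 2 := by
  funext τ
  rw [normalizedDerivOfComplex, (hasDerivAt_automorphyFactor γ τ).deriv]
  simp only [Pi.neg_apply, Pi.pow_apply, automorphyFactor]
  ring

lemma mdifferentiable_normalizedDeriv_iterate {a : ℍ → ℂ} (ha : MDiff a) (r : ℕ) :
    MDiff (normalizedDerivOfComplex^[r] a) := by
  rw [← coe_holomorphicDer_iterate r ⟨a, ha⟩]
  exact (holomorphicDer^[r] ⟨a, ha⟩).2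

/-- The functions `(D^r a)|_(k + 2r) γ` satisfy the recursion twisted by the automorphy factor and
start from `a|_k γ = a`; the same holds for `b`. Slashing the bracket replaces its iterates by these
twisted ones, which leaves it unchanged. -/
lemma slash_classicalRankinCohen {n k l : ℕ} {a b : ℍ → ℂ} (ha : MDiff a) (hb : MDiff b)
    (γ : SL(2, ℤ)) (hka : a ∣[(k : ℤ)] γ = a) (hlb : b ∣[(l : ℤ)] γ = b) :
    classicalRankinCohen n k l a b ∣[((k + l + 2 * n : ℕ) : ℤ)] γ =
      classicalRankinCohen n k l a b := by
  let u (k : ℕ) (a : ℍ → ℂ) (ha : MDiff a) (r : ℕ) : holomorphic :=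
    ⟨normalizedDerivOfComplex^[r] a ∣[((k + 2 * r : ℕ) : ℤ)] γ,
      (mdifferentiable_normalizedDeriv_iterate ha r).slash _ _⟩
  let x : holomorphic := ⟨automorphyFactor γ, mdifferentiable_automorphyFactor γ⟩
  have hx : holomorphicDer x = -x ^ 2 := Subtype.ext (normalizedDeriv_automorphyFactor γ)
  have hu (k : ℕ) (a : ℍ → ℂ) (ha : MDiff a) (r : ℕ) : u k a ha (r + 1) =
      holomorphicDer (u k a ha r) + ((k + 2 * r : ℕ) : holomorphic) * (x * u k a ha r) := by
    refine Subtype.ext (funext fun τ => ?_)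
    have h := congrFun (normalizedDerivOfComplex_SL_slash (k := ((k + 2 * r : ℕ) : ℤ))
      (mdifferentiable_normalizedDeriv_iterate ha r) (γ := γ)) τ
    have e : ((k + 2 * (r + 1) : ℕ) : ℤ) = ((k + 2 * r : ℕ) : ℤ) + 2 := by push_cast; ring
    change (normalizedDerivOfComplex^[r + 1] a ∣[((k + 2 * (r + 1) : ℕ) : ℤ)] γ) τ =
      normalizedDerivOfComplex (normalizedDerivOfComplex^[r] a ∣[((k + 2 * r : ℕ) : ℤ)] γ) τ +
        ((k + 2 * r : ℕ) : ℂ) * (automorphyFactor γ τ *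
          (normalizedDerivOfComplex^[r] a ∣[((k + 2 * r : ℕ) : ℤ)] γ) τ)
    rw [h, e, Function.iterate_succ_apply', automorphyFactor, Pi.sub_apply]
    push_cast
    ring
  have h := congrArg Subtype.val
    (rankinCohen_twist holomorphicDer hx (hu k a ha) (hu l b hb) n)
  rw [coe_rankinCohen_holomorphicDer] at h
  have h0 : (u k a ha 0 : ℍ → ℂ) = a := hka
  have h1 : (u l b hb 0 : ℍ → ℂ) = b := hlb
  rw [h0, h1] at h
  refine Eq.trans (funext fun τ => ?_) h
  rw [SL_slash_apply, QuasiJacobi.classicalRankinCohen, AddSubmonoidClass.coe_finsetSum, Finset.sum_apply,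
    Finset.sum_apply, Finset.sum_mul]
  refine Finset.sum_congr rfl fun r hr => ?_
  change rcCoeff n k l r * (normalizedDerivOfComplex^[r] a (γ • τ) *
    normalizedDerivOfComplex^[n - r] b (γ • τ)) * _ = rcCoeff n k l r *
      ((normalizedDerivOfComplex^[r] a ∣[((k + 2 * r : ℕ) : ℤ)] γ) τ *
        (normalizedDerivOfComplex^[n - r] b ∣[((l + 2 * (n - r) : ℕ) : ℤ)] γ) τ)
  have e : -((k + l + 2 * n : ℕ) : ℤ) = -((k + 2 * r : ℕ) : ℤ) + -((l + 2 * (n - r) : ℕ) : ℤ) := by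
    have := Finset.mem_range.mp hr
    omega
  rw [SL_slash_apply, SL_slash_apply, e, zpow_add₀ (denom_ne_zero _ _)]
  ring

lemma IsHoloAtInfty.classicalRankinCohen {a b : ℍ → ℂ} (ha : IsHoloAtInfty a)
    (hb : IsHoloAtInfty b) (n k l : ℕ) : IsHoloAtInfty (classicalRankinCohen n k l a b) := by
  have h {a : ℍ → ℂ} (ha : IsHoloAtInfty a) (r : ℕ) :
      IsHoloAtInfty (normalizedDerivOfComplex^[r] a) := by
    induction r with
    | zero => exact ha
    | succ r ih => rw [Function.iterate_succ_apply']; exact ih.normalizedDeriv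
  exact isHoloAtInfty_sum _ _ fun r _ => ((h ha r).mul (h hb _)).const_mul _

/-- The classical Rankin-Cohen bracket of two modular forms is a modular form. -/
theorem exists_modularForm_classicalRankinCohen (c : ℂ) (n : ℕ) {k l : ℕ}
    (f : ModularForm 𝒮ℒ (k : ℤ)) (g : ModularForm 𝒮ℒ (l : ℤ)) :
    ∃ h : ModularForm 𝒮ℒ ((k + l + 2 * n : ℕ) : ℤ),
      (h : ℍ → ℂ) = c • classicalRankinCohen n k l f g := by
  refine exists_modularForm (((isHoloAtInfty_modularForm f).classicalRankinCohen
    (isHoloAtInfty_modularForm g) n k l).const_mul c) fun γ => ?_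
  rw [SL_smul_slash, slash_classicalRankinCohen (ModularFormClass.holo f) (ModularFormClass.holo g) γ (slash_modularForm f γ)
    (slash_modularForm g γ)]

/-! ### Modular forms as quasi-Jacobi forms -/

lemma ext_pullTau (a : ℍ → ℂ) {p : ℂ × ℂ} (hp : p ∈ dom) :
    ext (pullTau a) p = a (ofComplex p.1) := by
  rw [ext_of_mem _ hp, ofComplex_apply_of_im_pos hp.1]
  rfl

lemma isSingular_pullTau {a : ℍ → ℂ} (ha : IsHoloAtInfty a)
    (hp : ∀ τ : ℍ, a ((1 : ℝ) +ᵥ τ) = a τ) : IsSingular (pullTau a) where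
  holo := by
    intro p hp
    have h1 : DifferentiableAt ℂ (a ∘ ofComplex) p.1 :=
      mdifferentiableAt_iff.mp (ha.1 ⟨p.1, hp.1⟩)
    have h2 : DifferentiableAt ℂ (fun p : ℂ × ℂ => (a ∘ ofComplex) p.1) p :=
      h1.comp p differentiableAt_fst
    exact h2.differentiableWithinAt.congr (fun q hq => ext_pullTau a hq) (ext_pullTau a hp)
  periodic_z τ z := by
    by_cases h : (τ, z) ∈ dom
    · rw [ext_pullTau a h, ext_pullTau a (dom_add_one_right.mpr h)]
    · simp [ext, h, mt dom_add_one_right.mp h]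
  periodic_tau τ z := by
    by_cases h : (τ, z) ∈ dom
    · have h' := dom_add_one_left.mpr h
      rw [ext_pullTau a h, ext_pullTau a h', ofComplex_apply_of_im_pos h.1,
        ofComplex_apply_of_im_pos h'.1, ← hp ⟨τ, h.1⟩]
      congr 1
      ext
      simp [add_comm]
    · simp [ext, h, mt dom_add_one_left.mp h]
  poles := by
    refine ⟨0, fun τ m n => ?_⟩
    have h : (fun z : ℂ => ext (pullTau a) (τ, z))
        =ᶠ[𝓝[≠] ((m : ℂ) + (n : ℂ) * (τ : ℂ))] fun _ => a τ :=
      (eventually_mem_dom τ _).mono fun z hz => (ext_pullTau a hz).trans (by rw [ofComplex_apply])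
    refine ⟨(MeromorphicAt.const _ _).congr h.symm, ?_⟩
    rw [meromorphicOrderAt_congr h]
    simpa using (analyticAt_const (v := a τ)).meromorphicOrderAt_nonneg
  laurent := by
    refine ⟨0, fun n => if n = 0 then a else fun _ => 0, fun n => ?_, fun τ => ?_⟩
    · by_cases hn : n = 0
      · simpa [hn] using ha
      · simpa [hn] using isHoloAtInfty_const 0
    · filter_upwards [eventually_mem_dom τ 0] with z hz
      rw [ext_pullTau a hz, ofComplex_apply]
      convert hasSum_ite_eq (0 : ℕ) (a τ) using 2 with n
      split_ifs with h <;> simp [h]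

/-- A modular form has depth zero: the polynomial in `X` and `Y` is the constant `f`. Periodicity in
`τ` comes from the translation `T`. -/
lemma pullTau_mem_quasiJacobi {k : ℕ} (f : ModularForm 𝒮ℒ (k : ℤ)) :
    pullTau f ∈ quasiJacobi k := by
  have hγ (γ : SL(2, ℤ)) (τ : ℍ) : f (γ • τ) * denom γ τ ^ (-(k : ℤ)) = f τ := by
    rw [← SL_slash_apply, slash_modularForm]
  have hs : IsSingular (pullTau f) := by
    refine isSingular_pullTau (isHoloAtInfty_modularForm f) fun τ => ?_
    have h := hγ ModularGroup.T τ
    rw [UpperHalfPlane.modular_T_smul] at h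
    have hd : denom ModularGroup.T τ = 1 := by rw [denom_SL]; simp [ModularGroup.T]
    rwa [hd, one_zpow, mul_one] at h
  refine ⟨hs, MvPolynomial.C ⟨pullTau f, hs⟩, fun A => ?_⟩
  rw [MvPolynomial.aeval_C]
  funext p
  change (autJ A p ^ k)⁻¹ * pullTau f ⟨actPoint A p, actPoint_mem A p⟩ = pullTau f p
  have h := hγ A.1 ⟨p.1.1, p.2.1⟩
  have hd : denom A.1 (⟨p.1.1, p.2.1⟩ : ℍ) = autJ A p := denom_SL _ _
  rw [hd, zpow_neg, zpow_natCast, mul_comm] at h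
  rw [pullTau, pullTau, ← h]
  congr 2
  ext
  rw [coe_specialLinearGroup_apply]
  simp [actPoint, autJ]

lemma modularForms_le_JSinf : modularForms ≤ JSinf := by
  have h : Submodule.span ℂ {F | ∃ (k : ℕ) (f : ModularForm 𝒮ℒ (k : ℤ)), F = pullTau f} ≤
      Subalgebra.toSubmodule JSinf := by
    rw [Submodule.span_le]
    rintro _ ⟨k, f, rfl⟩
    exact quasiJacobi_le_JSinf (pullTau_mem_quasiJacobi f)
  exact h

lemma dTau_pullTau {a : ℍ → ℂ} (ha : MDiff a) :
    dTau (pullTau a) = (Real.pi : ℂ) ^ 2 • pullTau (normalizedDerivOfComplex a) := by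
  funext p
  have h1 := mdifferentiableAt_iff.mp (ha ⟨p.1.1, p.2.1⟩)
  have h2 : deriv (fun t : ℂ => ext (pullTau a) (t, p.1.2)) p.1.1 =
      deriv (a ∘ ofComplex) p.1.1 :=
    Filter.EventuallyEq.deriv_eq ((eventually_fst_mem_dom p).mono fun t ht => ext_pullTau a ht)
  rw [dTau, h2, pi_div_two_I, mul_assoc]
  rfl

lemma dTau_iterate_pullTau {a : ℍ → ℂ} (ha : MDiff a) (r : ℕ) :
    dTau^[r] (pullTau a) =
      ((Real.pi : ℂ) ^ 2) ^ r • pullTau (normalizedDerivOfComplex^[r] a) := by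
  induction r with
  | zero => simp
  | succ r ih =>
    rw [Function.iterate_succ_apply', ih, dTau_smul,
      dTau_pullTau (mdifferentiable_normalizedDeriv_iterate ha r), smul_smul, ← pow_succ,
      Function.iterate_succ_apply']

/-- Each term contains `n` derivatives in total, and each contributes one factor `π²`. -/
lemma sum_dTau_pullTau {a b : ℍ → ℂ} (ha : MDiff a) (hb : MDiff b) (n k l : ℕ) :
    ∑ r ∈ Finset.range (n + 1),
      rcCoeff n k l r • (dTau^[r] (pullTau a) * dTau^[n - r] (pullTau b)) =
      pullTau (((Real.pi : ℂ) ^ 2) ^ n • classicalRankinCohen n k l a b) := by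
  funext p
  rw [Finset.sum_apply]
  change _ = ((Real.pi : ℂ) ^ 2) ^ n * (classicalRankinCohen n k l a b) ⟨p.1.1, p.2.1⟩
  rw [classicalRankinCohen, Finset.sum_apply, Finset.mul_sum]
  refine Finset.sum_congr rfl fun r hr => ?_
  rw [dTau_iterate_pullTau ha, dTau_iterate_pullTau hb,
    ← pow_mul_pow_sub ((Real.pi : ℂ) ^ 2) (Finset.mem_range_succ_iff.mp hr)]
  simp only [Pi.smul_apply, Pi.mul_apply, smul_eq_mul, pullTau]
  ring

lemma IsRankinCohen.exists_modularForm {B : ℕ → JSinf →ₗ[ℂ] JSinf →ₗ[ℂ] JSinf}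
    (hB : IsRankinCohen B) (n k l : ℕ) (f : ModularForm 𝒮ℒ (k : ℤ)) (g : ModularForm 𝒮ℒ (l : ℤ))
    {F G : JSinf} (hF : (F : dom → ℂ) = pullTau f) (hG : (G : dom → ℂ) = pullTau g) :
    ∃ h : ModularForm 𝒮ℒ ((k + l + 2 * n : ℕ) : ℤ),
      (h : ℍ → ℂ) = ((Real.pi : ℂ) ^ 2) ^ n • classicalRankinCohen n k l f g ∧
      (B n F G : dom → ℂ) = pullTau h := by
  obtain ⟨h, hh⟩ := exists_modularForm_classicalRankinCohen (((Real.pi : ℂ) ^ 2) ^ n) n f g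
  refine ⟨h, hh, ?_⟩
  rw [hB n k l F G (hF ▸ pullTau_mem_quasiJacobi f) (hG ▸ pullTau_mem_quasiJacobi g), hF, hG,
    sum_dTau_pullTau (ModularFormClass.holo f) (ModularFormClass.holo g), hh]

lemma modularForms_induction {motive : (F : JSinf) → Prop}
    (mem : ∀ (k : ℕ) (f : ModularForm 𝒮ℒ (k : ℤ)) (F : JSinf),
      (F : dom → ℂ) = pullTau f → motive F)
    (add : ∀ F G, motive F → motive G → motive (F + G))
    (smul : ∀ (c : ℂ) F, motive F → motive (c • F))
    (F : JSinf) (hF : (F : dom → ℂ) ∈ modularForms) : motive F := by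
  obtain ⟨F, hF'⟩ := F
  have hF : F ∈ Submodule.span ℂ {F | ∃ (k : ℕ) (f : ModularForm 𝒮ℒ (k : ℤ)), F = pullTau f} := hF
  induction hF using Submodule.span_induction with
  | zero => exact mem 0 0 0 rfl
  | mem F h =>
    obtain ⟨k, f, rfl⟩ := h
    exact mem k f _ rfl
  | add F G hF₁ hG₁ ihF ihG =>
    exact add ⟨F, modularForms_le_JSinf hF₁⟩ ⟨G, modularForms_le_JSinf hG₁⟩ (ihF _ hF₁) (ihG _ hG₁)
  | smul c F hF₁ ih => exact smul c ⟨F, modularForms_le_JSinf hF₁⟩ (ih _ hF₁)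

lemma IsRankinCohen.mem_modularForms {B : ℕ → JSinf →ₗ[ℂ] JSinf →ₗ[ℂ] JSinf}
    (hB : IsRankinCohen B) (n : ℕ) {F G : JSinf} (hF : (F : dom → ℂ) ∈ modularForms)
    (hG : (G : dom → ℂ) ∈ modularForms) : (B n F G : dom → ℂ) ∈ modularForms := by
  refine modularForms_induction (motive := fun F => (B n F G : dom → ℂ) ∈ modularForms)
    (fun k f F hf => ?_) (fun F F' h h' => ?_) (fun c F h => ?_) F hF
  · refine modularForms_induction (motive := fun G => (B n F G : dom → ℂ) ∈ modularForms)
      (fun l g G hg => ?_) (fun G G' h h' => ?_) (fun c G h => ?_) G hG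
    · obtain ⟨h, -, hh⟩ := hB.exists_modularForm n k l f g hf hg
      rw [hh]
      exact Submodule.subset_span ⟨_, h, rfl⟩
    · rw [map_add]
      exact add_mem h h'
    · rw [map_smul]
      exact Subalgebra.smul_mem _ h c
  · rw [map_add, LinearMap.add_apply]
    exact add_mem h h'
  · rw [map_smul, LinearMap.smul_apply]
    exact Subalgebra.smul_mem _ h c

end

end QuasiJacobi

open QuasiJacobi in
theorem mainTheorem8 :
    (∃! B : ℕ → JSinf →ₗ[ℂ] JSinf →ₗ[ℂ] JSinf, IsRankinCohen B) ∧
    ∀ B : ℕ → JSinf →ₗ[ℂ] JSinf →ₗ[ℂ] JSinf, IsRankinCohen B →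
      -- the `n`-th bracket raises the total weight by `2n`
      (∀ (n k l : ℕ) (f g : JSinf),
        (f : dom → ℂ) ∈ quasiJacobi k → (g : dom → ℂ) ∈ quasiJacobi l →
          (B n f g : dom → ℂ) ∈ quasiJacobi (k + l + 2 * n)) ∧
      -- the brackets are a formal deformation of `JS^∞`
      IsFormalDeformation B ∧
      -- `M` is a subalgebra of `JS^∞`, stable under the brackets
      modularForms ≤ JSinf ∧
      (∀ (n : ℕ) (f g : JSinf),
        (f : dom → ℂ) ∈ modularForms → (g : dom → ℂ) ∈ modularForms →
          (B n f g : dom → ℂ) ∈ modularForms) ∧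
      -- on modular forms they are the classical Rankin-Cohen brackets (here `∂_τ = π² D`)
      (∀ (n k l : ℕ) (f : ModularForm 𝒮ℒ (k : ℤ)) (g : ModularForm 𝒮ℒ (l : ℤ)) (F G : JSinf),
        (F : dom → ℂ) = pullTau f → (G : dom → ℂ) = pullTau g →
          ∃ h : ModularForm 𝒮ℒ ((k + l + 2 * n : ℕ) : ℤ),
            (h : ℍ → ℂ) = ((Real.pi : ℂ) ^ 2) ^ n • classicalRankinCohen n k l f g ∧
            (B n F G : dom → ℂ) = pullTau h) := by
  refine ⟨existsUnique_isRankinCohen, fun B hB => ⟨fun n k l f g hf hg => hB.mem_quasiJacobi hf hg,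
    hB.isFormalDeformation, modularForms_le_JSinf,
    fun n f g hf hg => hB.mem_modularForms n hf hg, fun n k l f g F G hF hG =>
      hB.exists_modularForm n k l f g hF hG⟩⟩
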